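/- Let $(A,\mathfrak m)$ be a (Noetherian) Cohen-Macaulay local ring with infinite residue field which is not regular, and let $L$ be a maximal Cohen-Macaulay (MCM) $A$-module, i.e. a finitely generated $A$-module with $\operatorname{depth}L=\dim A$. Let $M=\operatorname{Syz}^A_1(L)$ be the first syzygy module of $L$, i.e. the kernel of a minimal free cover $A^r\to L$. Assume that $M\neq 0$ and that $M_P$ is a free $A_P$-module for every $P\in\operatorname{Spec}(A)\smallsetminus\{\mathfrak m\}$. For an ideal $J$ of $A$ put $G_J(A)=\bigoplus_{n\ge 0}J^n/J^{n+1}$, $G_J(A)_+=\bigoplus_{n\ge 1}J^n/J^{n+1}$ and $G_J(M)=\bigoplus_{n\ge 0}J^nM/J^{n+1}M$, and let $\operatorname{grade}(\mathfrak a,N)$ be the length of a maximal $N$-regular sequence in $\mathfrak a$ (it is $\infty$ if $\mathfrak aN=N$). For an ideal $I$ of $A$ let $\operatorname{Ass}^\infty_I(M)$ be the constant value of $\operatorname{Ass}_A(M/I^nM)$ for $n\gg 0$. Let $\mathcal R(I)=\bigoplus_{n\ge 0}I^nt^n$ be the Rees ring, $R_+=\bigoplus_{n\ge 1}I^nt^n$,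 let $L^I(M)=\bigoplus_{n\ge 0}M/I^{n+1}M$ with its structure of graded $\mathcal R(I)$-module (for which $L^I(M)(-1)$ is the quotient of $M[t,t^{-1}]$ by $\bigoplus_{n\in\mathbb Z}I^nMt^n$, where $I^n=A$ for $n\le 0$), and write $H^i(-)$ for the graded local cohomology modules $H^i_{R_+}(-)$. With $g=\operatorname{grade}(I,M)$ let $$\xi_I(M)=\min\bigl(\{g\}\cup\{\,0\le i\le g-1:\ H^i(L^I(M))_{-1}\ne 0\ \text{or}\ H^i(L^I(M))_j\neq 0\text{ for infinitely many }j<0\}\bigr),$$ $$\operatorname{amp}_I(M)=\max\{\,|n|:\ H^i(L^I(M))_{n-1}\neq 0\ \text{for some}\ 0\le i\le \xi_I(M)-1\}$$ (a supremum in $\mathbb N\cup\{\infty\}$, which is $0$ if there is no such $n$). Let $I$ be an ideal of $A$ such that $\operatorname{grade}(G_{I^n}(A)_+,G_{I^n}(A))\ge 2$ for all $n\gg 0$. If $\mathfrak m\notin\operatorname{Ass}^\infty_I(M)$, then $\operatorname{amp}_I(M)<\infty$ and $$\operatorname{grade}(G_{I^n}(A)_+,G_{I^n}(M))\ge 2\quad\text{for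 every } n>\operatorname{amp}_I(M).$$ -/

import Mathlib

set_option maxSynthPendingDepth 3

open Filter

noncomputable section

namespace AsymptoticGrade

/-! ### Grade, Cohen-Macaulay modules, syzygies, asymptotic associated primes -/

/-- The grade of an ideal `J` on a module `N`: the supremum of the lengths of the sequences in `J`
in which every element is a nonzerodivisor on `N` modulo its predecessors.  For `N` finitely
generated over a Noetherian ring this is the common length of the maximal `N`-regular sequences
in `J` when `J N ≠ N`, and it is `∞` when `J N = N` (the usual convention). -/
def grade {R : Type*} [CommRing R] (J : Ideal R) (N : Type*) [AddCommGroup N] [Module R N] : ℕ∞ :=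
  ⨆ rs ∈ {rs : List R | (∀ r ∈ rs, r ∈ J) ∧ RingTheory.Sequence.IsWeaklyRegular N rs},
    (rs.length : ℕ∞)

/-- A maximal Cohen-Macaulay module over a (Noetherian) local ring: finitely generated, of depth
`dim A`. (The zero module is excluded, its depth being `∞`.) -/
def IsMaximalCohenMacaulay (A : Type*) [CommRing A] [IsLocalRing A]
    (L : Type*) [AddCommGroup L] [Module A L] : Prop :=
  Module.Finite A L ∧
    ((grade (IsLocalRing.maximalIdeal A) L : ℕ∞) : WithBot ℕ∞) = ringKrullDim A

/-- A Cohen-Macaulay local ring: Noetherian, of depth equal to its dimension. -/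
def IsCohenMacaulayLocalRing (A : Type*) [CommRing A] [IsLocalRing A] : Prop :=
  IsNoetherianRing A ∧ IsMaximalCohenMacaulay A A

/-- `M` is (isomorphic to) the first syzygy module of `L`, i.e. the kernel of a minimal
free cover `A^r → L`. -/
def IsFirstSyzygy (A : Type*) [CommRing A] [IsLocalRing A] (L : Type*) [AddCommGroup L] [Module A L]
    (M : Type*) [AddCommGroup M] [Module A M] : Prop :=
  ∃ (r : ℕ) (f : (Fin r → A) →ₗ[A] L), Function.Surjective f ∧
    LinearMap.ker f ≤ IsLocalRing.maximalIdeal A • (⊤ : Submodule A (Fin r → A)) ∧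
    Nonempty (M ≃ₗ[A] LinearMap.ker f)

/-- `M_P` is a free `A_P`-module for every non-maximal prime `P` of the local ring `A`. -/
def IsFreeOnPuncturedSpectrum (A : Type*) [CommRing A] [IsLocalRing A]
    (M : Type*) [AddCommGroup M] [Module A M] : Prop :=
  ∀ (P : Ideal A) [P.IsPrime], P ≠ IsLocalRing.maximalIdeal A →
    Module.Free (Localization.AtPrime P) (LocalizedModule P.primeCompl M)

/-- The set `Ass^∞_I(M)`.  For `M` finitely generated over a Noetherian ring, the sets
`Ass(M/I^nM)` do not depend on `n` for `n ≫ 0`; the stable value is then the set of the primes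
that belong to `Ass(M/I^nM)` for arbitrarily large `n`. -/
def assInfty {A : Type*} [CommRing A] (I : Ideal A) (M : Type*) [AddCommGroup M] [Module A M] :
    Set (Ideal A) :=
  {P | ∃ᶠ n : ℕ in atTop, P ∈ associatedPrimes A (M ⧸ (I ^ n • ⊤ : Submodule A M))}

/-! ### Rees rings and associated graded rings and modules -/

section Graded

variable {A : Type*} [CommRing A] (I : Ideal A)

/-- The ideal `R_+ = ⨁_{n ≥ 1} I^n t^n` of the Rees ring `R(I) = ⨁_{n ≥ 0} I^n t^n ⊆ A[t]`. -/
def reesIrrelevant : Ideal (reesAlgebra I) :=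
  RingHom.ker ((Polynomial.constantCoeff (R := A)).comp (reesAlgebra I).val.toRingHom)

/-- The elements `a t^d` of degree `d` of the Rees ring. -/
def reesHomogeneous (d : ℕ) : Set (reesAlgebra I) :=
  {s | ∃ a : A, (s : Polynomial A) = Polynomial.monomial d a}

/-- The Rees module `R(I, M) = ⨁_{n ≥ 0} I^n M t^n ⊆ M[t]`, an `R(I)`-submodule of `M[t]`. -/
abbrev reesModule (M : Type*) [AddCommGroup M] [Module A M] :
    Submodule (reesAlgebra I) (PolynomialModule A M) :=
  (I.stableFiltration (⊤ : Submodule A M)).submodule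

/-- The ideal `I R(I) = ⨁_{n ≥ 0} I^{n+1} t^n` of the Rees ring. -/
abbrev reesExtension : Ideal (reesAlgebra I) :=
  I.map (algebraMap A (reesAlgebra I))

/-- The associated graded ring `G_I(A) = R(I) / I R(I) = ⨁_{n ≥ 0} I^n / I^{n+1}`. -/
abbrev GRing : Type _ := reesAlgebra I ⧸ reesExtension I

/-- The associated graded module `G_I(M) = R(I, M) / I R(I, M) = ⨁_{n ≥ 0} I^n M / I^{n+1} M`,
a module over `G_I(A)`. -/
abbrev GModule (M : Type*) [AddCommGroup M] [Module A M] : Type _ :=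
  reesModule I M ⧸ (reesExtension I • ⊤ : Submodule (reesAlgebra I) (reesModule I M))

/-- The irrelevant ideal `G_I(A)_+ = ⨁_{n ≥ 1} I^n / I^{n+1}` of `G_I(A)`. -/
def GIrrelevant : Ideal (GRing I) :=
  (reesIrrelevant I).map (Ideal.Quotient.mk (reesExtension I))

/-- The `R(I)`-module `L^I(M) = ⨁_{n ≥ 0} M / I^{n+1} M`.  Up to the shift of the grading by one it
is the cokernel of the inclusion of the extended Rees module of `M` in `M[t, t⁻¹]`; as the two
agree in negative degrees, it is also the quotient of `M[t]` by the Rees module, the class of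
`m t^k` being the class of `m` in `M / I^k M` (which is zero for `k = 0`). -/
abbrev LModule (M : Type*) [AddCommGroup M] [Module A M] : Type _ :=
  PolynomialModule A M ⧸ reesModule I M

/-- The elements of degree `n` of `L^I(M)`: the component of degree `n` is `M / I^{n+1} M`, which
consists of the classes of the elements `m t^{n+1}`; it is zero for `n < 0`. -/
def LHomogeneous (M : Type*) [AddCommGroup M] [Module A M] (n : ℤ) : Set (LModule I M) :=
  {e | e = 0 ∨ ∃ (k : ℕ) (m : M), (k : ℤ) = n + 1 ∧
    e = (reesModule I M).mkQ (PolynomialModule.single A k m)}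

end Graded

/-! ### Local cohomology through the Čech complex, with its grading -/

section Cech

variable {R : Type*} [CommRing R] {m : ℕ} (f : Fin m → R) (E : Type*) [AddCommGroup E] [Module R E]

/-- The multiplicative set generated by the elements `f (σ 0), …, f (σ (p - 1))`. -/
def cechDenominators {p : ℕ} (σ : Fin p ↪o Fin m) : Submonoid R :=
  Submonoid.closure (Set.range (f ∘ σ))

/-- The term of (cohomological) degree `p` of the Čech complex
`0 → E → ⨁ E_{f i} → ⨁_{i < j} E_{f i * f j} → ⋯ → E_{f 0 ⋯ f (m - 1)} → 0`. -/
abbrev CechModule (p : ℕ) : Type _ :=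
  (σ : Fin p ↪o Fin m) → LocalizedModule (cechDenominators f σ) E

/-- The increasing sequence `σ` without its `k`-th term. -/
def cechFace {p : ℕ} (σ : Fin (p + 1) ↪o Fin m) (k : Fin (p + 1)) : Fin p ↪o Fin m :=
  (Fin.succAboveOrderEmb k).trans σ

lemma cechDenominators_face_le {p : ℕ} (σ : Fin (p + 1) ↪o Fin m) (k : Fin (p + 1)) :
    cechDenominators f (cechFace σ k) ≤ cechDenominators f σ :=
  Submonoid.closure_mono (by rintro _ ⟨i, rfl⟩; exact ⟨k.succAbove i, rfl⟩)

/-- The differential of the Čech complex: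
`(d z)_σ = ∑ₖ (-1)^k z_{σ without its k-th term}`, taken in the localization at `σ`. -/
def cechD (p : ℕ) : CechModule f E p →ₗ[R] CechModule f E (p + 1) :=
  LinearMap.pi fun σ => ∑ k : Fin (p + 1), (-1 : R) ^ (k : ℕ) •
    (LocalizedModule.liftOfLE _ _ (cechDenominators_face_le f σ k)).comp
      (LinearMap.proj (cechFace σ k))

/-- The coboundaries in the Čech complex. -/
def cechBoundaries : (p : ℕ) → Submodule R (CechModule f E p)
  | 0 => ⊥
  | p + 1 => LinearMap.range (cechD f E p)

/-- The cohomology of the Čech complex, i.e. the local cohomology `H^p_J(E)` with respect to the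
ideal `J` generated by the `f i` (for `R` Noetherian). -/
abbrev CechCohomology (p : ℕ) : Type _ :=
  LinearMap.ker (cechD f E p) ⧸ (cechBoundaries f E p).submoduleOf (LinearMap.ker (cechD f E p))

variable {E}

/-- A Čech cochain is homogeneous of degree `n` if all its components are fractions `e / s` with
`s` homogeneous of some degree `d` and `e` homogeneous of degree `n + d`. Here `𝒜 d` is the set of
elements of degree `d` of the ring, `ℰ n` the set of elements of degree `n` of the module. -/
def IsCechHomogeneous (𝒜 : ℕ → Set R) (ℰ : ℤ → Set E) (n : ℤ) {p : ℕ}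
    (z : CechModule f E p) : Prop :=
  ∀ σ : Fin p ↪o Fin m, ∃ (d : ℕ) (s : cechDenominators f σ) (e : E),
    (s : R) ∈ 𝒜 d ∧ e ∈ ℰ (n + d) ∧ z σ = LocalizedModule.mk e s

/-- The graded component of degree `n` of the local cohomology: it consists of the classes of the
cocycles that are homogeneous of degree `n`. -/
def cechCohomologyComponent (𝒜 : ℕ → Set R) (ℰ : ℤ → Set E) (p : ℕ) (n : ℤ) :
    AddSubgroup (CechCohomology f E p) :=
  AddSubgroup.closure
    {c | ∃ z : LinearMap.ker (cechD f E p), IsCechHomogeneous f 𝒜 ℰ n (z : CechModule f E p) ∧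
      c = Submodule.Quotient.mk z}

end Cech

/-! ### The invariants `ξ_I(M)` and `amp_I(M)` -/

section Invariants

variable {A : Type*} [CommRing A] [IsNoetherianRing A] (I : Ideal A)

lemma exists_generators :
    ∃ (m : ℕ) (x : Fin m → A), Submodule.span A (Set.range x) = I :=
  Submodule.fg_iff_exists_fin_generating_family.1 (IsNoetherian.noetherian I)

/-- The size of a chosen finite generating family of the ideal `I`. -/
def numGenerators : ℕ := (exists_generators I).choose

/-- A chosen finite generating family of the ideal `I`. -/
def generators : Fin (numGenerators I) → A := (exists_generators I).choose_spec.choose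

lemma span_generators : Submodule.span A (Set.range (generators I)) = I :=
  (exists_generators I).choose_spec.choose_spec

lemma generators_mem (i : Fin (numGenerators I)) : generators I i ∈ I :=
  (span_generators I).le (Submodule.subset_span ⟨i, rfl⟩)

/-- The elements `x_1 t, …, x_m t` of the Rees ring, where `I = (x_1, …, x_m)`; they generate the
ideal `R_+`. -/
def reesGenerators (i : Fin (numGenerators I)) : reesAlgebra I :=
  ⟨Polynomial.monomial 1 (generators I i), reesAlgebra.monomial_mem.2 (by
    rw [pow_one]; exact generators_mem I i)⟩

variable (M : Type*) [AddCommGroup M] [Module A M]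

/-- The graded component `H^i(L^I(M))_n` of the local cohomology module `H^i_{R_+}(L^I(M))`. -/
def HL (i : ℕ) (n : ℤ) : AddSubgroup (CechCohomology (reesGenerators I) (LModule I M) i) :=
  cechCohomologyComponent (reesGenerators I) (reesHomogeneous I) (LHomogeneous I M) i n

/-- `ξ_I(M)`: the minimum of `g = grade(I, M)` and of those `i` with `0 ≤ i ≤ g - 1` for which
`H^i(L^I(M))_{-1} ≠ 0`, or `H^i(L^I(M))_j ≠ 0` for infinitely many `j < 0`. -/
def xi : ℕ∞ :=
  sInf ({grade I M} ∪ {a | ∃ i : ℕ, a = i ∧ (i : ℕ∞) < grade I M ∧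
    (HL I M i (-1) ≠ ⊥ ∨ {j : ℤ | j < 0 ∧ HL I M i j ≠ ⊥}.Infinite)})

/-- The amplitude `amp_I(M)`: the supremum of all `|n|` such that `H^i(L^I(M))_{n-1} ≠ 0` for some
`i` with `0 ≤ i ≤ ξ_I(M) - 1` (and `0` if there is no such `n`). -/
def amp : ℕ∞ :=
  sSup {a | ∃ (n : ℤ) (i : ℕ), a = (n.natAbs : ℕ∞) ∧ (i : ℕ∞) < xi I M ∧ HL I M i (n - 1) ≠ ⊥}

end Invariants

end AsymptoticGrade

end

/-!
The modules `L^I(M)` see `G_{I ^ n}(M)` through their local cohomology in low degrees, and the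
hypotheses on `M` serve to show that `ξ_I(M) ≥ 2`, so that this cohomology vanishes outside of the
range measured by `amp_I(M)`.

*The syzygy.* Let `0 → M → F → L → 0` be exact with `F` free. The elements of `A` whose
multiplication on `M` extends to a homomorphism `F → M` form an ideal `𝔠`. For a prime `P ≠ 𝔪`, a
maximal sequence in `P` that is regular on `A` and `L` generates an ideal `K` with `K F ∩ M = K M`
and with `P` associated to `A / K`; this forces the free `A_P`-module `M_P` to split off `F_P`, so
`𝔠 ⊄ P`. As `𝔠` multiplies `I ^ n F ∩ M` into `I ^ n M`, and `𝔪` is not associated to `M / I ^ n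
M`, we get `I ^ n F ∩ M = I ^ n M` for `n` large (`eventually_mem_smul_top_of_syzygy`).

*Local cohomology.* The Čech complex of `L^I(M)` is graded, and its classes are killed by powers
of the elements of `R_+`. If `u ∈ I` is superficial (one exists as the residue field is infinite),
then `u t` is injective on `L^I(M)` in large degrees, with cokernel `L^I(M / u M)`; so
`H^i(L^I(M))_n = 0` for `n ≫ 0` and `i < grade(I, M)`, by induction on `i`
(`exists_forall_HL_eq_bot`). In negative degrees the vanishing for almost all degrees is built
into `ξ_I(M)`. This gives `amp_I(M) < ∞` (`amp_lt_top`).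

*The bound `ξ_I(M) ≥ 2`.* In cohomological degrees `0` and `1` the vanishing of `H^i(L^I(M))_{n -
1}` can be written in terms of elements: with `I = (x_1, …, x_m)`, it is about the solutions of
`x_a ^ k e_b ≡ x_b ^ k e_a` modulo powers of `I`. If `grade(G_J(A)_+, G_J(A)) ≥ 2` for `J = I ^
c`, exactness of a Koszul complex over `G_J(A)` determines these solutions in `A`, hence in `F`,
and the equality `I ^ n F ∩ M = I ^ n M` brings them down to `M` (`HL_one_eq_bot_of_GRing`). This
uses `c` arbitrary for the degree `-1`, and the degree `-c - 1` for all `c ≫ 0`. The same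
exactness gives `grade(I, A) ≥ 2`, and then `grade(I, M) ≥ 2`, since a nonzerodivisor of `A` is
regular on the maximal Cohen-Macaulay module `L`.

*The conclusion.* For `c > amp_I(M)` we now have `H^i(L^I(M))_{c p - 1} = 0` for `i = 0, 1` and
all `p ≥ 0`. Read in terms of elements again, this says that the Koszul cohomology of `G_{I ^
c}(M)` with respect to the elements `y t`, `y ∈ I ^ c`, vanishes in degrees `0` and `1`, which
means that `grade(G_{I ^ c}(A)_+, G_{I ^ c}(M)) ≥ 2` (`hasWeaklyRegularSeq_two_GModule`).

If `I = A`, all the modules involved are zero.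
-/

namespace AsymptoticGrade

open RingTheory.Sequence Pointwise

/-! ### Regular sequences and grade -/

section Depth

variable {R : Type*} [CommRing R]

/-- The ideal `J` contains an `N`-regular sequence of length `k` (in the weak sense: `J N = N` is
allowed). -/
def HasWeaklyRegularSeq (J : Ideal R) (k : ℕ) (N : Type*) [AddCommGroup N] [Module R N] : Prop :=
  ∃ rs : List R, rs.length = k ∧ (∀ r ∈ rs, r ∈ J) ∧ IsWeaklyRegular N rs

variable {J : Ideal R} {N : Type*} [AddCommGroup N] [Module R N]

lemma hasWeaklyRegularSeq_zero : HasWeaklyRegularSeq J 0 N :=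
  ⟨[], rfl, by simp, IsWeaklyRegular.nil R N⟩

lemma hasWeaklyRegularSeq_succ_iff {k : ℕ} :
    HasWeaklyRegularSeq J (k + 1) N ↔
      ∃ x ∈ J, IsSMulRegular N x ∧ HasWeaklyRegularSeq J k (QuotSMulTop x N) := by
  constructor
  · rintro ⟨rs, hl, hm, hr⟩
    match rs with
    | [] => simp at hl
    | x :: rs =>
      rw [isWeaklyRegular_cons_iff] at hr
      exact ⟨x, hm x (by simp), hr.1, rs, by simpa using hl, fun r h => hm r (by simp [h]), hr.2⟩
  · rintro ⟨x, hx, hr, rs, hl, hm, hw⟩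
    exact ⟨x :: rs, by simp [hl], by simpa using ⟨hx, hm⟩,
      (isWeaklyRegular_cons_iff _ _ _).2 ⟨hr, hw⟩⟩

lemma HasWeaklyRegularSeq.of_le {k l : ℕ} (h : HasWeaklyRegularSeq J k N) (hl : l ≤ k) :
    HasWeaklyRegularSeq J l N := by
  obtain ⟨rs, hk, hm, hr⟩ := h
  refine ⟨rs.take l, by simp [hk, hl], fun r h => hm r (List.mem_of_mem_take h), ?_⟩
  rw [← List.take_append_drop l rs] at hr
  exact ((isWeaklyRegular_append_iff _ _ _).1 hr).1

lemma HasWeaklyRegularSeq.mono {J' : Ideal R} {k : ℕ} (h : HasWeaklyRegularSeq J k N)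
    (hJ : J ≤ J') : HasWeaklyRegularSeq J' k N := by
  obtain ⟨rs, hk, hm, hr⟩ := h
  exact ⟨rs, hk, fun r hr => hJ (hm r hr), hr⟩

lemma HasWeaklyRegularSeq.congr {N' : Type*} [AddCommGroup N'] [Module R N'] (e : N ≃ₗ[R] N')
    {k : ℕ} (h : HasWeaklyRegularSeq J k N) : HasWeaklyRegularSeq J k N' := by
  obtain ⟨rs, hk, hm, hr⟩ := h
  exact ⟨rs, hk, hm, (e.isWeaklyRegular_congr rs).1 hr⟩

lemma le_grade_iff {k : ℕ} : (k : ℕ∞) ≤ grade J N ↔ HasWeaklyRegularSeq J k N := by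
  constructor
  · intro h
    rcases Nat.eq_zero_or_pos k with rfl | hk
    · exact hasWeaklyRegularSeq_zero
    by_contra hcon
    have : grade J N ≤ ((k - 1 : ℕ) : ℕ∞) := by
      refine iSup₂_le fun rs hrs => ?_
      by_contra hlt
      have hlt' : k ≤ rs.length := by
        have : k - 1 < rs.length := by exact_mod_cast not_le.1 hlt
        omega
      exact hcon (HasWeaklyRegularSeq.of_le ⟨rs, rfl, hrs.1, hrs.2⟩ hlt')
    have := h.trans this
    have : k ≤ k - 1 := by exact_mod_cast this
    omega
  · rintro ⟨rs, rfl, hm, hr⟩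
    exact le_iSup₂_of_le (f := fun (rs : List R) (_ : rs ∈ {rs : List R | (∀ r ∈ rs, r ∈ J) ∧
      RingTheory.Sequence.IsWeaklyRegular N rs}) => (rs.length : ℕ∞)) rs ⟨hm, hr⟩ le_rfl

/-- Dividing out by two elements, in either order. -/
noncomputable def quotSMulTopComm (x y : R) (N : Type*) [AddCommGroup N] [Module R N] :
    QuotSMulTop x (QuotSMulTop y N) ≃ₗ[R] QuotSMulTop y (QuotSMulTop x N) := by
  have key : ∀ a b : R, (a • (⊤ : Submodule R (QuotSMulTop b N))) =
      (a • (⊤ : Submodule R N)).map (b • (⊤ : Submodule R N)).mkQ := by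
    intro a b
    rw [Submodule.map_pointwise_smul, Submodule.map_top, Submodule.range_mkQ]
  exact (Submodule.quotEquivOfEq _ _ (key x y)).trans
    ((Submodule.quotientQuotientEquivQuotientSup _ _).trans
    ((Submodule.quotEquivOfEq _ _ (sup_comm _ _)).trans
    ((Submodule.quotientQuotientEquivQuotientSup _ _).symm.trans
    (Submodule.quotEquivOfEq _ _ (key y x).symm))))

/-- An ideal that kills no nonzero element of a finitely generated module contains a
nonzerodivisor on the module. -/
lemma exists_isSMulRegular_of_forall_eq_zero [IsNoetherianRing R] [Module.Finite R N]
    (h : ∀ n : N, (∀ r ∈ J, r • n = 0) → n = 0) : ∃ x ∈ J, IsSMulRegular N x := by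
  by_contra! hcon
  have hsub : (J : Set R) ⊆ ⋃ p ∈ associatedPrimes R N, (p : Set R) := by
    intro r hr
    rw [biUnion_associatedPrimes_eq_compl_regular]
    exact hcon r hr
  obtain ⟨p, hp, hJp⟩ := (J.subset_union_prime_finite (associatedPrimes.finite R N) (f := id) 0 0
    fun _ h _ _ => IsAssociatedPrime.isPrime h).1 hsub
  obtain ⟨hpp, n, rfl⟩ := isAssociatedPrime_iff.1 hp
  have : n = 0 := h n fun r hr => by
    have := hJp hr
    simpa [Submodule.mem_colon_singleton] using this
  subst this
  exact hpp.ne_top (by ext; simp [Submodule.mem_colon_singleton])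

lemma quotSMulTop_mk_eq_zero {x : R} {n : N} :
    (Submodule.Quotient.mk n : QuotSMulTop x N) = 0 ↔ ∃ n', x • n' = n := by
  rw [Submodule.Quotient.mk_eq_zero, Submodule.mem_smul_pointwise_iff_exists]
  simp

/-- If `x`, `y` are nonzerodivisors on `N` in `J` and `J` kills no nonzero element of `N / y N`,
then it kills no nonzero element of `N / x N`. -/
lemma quotSMulTop_eq_zero_of_swap {x y : R} (hyJ : y ∈ J) (hx : IsSMulRegular N x)
    (hy : IsSMulRegular N y)
    (h : ∀ n : QuotSMulTop y N, (∀ r ∈ J, r • n = 0) → n = 0)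
    (n : QuotSMulTop x N) (hn : ∀ r ∈ J, r • n = 0) : n = 0 := by
  obtain ⟨n, rfl⟩ := Submodule.Quotient.mk_surjective _ n
  have hn' : ∀ r ∈ J, ∃ n', x • n' = r • n := fun r hr => quotSMulTop_mk_eq_zero.1 (hn r hr)
  obtain ⟨n', hn'y⟩ := hn' y hyJ
  have hz : (Submodule.Quotient.mk n' : QuotSMulTop y N) = 0 := by
    apply h
    intro r hr
    obtain ⟨n'', hn''⟩ := hn' r hr
    refine quotSMulTop_mk_eq_zero.2 ⟨n'', hx ?_⟩
    change x • y • n'' = x • r • n'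
    rw [smul_comm x y, hn'', smul_comm y r, ← hn'y, smul_comm]
  obtain ⟨e, rfl⟩ := quotSMulTop_mk_eq_zero.1 hz
  refine quotSMulTop_mk_eq_zero.2 ⟨e, hy ?_⟩
  change y • x • e = y • n
  rw [← hn'y, smul_comm]

lemma eq_zero_of_isSMulRegular {x : R} (hxJ : x ∈ J) (hx : IsSMulRegular N x)
    (n : N) (hn : ∀ r ∈ J, r • n = 0) : n = 0 := by
  refine hx ?_
  change x • n = x • 0
  rw [hn x hxJ, smul_zero]

lemma isSMulRegular_swap [IsLocalRing R] [IsNoetherianRing R] [Module.Finite R N]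
    {x y : R} (hxm : x ∈ IsLocalRing.maximalIdeal R) (hym : y ∈ IsLocalRing.maximalIdeal R)
    (hx : IsSMulRegular N x) (hy : IsSMulRegular (QuotSMulTop x N) y) :
    IsSMulRegular N y ∧ IsSMulRegular (QuotSMulTop y N) x := by
  have h1 : IsWeaklyRegular N [x, y] := by simp [isWeaklyRegular_cons_iff, hx, hy]
  have h2 := IsLocalRing.isWeaklyRegular_of_perm_of_subset_maximalIdeal h1
    (List.Perm.swap y x []) fun r hr => by
      rcases List.mem_pair.1 hr with rfl | rfl <;> assumption
  simpa [isWeaklyRegular_cons_iff] using h2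

/-- All maximal regular sequences in an ideal have the same length: dividing by a nonzerodivisor
of the ideal lowers the available length of regular sequences by exactly one. -/
theorem HasWeaklyRegularSeq.quotSMulTop [IsLocalRing R] [IsNoetherianRing R]
    (hJ : J ≤ IsLocalRing.maximalIdeal R) {k : ℕ} :
    ∀ {N : Type*} [AddCommGroup N] [Module R N] [Module.Finite R N],
    HasWeaklyRegularSeq J (k + 1) N → ∀ {x : R}, x ∈ J → IsSMulRegular N x →
      HasWeaklyRegularSeq J k (QuotSMulTop x N) := by
  induction k with
  | zero => intros; exact hasWeaklyRegularSeq_zero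
  | succ k ih =>
    intro N _ _ _ h x hxJ hx
    obtain ⟨y, hyJ, hy, hk⟩ := hasWeaklyRegularSeq_succ_iff.1 h
    obtain ⟨y₂, hy₂J, hy₂, -⟩ := hasWeaklyRegularSeq_succ_iff.1 hk
    have hty := eq_zero_of_isSMulRegular (N := QuotSMulTop y N) hy₂J hy₂
    have htx := quotSMulTop_eq_zero_of_swap hyJ hx hy hty
    -- a common nonzerodivisor `z` on `N / x N` and `N / y N` links the two sequences
    obtain ⟨z, hzJ, hz⟩ := exists_isSMulRegular_of_forall_eq_zero (J := J)
      (N := QuotSMulTop x N × QuotSMulTop y N) fun n hn => Prod.ext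
        (htx n.1 fun r hr => congrArg Prod.fst (hn r hr))
        (hty n.2 fun r hr => congrArg Prod.snd (hn r hr))
    have hzx : IsSMulRegular (QuotSMulTop x N) z := fun a b hab =>
      congrArg Prod.fst (hz (a₁ := (a, 0)) (a₂ := (b, 0)) (Prod.ext hab rfl))
    have hzy : IsSMulRegular (QuotSMulTop y N) z := fun a b hab =>
      congrArg Prod.snd (hz (a₁ := (0, a)) (a₂ := (0, b)) (Prod.ext rfl hab))
    obtain ⟨hzN, hyz⟩ := isSMulRegular_swap (hJ hyJ) (hJ hzJ) hy hzy
    obtain ⟨-, hxz⟩ := isSMulRegular_swap (hJ hxJ) (hJ hzJ) hx hzx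
    have h1 : HasWeaklyRegularSeq J (k + 1) (QuotSMulTop z N) :=
      hasWeaklyRegularSeq_succ_iff.2 ⟨y, hyJ, hyz, (ih hk hzJ hzy).congr (quotSMulTopComm z y N)⟩
    exact hasWeaklyRegularSeq_succ_iff.2
      ⟨z, hzJ, hzx, (ih h1 hxJ hxz).congr (quotSMulTopComm x z N)⟩

end Depth

/-! ### Depth and the dimension of associated primes -/

section Dimension

variable {A : Type*} [CommRing A]

lemma ringKrullDim_quotient_lt {P Q : Ideal A} [P.IsPrime] [Q.IsPrime] (h : P < Q) :
    ringKrullDim (A ⧸ Q) + 1 ≤ ringKrullDim (A ⧸ P) := by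
  obtain ⟨x, hxQ, hxP⟩ := Set.exists_of_ssubset h
  have hx : Ideal.Quotient.mk P x ∈ nonZeroDivisors (A ⧸ P) :=
    mem_nonZeroDivisors_of_ne_zero (by rwa [ne_eq, Ideal.Quotient.eq_zero_iff_mem])
  refine le_trans ?_ (ringKrullDim_quotient_succ_le_of_nonZeroDivisor hx)
  gcongr
  let f : (A ⧸ P) ⧸ Ideal.span {Ideal.Quotient.mk P x} →+* A ⧸ Q :=
    Ideal.Quotient.lift _ (Ideal.Quotient.factor h.le) (by
      intro a ha
      obtain ⟨b, rfl⟩ := Ideal.mem_span_singleton'.1 ha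
      have : Ideal.Quotient.factor h.le (Ideal.Quotient.mk P x) = 0 := by
        rw [Ideal.Quotient.factor_mk, Ideal.Quotient.eq_zero_iff_mem]; exact hxQ
      rw [map_mul, this, mul_zero])
  refine ringKrullDim_le_of_surjective f ?_
  intro b
  obtain ⟨a, rfl⟩ := Ideal.Quotient.mk_surjective b
  exact ⟨Ideal.Quotient.mk _ (Ideal.Quotient.mk _ a), rfl⟩

variable [IsLocalRing A] [IsNoetherianRing A]

/-- The dimension of `A / Q`, for `Q` an associated prime of `N`, is at least the depth of `N`. -/
theorem le_ringKrullDim_quotient_of_mem_associatedPrimes {d : ℕ} :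
    ∀ {N : Type*} [AddCommGroup N] [Module A N] [Module.Finite A N],
    HasWeaklyRegularSeq (IsLocalRing.maximalIdeal A) d N → ∀ {Q : Ideal A},
      Q ∈ associatedPrimes A N → (d : WithBot ℕ∞) ≤ ringKrullDim (A ⧸ Q) := by
  induction d with
  | zero =>
    intro N _ _ _ _ Q hQ
    have := IsAssociatedPrime.isPrime hQ
    simpa using ringKrullDim_nonneg_of_nontrivial (R := A ⧸ Q)
  | succ d ih =>
    intro N _ _ _ h Q hQ
    obtain ⟨y, hym, hy, hd⟩ := hasWeaklyRegularSeq_succ_iff.1 h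
    obtain ⟨hQp, n, hn⟩ := isAssociatedPrime_iff.1 hQ
    let U : Submodule A N :=
      { carrier := {u | ∀ r ∈ Q, r • u = 0}
        add_mem' := fun ha hb r hr => by rw [smul_add, ha r hr, hb r hr, add_zero]
        zero_mem' := fun r _ => smul_zero r
        smul_mem' := fun c u hu r hr => by rw [smul_comm, hu r hr, smul_zero] }
    have hnU : n ∈ U := fun r hr => by
      rw [hn] at hr; simpa [Submodule.mem_colon_singleton] using hr
    -- an element of `U` outside of `y N`, by Nakayama
    have hex : ∃ u ∈ U, ¬ ∃ n', y • n' = u := by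
      by_contra! hcon
      have hU : U ≤ Ideal.span {y} • U := by
        intro u hu
        obtain ⟨n', rfl⟩ := hcon u hu
        refine Submodule.smul_mem_smul (Ideal.mem_span_singleton_self y) fun r hr => hy ?_
        change y • r • n' = y • 0
        rw [smul_comm, hu r hr, smul_zero]
      have hbot := Submodule.eq_bot_of_le_smul_of_le_jacobson_bot (Ideal.span {y}) U
        (IsNoetherian.noetherian U) hU (by
          rw [IsLocalRing.jacobson_eq_maximalIdeal _ bot_ne_top]
          simpa [Ideal.span_le] using hym)
      have hn0 : n = 0 := by simpa [hbot] using hnU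
      subst hn0
      exact hQp.ne_top (by rw [hn]; ext; simp [Submodule.mem_colon_singleton])
    obtain ⟨u, huU, hu⟩ := hex
    have hne : (Submodule.Quotient.mk u : QuotSMulTop y N) ≠ 0 := fun h0 =>
      hu (quotSMulTop_mk_eq_zero.1 h0)
    obtain ⟨Q', hQ', hle⟩ := exists_le_isAssociatedPrime_of_isNoetherianRing A _ hne
    have hQ'p := hQ'.isPrime
    have hQle : Q ≤ Q' := fun r hr => hle (by
      rw [Submodule.mem_colon_singleton, ← Submodule.Quotient.mk_smul, huU r hr]; simp)
    have hyQ' : y ∈ Q' := hle (by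
      rw [Submodule.mem_colon_singleton]
      exact quotSMulTop_mk_eq_zero.2 ⟨u, rfl⟩)
    have hyQ : y ∉ Q := fun hyQ => by
      rw [hn, Submodule.mem_colon_singleton] at hyQ
      have hn0 : n = 0 := hy (by simpa using hyQ)
      subst hn0
      exact hQp.ne_top (by rw [hn]; ext; simp [Submodule.mem_colon_singleton])
    have hlt : Q < Q' := lt_of_le_of_ne hQle (by rintro rfl; exact hyQ hyQ')
    have := ih hd hQ'
    push_cast
    exact (by gcongr : (d : WithBot ℕ∞) + 1 ≤ ringKrullDim (A ⧸ Q') + 1).trans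
      (ringKrullDim_quotient_lt hlt)

end Dimension

/-! ### Sequences that are regular on the ring and on a module -/

section Chain

variable {A : Type*} [CommRing A]

/-- Dividing first by `K` and then by `x` is dividing by `K + (x)`. -/
noncomputable def quotSMulTopQuotEquiv (K : Ideal A) (x : A) (N : Type*) [AddCommGroup N]
    [Module A N] :
    QuotSMulTop x (N ⧸ (K • ⊤ : Submodule A N)) ≃ₗ[A]
      (N ⧸ ((K ⊔ Ideal.span {x}) • ⊤ : Submodule A N)) := by
  have key : (x • (⊤ : Submodule A (N ⧸ (K • ⊤ : Submodule A N)))) =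
      (x • (⊤ : Submodule A N)).map (K • ⊤ : Submodule A N).mkQ := by
    rw [Submodule.map_pointwise_smul, Submodule.map_top, Submodule.range_mkQ]
  exact (Submodule.quotEquivOfEq _ _ key).trans
    ((Submodule.quotientQuotientEquivQuotientSup _ _).trans
    (Submodule.quotEquivOfEq _ _ (by
      rw [Submodule.sup_smul, Submodule.ideal_span_singleton_smul])))

lemma ringKrullDim_quotient_sup_span_singleton {K : Ideal A} {x : A}
    (hx : IsSMulRegular (A ⧸ (K • ⊤ : Submodule A A)) x) :
    ringKrullDim (A ⧸ (K ⊔ Ideal.span {x})) + 1 ≤ ringKrullDim (A ⧸ K) := by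
  have hK : (K • ⊤ : Submodule A A) = K := by rw [smul_eq_mul, Ideal.mul_top]
  rw [hK] at hx
  have hx' : Ideal.Quotient.mk K x ∈ nonZeroDivisors (A ⧸ K) := by
    rw [mem_nonZeroDivisors_iff_right]
    intro z hz
    refine hx ?_
    change x • z = x • 0
    rw [smul_zero, Algebra.smul_def, mul_comm]
    exact hz
  refine le_trans ?_ (ringKrullDim_quotient_succ_le_of_nonZeroDivisor hx')
  gcongr
  let f : (A ⧸ K) ⧸ Ideal.span {Ideal.Quotient.mk K x} →+* A ⧸ (K ⊔ Ideal.span {x}) :=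
    Ideal.Quotient.lift _ (Ideal.Quotient.factor le_sup_left) (by
      intro a ha
      obtain ⟨b, rfl⟩ := Ideal.mem_span_singleton'.1 ha
      have : Ideal.Quotient.factor (le_sup_left : K ≤ K ⊔ Ideal.span {x})
          (Ideal.Quotient.mk K x) = 0 := by
        rw [Ideal.Quotient.factor_mk, Ideal.Quotient.eq_zero_iff_mem]
        exact Ideal.mem_sup_right (Ideal.mem_span_singleton_self x)
      rw [map_mul, this, mul_zero])
  refine ringKrullDim_le_of_surjective f ?_
  intro b
  obtain ⟨a, rfl⟩ := Ideal.Quotient.mk_surjective b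
  exact ⟨Ideal.Quotient.mk _ (Ideal.Quotient.mk _ a), rfl⟩

/-- If `x` is a nonzerodivisor on `L / K L`, where `0 → M → F → L → 0` is exact, then
`K F ∩ M = K M` implies the same for `K + (x)`. -/
lemma mem_sup_span_smul_of_isSMulRegular {F L M : Type*} [AddCommGroup F] [Module A F]
    [AddCommGroup L] [Module A L] [AddCommGroup M] [Module A M] {f : F →ₗ[A] L}
    (hf : Function.Surjective f) {ι : M →ₗ[A] F} (hι : LinearMap.range ι = LinearMap.ker f)
    {K : Ideal A} {x : A} (hx : IsSMulRegular (L ⧸ (K • ⊤ : Submodule A L)) x)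
    (hK : ∀ m : M, ι m ∈ (K • ⊤ : Submodule A F) → m ∈ (K • ⊤ : Submodule A M))
    (m : M) (hm : ι m ∈ ((K ⊔ Ideal.span {x}) • ⊤ : Submodule A F)) :
    m ∈ ((K ⊔ Ideal.span {x}) • ⊤ : Submodule A M) := by
  rw [Submodule.sup_smul, Submodule.ideal_span_singleton_smul, Submodule.mem_sup] at hm ⊢
  obtain ⟨y, hy, z, hz, hyz⟩ := hm
  rw [Submodule.mem_smul_pointwise_iff_exists] at hz
  obtain ⟨v, -, rfl⟩ := hz
  have hfK : (K • ⊤ : Submodule A F).map f = K • ⊤ := by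
    rw [Submodule.map_smul'', Submodule.map_top, LinearMap.range_eq_top.2 hf]
  have h0 : f y + x • f v = 0 := by
    rw [← map_smul, ← map_add, hyz, ← LinearMap.mem_ker, ← hι]; exact ⟨m, rfl⟩
  have hfv : f v ∈ (K • ⊤ : Submodule A L) := by
    refine mem_of_isSMulRegular_quotient_of_smul_mem hx ?_
    rw [eq_neg_of_add_eq_zero_right h0]
    exact neg_mem (hfK ▸ Submodule.mem_map_of_mem hy)
  rw [← hfK] at hfv
  obtain ⟨v', hv', hvv'⟩ := hfv
  have hker : v - v' ∈ LinearMap.range ι := by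
    rw [hι, LinearMap.mem_ker, map_sub, hvv', sub_self]
  obtain ⟨m', hm'⟩ := hker
  refine ⟨m - x • m', hK _ ?_, x • m', ?_, by abel⟩
  · have : ι (m - x • m') = y + x • v' := by
      rw [map_sub, map_smul, hm', ← hyz, smul_sub]; abel
    rw [this]
    exact add_mem hy (Submodule.smul_mem _ _ hv')
  · rw [Submodule.mem_smul_pointwise_iff_exists]
    exact ⟨m', trivial, rfl⟩

variable [IsLocalRing A] [IsNoetherianRing A]

/-- A prime `P` containing `K` is associated to `A / K` if `A / K` and `L / K L` have depth at least
`dim A / K` and no element of `P` is regular on both. -/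
lemma mem_associatedPrimes_of_forall_not_isSMulRegular {L : Type*} [AddCommGroup L] [Module A L]
    [Module.Finite A L] {P : Ideal A} [hP : P.IsPrime] {e : ℕ} {K : Ideal A} (hKP : K ≤ P)
    (hA : HasWeaklyRegularSeq (IsLocalRing.maximalIdeal A) e (A ⧸ (K • ⊤ : Submodule A A)))
    (hL : HasWeaklyRegularSeq (IsLocalRing.maximalIdeal A) e (L ⧸ (K • ⊤ : Submodule A L)))
    (hdim : ringKrullDim (A ⧸ K) ≤ e)
    (hx : ¬ ∃ x ∈ P, IsSMulRegular ((A ⧸ (K • ⊤ : Submodule A A)) ×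
        (L ⧸ (K • ⊤ : Submodule A L))) x) :
    P ∈ associatedPrimes A (A ⧸ K) := by
  have hex : ∃ n : (A ⧸ (K • ⊤ : Submodule A A)) × (L ⧸ (K • ⊤ : Submodule A L)),
      (∀ r ∈ P, r • n = 0) ∧ n ≠ 0 := by
    by_contra! hcon
    exact hx (exists_isSMulRegular_of_forall_eq_zero hcon)
  obtain ⟨n, hn, hn0⟩ := hex
  obtain ⟨Q, hQ, hle⟩ := exists_le_isAssociatedPrime_of_isNoetherianRing A n hn0
  have hQp := hQ.isPrime
  have hPQ : P ≤ Q := fun r hr => hle (by simpa [Submodule.mem_colon_singleton] using hn r hr)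
  have hQdim : (e : WithBot ℕ∞) ≤ ringKrullDim (A ⧸ Q) := by
    rcases (associatedPrimes.prod A _ _).subset hQ with h | h
    · exact le_ringKrullDim_quotient_of_mem_associatedPrimes hA h
    · exact le_ringKrullDim_quotient_of_mem_associatedPrimes hL h
  -- no strict inclusion of primes between `K` and `Q` is possible
  have key : ∀ {P' Q' : Ideal A} [P'.IsPrime] [Q'.IsPrime], K ≤ P' → P' < Q' →
      (e : WithBot ℕ∞) ≤ ringKrullDim (A ⧸ Q') → False := by
    intro P' Q' _ _ hKP' hlt hle
    have h0 : (e : WithBot ℕ∞) + 1 ≤ ringKrullDim (A ⧸ Q') + 1 := by gcongr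
    have h1 := (h0.trans (ringKrullDim_quotient_lt hlt)).trans
      ((ringKrullDim_le_of_surjective (Ideal.Quotient.factor hKP')
        (Ideal.Quotient.factor_surjective hKP')).trans hdim)
    norm_cast at h1
    omega
  have hPQ' : P = Q := by
    by_contra hne
    exact key hKP (lt_of_le_of_ne hPQ hne) hQdim
  subst hPQ'
  refine Module.associatedPrimes.minimalPrimes_annihilator_subset_associatedPrimes A (A ⧸ K) ?_
  rw [Ideal.annihilator_quotient]
  refine ⟨⟨hP, hKP⟩, fun P' hP' hle' => ?_⟩
  by_contra hnle
  have := hP'.1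
  exact key hP'.2 (lt_of_le_not_ge hle' hnle) hQdim

/-- Let `0 → M → F → L → 0` be exact, with `A` and `L` of depth at least `dim A`. Every prime `P` is
an associated prime of `A / K` for an ideal `K` with `K F ∩ M = K M`, namely the ideal generated
by a maximal sequence in `P` that is regular on `A` and on `L`. -/
theorem exists_mem_associatedPrimes_quotient {F L M : Type*} [AddCommGroup F] [Module A F]
    [AddCommGroup L] [Module A L] [Module.Finite A L] [AddCommGroup M] [Module A M] {f : F →ₗ[A] L}
    (hf : Function.Surjective f) {ι : M →ₗ[A] F} (hι : LinearMap.range ι = LinearMap.ker f)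
    (P : Ideal A) [hP : P.IsPrime] {e : ℕ} : ∀ {K : Ideal A}, K ≤ P →
    HasWeaklyRegularSeq (IsLocalRing.maximalIdeal A) e (A ⧸ (K • ⊤ : Submodule A A)) →
    HasWeaklyRegularSeq (IsLocalRing.maximalIdeal A) e (L ⧸ (K • ⊤ : Submodule A L)) →
    ringKrullDim (A ⧸ K) ≤ e →
    (∀ m : M, ι m ∈ (K • ⊤ : Submodule A F) → m ∈ (K • ⊤ : Submodule A M)) →
    ∃ K' : Ideal A, P ∈ associatedPrimes A (A ⧸ K') ∧
      ∀ m : M, ι m ∈ (K' • ⊤ : Submodule A F) → m ∈ (K' • ⊤ : Submodule A M) := by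
  induction e with
  | zero =>
    intro K hKP hA hL hdim hK
    refine ⟨K, mem_associatedPrimes_of_forall_not_isSMulRegular hKP hA hL hdim ?_, hK⟩
    rintro ⟨x, hxP, hx⟩
    have hxA : IsSMulRegular (A ⧸ (K • ⊤ : Submodule A A)) x := fun a b hab =>
      congrArg Prod.fst (hx (a₁ := (a, 0)) (a₂ := (b, 0)) (Prod.ext hab rfl))
    have h1 := (ringKrullDim_quotient_sup_span_singleton hxA).trans hdim
    have hne : K ⊔ Ideal.span {x} ≤ P := sup_le hKP (by simpa [Ideal.span_le] using hxP)
    have : Nontrivial (A ⧸ (K ⊔ Ideal.span {x})) :=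
      Ideal.Quotient.nontrivial_iff.2 (ne_top_of_le_ne_top hP.ne_top hne)
    have h2 := ringKrullDim_nonneg_of_nontrivial (R := A ⧸ (K ⊔ Ideal.span {x}))
    have h3 : (0 : WithBot ℕ∞) + 1 ≤ ringKrullDim (A ⧸ (K ⊔ Ideal.span {x})) + 1 := by gcongr
    exact absurd (h3.trans h1) (by norm_num)
  | succ e ih =>
    intro K hKP hA hL hdim hK
    by_cases hx : ∃ x ∈ P, IsSMulRegular ((A ⧸ (K • ⊤ : Submodule A A)) ×
        (L ⧸ (K • ⊤ : Submodule A L))) x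
    · obtain ⟨x, hxP, hx⟩ := hx
      have hxm := IsLocalRing.le_maximalIdeal hP.ne_top hxP
      have hxA : IsSMulRegular (A ⧸ (K • ⊤ : Submodule A A)) x := fun a b hab =>
        congrArg Prod.fst (hx (a₁ := (a, 0)) (a₂ := (b, 0)) (Prod.ext hab rfl))
      have hxL : IsSMulRegular (L ⧸ (K • ⊤ : Submodule A L)) x := fun a b hab =>
        congrArg Prod.snd (hx (a₁ := (0, a)) (a₂ := (0, b)) (Prod.ext rfl hab))
      have h1 := (ringKrullDim_quotient_sup_span_singleton hxA).trans hdim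
      refine ih (K := K ⊔ Ideal.span {x}) (sup_le hKP (by simpa [Ideal.span_le] using hxP))
        ((hA.quotSMulTop le_rfl hxm hxA).congr (quotSMulTopQuotEquiv K x A))
        ((hL.quotSMulTop le_rfl hxm hxL).congr (quotSMulTopQuotEquiv K x L)) ?_
        (mem_sup_span_smul_of_isSMulRegular hf hι hxL hK)
      push_cast at h1
      generalize ringKrullDim (A ⧸ (K ⊔ Ideal.span {x})) = a at h1
      induction a with
      | bot => exact bot_le
      | coe a =>
        norm_cast at h1 ⊢
        exact (ENat.add_le_add_iff_right (by simp)).1 h1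
    · exact ⟨K, mem_associatedPrimes_of_forall_not_isSMulRegular hKP hA hL hdim hx, hK⟩

end Chain

/-! ### Splitting off a free submodule locally -/

section Splitting

/-- A homomorphism from a finite module to a finite free module over a local ring is split injective
if it is injective modulo the maximal ideal. -/
lemma exists_retraction_of_forall_mem_smul {R : Type*} [CommRing R] [IsLocalRing R]
    {M N : Type*} [AddCommGroup M] [Module R M] [AddCommGroup N] [Module R N] [Module.Finite R M]
    [Module.Finite R N] [Module.Free R N] (l : M →ₗ[R] N)
    (h : ∀ u, l u ∈ (IsLocalRing.maximalIdeal R • ⊤ : Submodule R N) →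
      u ∈ (IsLocalRing.maximalIdeal R • ⊤ : Submodule R M)) :
    ∃ l' : N →ₗ[R] M, l' ∘ₗ l = LinearMap.id := by
  rw [IsLocalRing.split_injective_iff_lTensor_residueField_injective, injective_iff_map_eq_zero]
  intro t ht
  obtain ⟨u, rfl⟩ := TensorProduct.mk_surjective R M (IsLocalRing.ResidueField R)
    (IsLocalRing.residue_surjective) t
  rw [TensorProduct.mk_apply, LinearMap.lTensor_tmul] at ht
  have h1 : l u ∈ (IsLocalRing.maximalIdeal R • ⊤ : Submodule R N) := by
    let b := Module.Free.chooseBasis R N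
    rw [← b.sum_repr (l u)]
    refine Submodule.sum_mem _ fun i _ => Submodule.smul_mem_smul ?_ trivial
    have := congrArg (fun t => TensorProduct.rid R (IsLocalRing.ResidueField R)
      (LinearMap.lTensor (IsLocalRing.ResidueField R) (b.coord i) t)) ht
    simp only [LinearMap.lTensor_tmul, TensorProduct.rid_tmul, map_zero, Algebra.smul_def,
      mul_one] at this
    exact (IsLocalRing.residue_eq_zero_iff _).1 this
  rw [TensorProduct.mk_apply]
  refine Submodule.smul_induction_on (h u h1) (fun r hr n _ => ?_) fun x y hx hy => ?_
  · rw [← TensorProduct.smul_tmul, Algebra.smul_def, mul_one]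
    have : algebraMap R (IsLocalRing.ResidueField R) r = 0 :=
      (IsLocalRing.residue_eq_zero_iff _).2 hr
    rw [this, TensorProduct.zero_tmul]
  · rw [TensorProduct.tmul_add, hx, hy, add_zero]

/-- Let `M ⊆ F` with `F` finite free and `M` free at the prime `P`. If `P` is an associated prime of
`A / K` for an ideal `K` with `K F ∩ M = K M`, then `M ⊆ F` splits at `P`: multiplication by some
element outside of `P` extends from `M` to a homomorphism `F → M`. -/
theorem exists_extension_of_mem_associatedPrimes {A : Type*} [CommRing A] [IsNoetherianRing A]
    {M F : Type*} [AddCommGroup M] [Module A M] [AddCommGroup F] [Module A F] [Module.Finite A F]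
    [Module.Free A F] {ι : M →ₗ[A] F} (hι : Function.Injective ι) (P : Ideal A) [P.IsPrime]
    [Module.Free (Localization.AtPrime P) (LocalizedModule P.primeCompl M)]
    {K : Ideal A} (hP : P ∈ associatedPrimes A (A ⧸ K))
    (hK : ∀ m : M, ι m ∈ (K • ⊤ : Submodule A F) → m ∈ (K • ⊤ : Submodule A M)) :
    ∃ a ∉ P, ∃ ψ : F →ₗ[A] M, ∀ m, ψ (ι m) = a • m := by
  have : Module.Finite A M := Module.Finite.of_injective ι hι
  have : Module.Free (Localization.AtPrime P) (LocalizedModule P.primeCompl F) :=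
    Module.free_of_isLocalizedModule P.primeCompl (LocalizedModule.mkLinearMap P.primeCompl F)
  -- `s ∉ K` with `s P ⊆ K`
  obtain ⟨-, s, hs⟩ := isAssociatedPrime_iff.1 hP
  obtain ⟨s, rfl⟩ := Ideal.Quotient.mk_surjective s
  have hsP : ∀ r, r ∈ P ↔ s * r ∈ K := by
    intro r
    rw [hs, Submodule.mem_colon_singleton, Submodule.mem_bot, Algebra.smul_def,
      ← Ideal.Quotient.eq_zero_iff_mem, mul_comm s r, map_mul]
    rfl
  let φ := LocalizedModule.map P.primeCompl ι
  have hφ : ∀ u : LocalizedModule P.primeCompl M, φ u ∈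
      (IsLocalRing.maximalIdeal (Localization.AtPrime P) • ⊤ :
      Submodule (Localization.AtPrime P) (LocalizedModule P.primeCompl F)) →
      u ∈ (IsLocalRing.maximalIdeal (Localization.AtPrime P) • ⊤ :
      Submodule (Localization.AtPrime P) (LocalizedModule P.primeCompl M)) := by
    intro u hu
    obtain ⟨m, t, rfl⟩ : ∃ m t, u = LocalizedModule.mk m t := by
      induction u using LocalizedModule.induction_on with
      | h m t => exact ⟨m, t, rfl⟩
    -- elements of `P F_P`, multiplied by `s` and a denominator, come from `K F`
    have hPF : ∀ v ∈ (IsLocalRing.maximalIdeal (Localization.AtPrime P) • ⊤ :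
        Submodule (Localization.AtPrime P) (LocalizedModule P.primeCompl F)),
        ∃ w ∈ (K • ⊤ : Submodule A F), ∃ c : P.primeCompl, s • v = LocalizedModule.mk w c := by
      intro v hv
      refine Submodule.smul_induction_on hv (fun r hr n _ => ?_) fun x y hx hy => ?_
      · obtain ⟨a, c, rfl⟩ := IsLocalization.exists_mk'_eq P.primeCompl r
        rw [IsLocalization.AtPrime.mk'_mem_maximal_iff (Localization.AtPrime P) P] at hr
        induction n using LocalizedModule.induction_on with
        | h n d =>
        refine ⟨(s * a) • n, Submodule.smul_mem_smul ((hsP a).1 hr) trivial, c * d, ?_⟩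
        rw [← Localization.mk_eq_mk', LocalizedModule.mk_smul_mk, LocalizedModule.smul'_mk,
          mul_smul]
      · obtain ⟨w, hw, c, hwc⟩ := hx
        obtain ⟨w', hw', c', hwc'⟩ := hy
        refine ⟨c' • w + c • w', add_mem (Submodule.smul_mem _ _ hw) (Submodule.smul_mem _ _ hw'),
          c * c', ?_⟩
        rw [smul_add, hwc, hwc', LocalizedModule.mk_add_mk]
    obtain ⟨w, hw, c, hwc⟩ := hPF _ hu
    rw [LocalizedModule.map_mk, LocalizedModule.smul'_mk, LocalizedModule.mk_eq] at hwc
    obtain ⟨b, hb⟩ := hwc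
    have hm : (b * c * s : A) • m ∈ (K • ⊤ : Submodule A M) := by
      apply hK
      rw [map_smul, mul_smul, mul_smul]
      have hb' : (b : A) • (c : A) • s • ι m = (b : A) • (t : A) • w := hb
      rw [hb']
      exact Submodule.smul_mem _ _ (Submodule.smul_mem _ _ hw)
    -- read off coordinates in a basis of `M_P`
    let B := Module.Free.chooseBasis (Localization.AtPrime P) (LocalizedModule P.primeCompl M)
    have hcoord : ∀ n ∈ (K • ⊤ : Submodule A M), ∀ i, B.repr (LocalizedModule.mk n 1) i ∈
        K.map (algebraMap A (Localization.AtPrime P)) := by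
      intro n hn i
      refine Submodule.smul_induction_on hn (fun r hr n _ => ?_) fun x y hx hy => ?_
      · rw [← LocalizedModule.smul'_mk, ← algebraMap_smul (Localization.AtPrime P) r, map_smul,
          Finsupp.smul_apply, smul_eq_mul]
        exact Ideal.mul_mem_right _ _ (Ideal.mem_map_of_mem _ hr)
      · have : LocalizedModule.mk (x + y) (1 : P.primeCompl) =
            LocalizedModule.mk x 1 + LocalizedModule.mk y 1 := by
          rw [LocalizedModule.mk_add_mk]; simp
        rw [this, map_add, Finsupp.add_apply]
        exact add_mem hx hy
    rw [← B.sum_repr (LocalizedModule.mk m t)]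
    refine Submodule.sum_mem _ fun i _ => Submodule.smul_mem_smul ?_ trivial
    by_contra hunit
    have hu : IsUnit (B.repr (LocalizedModule.mk m t) i) := by
      simpa using hunit
    have h1 := hcoord _ hm i
    have h2 : LocalizedModule.mk ((b * c * s : A) • m) (1 : P.primeCompl) =
        algebraMap A (Localization.AtPrime P) (b * c * s * t) • LocalizedModule.mk m t := by
      rw [algebraMap_smul, LocalizedModule.smul'_mk, mul_smul _ (t : A), smul_comm _ (t : A)]
      exact (LocalizedModule.mk_cancel t _).symm
    rw [h2, map_smul, Finsupp.smul_apply, smul_eq_mul, Ideal.mul_unit_mem_iff_mem _ hu,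
      IsLocalization.algebraMap_mem_map_algebraMap_iff P.primeCompl] at h1
    obtain ⟨d, hd, hdK⟩ := h1
    have : (d * (b * c * t) : A) ∈ P := by
      rw [hsP]; convert hdK using 1; ring
    exact P.primeCompl.mul_mem hd (P.primeCompl.mul_mem (P.primeCompl.mul_mem b.2 c.2) t.2) this
  obtain ⟨ρ, hρ⟩ := exists_retraction_of_forall_mem_smul φ hφ
  have := Module.finitePresentation_of_finite A F
  obtain ⟨ψ, a, ha⟩ := Module.FinitePresentation.exists_lift_of_isLocalizedModule P.primeCompl
    (LocalizedModule.mkLinearMap P.primeCompl M)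
    (ρ.restrictScalars A ∘ₗ LocalizedModule.mkLinearMap P.primeCompl F)
  obtain ⟨a', ha'⟩ := Module.Finite.exists_smul_of_comp_eq_of_isLocalizedModule P.primeCompl
    (LocalizedModule.mkLinearMap P.primeCompl M) (ψ ∘ₗ ι) (a • LinearMap.id) (by
      ext m
      have h1 := LinearMap.congr_fun ha (ι m)
      have h2 : ρ (LocalizedModule.mk (ι m) 1) = LocalizedModule.mk m 1 := by
        have := LinearMap.congr_fun hρ (LocalizedModule.mk m 1)
        simpa [φ, LocalizedModule.map_mk] using this
      simp only [LinearMap.comp_apply, LinearMap.smul_apply, LinearMap.restrictScalars_apply,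
        LocalizedModule.mkLinearMap_apply, LinearMap.id_apply] at h1 ⊢
      rw [h1, h2]
      exact (map_smul (LocalizedModule.mkLinearMap P.primeCompl M) (a : A) m).symm)
  refine ⟨a' * a, P.primeCompl.mul_mem a'.2 a.2, (a' : A) • ψ, fun m => ?_⟩
  have := LinearMap.congr_fun ha' m
  rw [mul_smul]
  exact this

end Splitting

/-! ### Syzygies of maximal Cohen-Macaulay modules -/

section CohenMacaulay

variable {A : Type*} [CommRing A] [IsLocalRing A] [IsNoetherianRing A]

/-- The Cohen-Macaulay conditions on `A` and `L` in terms of regular sequences of length `dim A`. -/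
lemma exists_hasWeaklyRegularSeq_maximalIdeal (hCM : IsCohenMacaulayLocalRing A)
    {L : Type*} [AddCommGroup L] [Module A L] (hL : IsMaximalCohenMacaulay A L) :
    ∃ d : ℕ, ringKrullDim A ≤ d ∧ HasWeaklyRegularSeq (IsLocalRing.maximalIdeal A) d A ∧
      HasWeaklyRegularSeq (IsLocalRing.maximalIdeal A) d L := by
  obtain ⟨d, hd⟩ : ∃ d : ℕ, ringKrullDim A = d := by
    have h1 := ringKrullDim_ne_bot (R := A)
    have h2 := ringKrullDim_ne_top (R := A)
    generalize ringKrullDim A = a at h1 h2 ⊢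
    induction a with
    | bot => exact absurd rfl h1
    | coe a =>
      induction a with
      | top => exact absurd rfl h2
      | coe a => exact ⟨a, rfl⟩
  have key : ∀ {a : ℕ∞}, (a : WithBot ℕ∞) = ringKrullDim A → (d : ℕ∞) ≤ a := by
    intro a ha
    rw [hd] at ha
    have : a = d := by exact_mod_cast ha
    exact this.ge
  exact ⟨d, hd.le, le_grade_iff.1 (key hCM.2.2), le_grade_iff.1 (key hL.2)⟩

/-- A nonzerodivisor of the ring is a nonzerodivisor on a module of depth `dim A`, as the associated
primes of the module are minimal primes of `A`. -/
lemma isSMulRegular_of_ringKrullDim_le {L : Type*} [AddCommGroup L] [Module A L]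
    [Module.Finite A L] {d : ℕ} (hd : ringKrullDim A ≤ d)
    (hL : HasWeaklyRegularSeq (IsLocalRing.maximalIdeal A) d L) {x : A} (hx : IsSMulRegular A x) :
    IsSMulRegular L x := by
  by_contra hcon
  have hmem : x ∈ ⋃ p ∈ associatedPrimes A L, (p : Set A) := by
    rw [biUnion_associatedPrimes_eq_compl_regular]; exact hcon
  simp only [Set.mem_iUnion] at hmem
  obtain ⟨Q, hQ, hxQ⟩ := hmem
  have hQp := IsAssociatedPrime.isPrime hQ
  have hQd := le_ringKrullDim_quotient_of_mem_associatedPrimes hL hQ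
  obtain ⟨P, hP, hPQ⟩ := Ideal.exists_minimalPrimes_le (J := Q) bot_le
  have hPp := hP.1.1
  rcases hPQ.lt_or_eq with hlt | rfl
  · have h0 : (d : WithBot ℕ∞) + 1 ≤ ringKrullDim (A ⧸ Q) + 1 := by gcongr
    have h1 := (h0.trans (ringKrullDim_quotient_lt hlt)).trans
      ((ringKrullDim_quotient_le P).trans hd)
    norm_cast at h1
    omega
  · refine Set.disjoint_iff.1 (Ideal.disjoint_nonZeroDivisors_of_mem_minimalPrimes hP) ⟨hxQ, ?_⟩
    rw [SetLike.mem_coe, mem_nonZeroDivisors_iff]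
    exact ⟨fun z hz => hx (by simpa using hz), fun z hz => hx (by simpa [mul_comm] using hz)⟩

/-- An ideal that is contained in no prime ideal other than `𝔪` and kills the class of `m` modulo
the submodule `U` forces `m ∈ U` if `𝔪` is not associated to `M / U`. -/
lemma mem_of_forall_smul_mem {M : Type*} [AddCommGroup M] [Module A M] {U : Submodule A M}
    (hass : IsLocalRing.maximalIdeal A ∉ associatedPrimes A (M ⧸ U)) {𝔠 : Ideal A}
    (h𝔠 : ∀ P : Ideal A, P.IsPrime → P ≠ IsLocalRing.maximalIdeal A → ¬ 𝔠 ≤ P)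
    {m : M} (hm : ∀ a ∈ 𝔠, a • m ∈ U) : m ∈ U := by
  by_contra hmU
  have hne : (Submodule.Quotient.mk m : M ⧸ U) ≠ 0 := by
    rwa [ne_eq, Submodule.Quotient.mk_eq_zero]
  obtain ⟨Q, hQ, hle⟩ := exists_le_isAssociatedPrime_of_isNoetherianRing A _ hne
  refine h𝔠 Q hQ.isPrime (fun h => hass (h ▸ hQ)) fun a ha => hle ?_
  rw [Submodule.mem_colon_singleton, ← Submodule.Quotient.mk_smul, Submodule.mem_bot,
    Submodule.Quotient.mk_eq_zero]
  exact hm a ha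

/-- The first syzygy `M ⊆ F` of a maximal Cohen-Macaulay module `L = F / M`, free on the punctured
spectrum: if `𝔪 ∉ Ass^∞_I(M)` then `I ^ n F ∩ M = I ^ n M` for large `n`, i.e.
`Tor_1(A / I ^ n, L) = 0`. -/
theorem eventually_mem_smul_top_of_syzygy (hCM : IsCohenMacaulayLocalRing A)
    {L : Type*} [AddCommGroup L] [Module A L] (hL : IsMaximalCohenMacaulay A L)
    {M F : Type*} [AddCommGroup M] [Module A M] [AddCommGroup F] [Module A F] [Module.Finite A F]
    [Module.Free A F] {f : F →ₗ[A] L} (hf : Function.Surjective f) {ι : M →ₗ[A] F}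
    (hinj : Function.Injective ι) (hι : LinearMap.range ι = LinearMap.ker f)
    (hfree : IsFreeOnPuncturedSpectrum A M) {I : Ideal A}
    (hass : IsLocalRing.maximalIdeal A ∉ assInfty I M) :
    ∀ᶠ n : ℕ in atTop, ∀ m : M, ι m ∈ (I ^ n • ⊤ : Submodule A F) →
      m ∈ (I ^ n • ⊤ : Submodule A M) := by
  have := hL.1
  obtain ⟨d, hd, hdA, hdL⟩ := exists_hasWeaklyRegularSeq_maximalIdeal hCM hL
  -- the elements whose multiplication on `M` extends to `F`
  let 𝔠 : Ideal A :=
    { carrier := {a | ∃ ψ : F →ₗ[A] M, ∀ m, ψ (ι m) = a • m}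
      add_mem' := by
        rintro a b ⟨ψ, hψ⟩ ⟨ψ', hψ'⟩
        exact ⟨ψ + ψ', fun m => by rw [LinearMap.add_apply, hψ, hψ', add_smul]⟩
      zero_mem' := ⟨0, fun m => by simp⟩
      smul_mem' := by
        rintro c a ⟨ψ, hψ⟩
        exact ⟨c • ψ, fun m => by rw [LinearMap.smul_apply, hψ, smul_eq_mul, mul_smul]⟩ }
  have h𝔠 : ∀ P : Ideal A, P.IsPrime → P ≠ IsLocalRing.maximalIdeal A → ¬ 𝔠 ≤ P := by
    intro P hP hPm hle
    obtain ⟨K, hPK, hK⟩ := exists_mem_associatedPrimes_quotient hf hι P (e := d) (K := ⊥) bot_le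
      (hdA.congr (Submodule.quotEquivOfEqBot _ (Submodule.bot_smul _)).symm)
      (hdL.congr (Submodule.quotEquivOfEqBot _ (Submodule.bot_smul _)).symm)
      ((ringKrullDim_quotient_le _).trans hd) (by
        intro m hm
        rw [Submodule.bot_smul, Submodule.mem_bot] at hm
        rw [hinj (hm.trans (map_zero ι).symm)]
        exact zero_mem _)
    have := hfree P hPm
    obtain ⟨a, haP, ha⟩ := exists_extension_of_mem_associatedPrimes hinj P hPK hK
    exact haP (hle ha)
  have hev := not_frequently.1 hass
  filter_upwards [hev] with n hn m hm
  refine mem_of_forall_smul_mem hn h𝔠 ?_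
  rintro a ⟨ψ, hψ⟩
  rw [← hψ]
  have := Submodule.mem_map_of_mem (f := ψ) hm
  rw [Submodule.map_smul''] at this
  exact Submodule.smul_mono le_rfl le_top this

end CohenMacaulay

/-! ### The Čech complex -/

section CechComplex

variable {R : Type*} [CommRing R] {E : Type*} [AddCommGroup E] [Module R E]

lemma liftOfLE_mk {S T : Submonoid R} (h : S ≤ T) (e : E) (s : S) :
    LocalizedModule.liftOfLE S T h (LocalizedModule.mk e s) =
      LocalizedModule.mk e ⟨s.1, h s.2⟩ := by
  rw [IsLocalizedModule.mk_eq_mk', IsLocalizedModule.liftOfLE_mk', ← IsLocalizedModule.mk_eq_mk']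

lemma liftOfLE_liftOfLE {S T U : Submonoid R} (h : S ≤ T) (h' : T ≤ U)
    (x : LocalizedModule S E) :
    LocalizedModule.liftOfLE T U h' (LocalizedModule.liftOfLE S T h x) =
      LocalizedModule.liftOfLE S U (h.trans h') x := by
  induction x using LocalizedModule.induction_on with
  | h e s => simp only [liftOfLE_mk]

variable {m : ℕ} (f : Fin m → R)

lemma cechD_apply {p : ℕ} (z : CechModule f E p) (σ : Fin (p + 1) ↪o Fin m) :
    cechD f E p z σ = ∑ k : Fin (p + 1), (-1 : R) ^ (k : ℕ) •
      LocalizedModule.liftOfLE _ _ (cechDenominators_face_le f σ k) (z (cechFace σ k)) := by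
  simp [cechD, LinearMap.pi_apply, LinearMap.sum_apply]

lemma neg_one_pow_succAbove_predAbove {n : ℕ} (q : Fin (n + 2)) (j : Fin (n + 1)) :
    (-1 : R) ^ ((q.succAbove j : Fin (n + 2)) : ℕ) * (-1) ^ ((j.predAbove q : Fin (n + 1)) : ℕ) =
      -((-1) ^ (q : ℕ) * (-1) ^ (j : ℕ)) := by
  rw [← pow_add, ← pow_add]
  rcases lt_or_ge (Fin.castSucc j) q with h | h
  · rw [Fin.succAbove_of_castSucc_lt _ _ h, Fin.predAbove_of_castSucc_lt _ _ h]
    have : (j : ℕ) < q := h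
    obtain ⟨r, hr⟩ : ∃ r, (q : ℕ) = r + 1 := ⟨q - 1, by omega⟩
    simp only [Fin.val_castSucc, Fin.val_pred, hr, Nat.add_sub_cancel]
    ring
  · rw [Fin.succAbove_of_le_castSucc _ _ h, Fin.predAbove_of_le_castSucc _ _ h]
    simp only [Fin.val_succ, Fin.coe_castPred]
    ring

lemma cechFace_cechFace {p : ℕ} (σ : Fin (p + 2) ↪o Fin m) (k : Fin (p + 2)) (l : Fin (p + 1)) :
    cechFace (cechFace σ (k.succAbove l)) (l.predAbove k) = cechFace (cechFace σ k) l := by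
  ext i
  simp only [cechFace, RelEmbedding.coe_trans, Function.comp_apply, Fin.succAboveOrderEmb_apply,
    Fin.succAbove_succAbove_succAbove_predAbove]

lemma liftOfLE_congr {p : ℕ} (z : CechModule f E p) {T : Submonoid R} {σ τ : Fin p ↪o Fin m}
    (h : σ = τ) (hσ : cechDenominators f σ ≤ T) (hτ : cechDenominators f τ ≤ T) :
    LocalizedModule.liftOfLE _ T hσ (z σ) = LocalizedModule.liftOfLE _ T hτ (z τ) := by
  subst h; rfl

lemma cechD_cechD (p : ℕ) (z : CechModule f E p) : cechD f E (p + 1) (cechD f E p z) = 0 := by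
  funext σ
  simp only [cechD_apply, map_sum, map_smul, Finset.smul_sum, smul_smul, liftOfLE_liftOfLE,
    Pi.zero_apply]
  rw [← Finset.sum_product']
  refine Finset.sum_involution (fun x _ => (x.1.succAbove x.2, x.2.predAbove x.1)) ?_ ?_ ?_ ?_
  · rintro ⟨k, l⟩ -
    rw [liftOfLE_congr f z (cechFace_cechFace σ k l) _
      ((cechDenominators_face_le f _ l).trans (cechDenominators_face_le f σ k)),
      ← add_smul, neg_one_pow_succAbove_predAbove, add_neg_cancel, zero_smul]
  · rintro ⟨k, l⟩ - - h
    exact Fin.succAbove_ne k l (congrArg Prod.fst h)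
  · simp
  · rintro ⟨k, l⟩ -
    simp [Fin.succAbove_succAbove_predAbove, Fin.predAbove_predAbove_succAbove]

lemma mem_cechBoundaries_succ {p : ℕ} {z : CechModule f E (p + 1)} :
    z ∈ cechBoundaries f E (p + 1) ↔ ∃ w, cechD f E p w = z := Iff.rfl

lemma mem_cechBoundaries_zero {z : CechModule f E 0} : z ∈ cechBoundaries f E 0 ↔ z = 0 := Iff.rfl

/-! ### Čech cohomology is torsion -/

lemma exists_mul_of_mem_cechDenominators {p : ℕ} (ρ : Fin (p + 1) ↪o Fin m) (q : Fin (p + 1))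
    {s : R} (hs : s ∈ cechDenominators f ρ) :
    ∃ (N : ℕ) (c : R), c ∈ cechDenominators f (cechFace ρ q) ∧ s = f (ρ q) ^ N * c := by
  induction hs using Submonoid.closure_induction with
  | mem s hs =>
    obtain ⟨i, rfl⟩ := hs
    rcases eq_or_ne i q with rfl | hi
    · exact ⟨1, 1, one_mem _, by simp⟩
    · obtain ⟨j, rfl⟩ := Fin.exists_succAbove_eq hi
      exact ⟨0, _, Submonoid.subset_closure ⟨j, rfl⟩, by simp [cechFace]⟩
  | one => exact ⟨0, 1, one_mem _, by simp⟩
  | mul s t _ _ hs ht =>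
    obtain ⟨N, c, hc, rfl⟩ := hs
    obtain ⟨N', c', hc', rfl⟩ := ht
    exact ⟨N + N', c * c', mul_mem hc hc', by ring⟩

lemma mem_cechDenominators {p : ℕ} (ρ : Fin p ↪o Fin m) (q : Fin p) :
    f (ρ q) ∈ cechDenominators f ρ := Submonoid.subset_closure ⟨q, rfl⟩

/-- The localization at `ρ` is the localization at the face of `ρ` opposite to `q`, localized
further at `f (ρ q)`: the kernel of the restriction map. -/
lemma exists_pow_smul_eq_zero_of_liftOfLE_eq_zero {p : ℕ} {ρ : Fin (p + 1) ↪o Fin m}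
    {q : Fin (p + 1)} {x : LocalizedModule (cechDenominators f (cechFace ρ q)) E}
    (hx : LocalizedModule.liftOfLE _ _ (cechDenominators_face_le f ρ q) x = 0) :
    ∃ N : ℕ, f (ρ q) ^ N • x = 0 := by
  induction x using LocalizedModule.induction_on with
  | h e s =>
    rw [liftOfLE_mk, ← LocalizedModule.zero_mk 1, LocalizedModule.mk_eq] at hx
    obtain ⟨⟨u, hu⟩, hx⟩ := hx
    obtain ⟨N, c, hc, rfl⟩ := exists_mul_of_mem_cechDenominators f ρ q hu
    refine ⟨N, ?_⟩
    rw [LocalizedModule.smul'_mk, ← LocalizedModule.zero_mk 1, LocalizedModule.mk_eq]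
    refine ⟨⟨c, hc⟩, ?_⟩
    simp only [Submonoid.smul_def, one_smul, smul_zero] at hx ⊢
    rw [smul_smul, mul_comm, hx]

/-- The localization at `ρ` is the localization at the face of `ρ` opposite to `q`, localized
further at `f (ρ q)`: the image of the restriction map. -/
lemma exists_liftOfLE_eq_pow_smul {p : ℕ} (ρ : Fin (p + 1) ↪o Fin m) (q : Fin (p + 1))
    (y : LocalizedModule (cechDenominators f ρ) E) :
    ∃ (N : ℕ) (x : LocalizedModule (cechDenominators f (cechFace ρ q)) E),
      LocalizedModule.liftOfLE _ _ (cechDenominators_face_le f ρ q) x = f (ρ q) ^ N • y := by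
  induction y using LocalizedModule.induction_on with
  | h e s =>
    obtain ⟨s, hs⟩ := s
    obtain ⟨N, c, hc, rfl⟩ := exists_mul_of_mem_cechDenominators f ρ q hs
    refine ⟨N, LocalizedModule.mk e ⟨c, hc⟩, ?_⟩
    rw [liftOfLE_mk, LocalizedModule.smul'_mk, LocalizedModule.mk_eq]
    refine ⟨1, ?_⟩
    simp only [Submonoid.smul_def, one_smul, smul_smul]
    rw [mul_comm c]

lemma orderEmbedding_eq_of_cechFace_eq {p : ℕ} {ρ ρ' : Fin (p + 1) ↪o Fin m} {q q' : Fin (p + 1)}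
    (h : cechFace ρ q = cechFace ρ' q') (ha : ρ q = ρ' q') : ρ = ρ' ∧ q = q' := by
  have hr : ∀ (ρ : Fin (p + 1) ↪o Fin m) (q : Fin (p + 1)),
      Set.range ρ = insert (ρ q) (Set.range (cechFace ρ q)) := by
    intro ρ q
    ext a
    constructor
    · rintro ⟨i, rfl⟩
      rcases eq_or_ne i q with rfl | hi
      · exact Or.inl rfl
      · obtain ⟨j, rfl⟩ := Fin.exists_succAbove_eq hi
        exact Or.inr ⟨j, rfl⟩
    · rintro (rfl | ⟨j, rfl⟩)
      · exact ⟨q, rfl⟩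
      · exact ⟨q.succAbove j, rfl⟩
  have hrr : Set.range ρ = Set.range ρ' := by rw [hr ρ q, hr ρ' q', h, ha]
  have hρ : ρ = ρ' := by
    refine RelEmbedding.coe_fn_injective ?_
    exact (StrictMono.range_inj ρ.strictMono ρ'.strictMono).1 hrr
  subst hρ
  exact ⟨rfl, ρ.injective ha⟩

lemma exists_cechFace_eq {p : ℕ} (σ : Fin p ↪o Fin m) {a : Fin m} (ha : a ∉ Set.range σ) :
    ∃ (ρ : Fin (p + 1) ↪o Fin m) (q : Fin (p + 1)), cechFace ρ q = σ ∧ ρ q = a := by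
  let s : Finset (Fin m) := insert a (Finset.univ.map σ.toEmbedding)
  have hs : s.card = p + 1 := by
    rw [Finset.card_insert_of_notMem (by simpa using ha)]; simp
  let ρ := s.orderEmbOfFin hs
  have hrange : Set.range ρ = insert a (Set.range σ) := by
    rw [Finset.range_orderEmbOfFin]; simp [s]
  obtain ⟨q, hq⟩ : a ∈ Set.range ρ := hrange ▸ Set.mem_insert _ _
  refine ⟨ρ, q, ?_, hq⟩
  refine RelEmbedding.coe_fn_injective ?_
  refine (StrictMono.range_inj (cechFace ρ q).strictMono σ.strictMono).1 ?_
  ext b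
  constructor
  · rintro ⟨j, rfl⟩
    have h1 : ρ (q.succAbove j) ∈ insert a (Set.range σ) := hrange ▸ ⟨_, rfl⟩
    refine h1.resolve_left fun h => ?_
    exact Fin.succAbove_ne q j (ρ.injective (h.trans hq.symm))
  · rintro ⟨i, rfl⟩
    obtain ⟨j, hj⟩ : σ i ∈ Set.range ρ := hrange ▸ Set.mem_insert_of_mem _ ⟨i, rfl⟩
    have hjq : j ≠ q := by
      rintro rfl
      exact ha ⟨i, hj.symm.trans hq⟩
    obtain ⟨j', rfl⟩ := Fin.exists_succAbove_eq hjq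
    exact ⟨j', hj⟩

lemma exists_forall_of_finite {ι : Type*} [Finite ι] {P : ι → ℕ → Prop}
    (hP : ∀ i, ∃ N, P i N) (hmono : ∀ i N N', N ≤ N' → P i N → P i N') : ∃ N, ∀ i, P i N := by
  choose N hN using hP
  obtain ⟨B, hB⟩ := (Set.finite_range N).bddAbove
  exact ⟨B, fun i => hmono i _ _ (hB ⟨i, rfl⟩) (hN i)⟩

/-- Every cocycle of the Čech complex becomes a coboundary after multiplication by a power of any
of the elements `f a`. Up to denominators, the contracting homotopy inserts `a` into the index. -/
theorem exists_pow_smul_mem_cechBoundaries {p : ℕ} {z : CechModule f E p}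
    (hz : cechD f E p z = 0) (a : Fin m) : ∃ N : ℕ, f a ^ N • z ∈ cechBoundaries f E p := by
  rcases p with _ | p
  · obtain ⟨ρ, q, hσ, rfl⟩ := exists_cechFace_eq
      (RelEmbedding.ofIsEmpty (· ≤ ·) (· ≤ ·) : Fin 0 ↪o Fin m)
      (a := a) (by rintro ⟨i, -⟩; exact i.elim0)
    have h0 := congrFun hz ρ
    rw [cechD_apply, Fin.sum_univ_one, Pi.zero_apply] at h0
    obtain rfl : q = 0 := Fin.fin_one_eq_zero q
    rw [Fin.val_zero, pow_zero, one_smul] at h0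
    obtain ⟨N, hN⟩ := exists_pow_smul_eq_zero_of_liftOfLE_eq_zero f h0
    refine ⟨N, funext fun σ => ?_⟩
    obtain rfl : σ = cechFace ρ 0 := by ext i; exact i.elim0
    exact hN
  -- the homotopy, with values in the localizations without `f a` inverted
  have hw : ∃ N : ℕ, ∀ τ : Fin p ↪o Fin m, ∃ w : LocalizedModule (cechDenominators f τ) E,
      (a ∈ Set.range τ → w = 0) ∧ ∀ (ρ : Fin (p + 1) ↪o Fin m) (q : Fin (p + 1))
        (h : cechFace ρ q = τ), ρ q = a →
        LocalizedModule.liftOfLE _ _ (h ▸ cechDenominators_face_le f ρ q) w =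
          f a ^ N • (-1 : R) ^ (q : ℕ) • z ρ := by
    refine exists_forall_of_finite (fun τ => ?_) ?_
    · by_cases ha : a ∈ Set.range τ
      · refine ⟨0, 0, fun _ => rfl, ?_⟩
        rintro ρ q rfl rfl
        obtain ⟨i, hi⟩ := ha
        exact absurd (ρ.injective hi) (Fin.succAbove_ne q i)
      · obtain ⟨ρ, q, rfl, rfl⟩ := exists_cechFace_eq τ ha
        obtain ⟨N, x, hx⟩ := exists_liftOfLE_eq_pow_smul f ρ q ((-1 : R) ^ (q : ℕ) • z ρ)
        refine ⟨N, x, fun h => absurd h ha, ?_⟩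
        intro ρ' q' h hq
        obtain ⟨rfl, rfl⟩ := orderEmbedding_eq_of_cechFace_eq h hq
        exact hx
    · rintro τ N N' hN ⟨w, hw0, hw⟩
      refine ⟨f a ^ (N' - N) • w, fun h => by rw [hw0 h, smul_zero], fun ρ q h hq => ?_⟩
      rw [map_smul, hw ρ q h hq, smul_smul, ← pow_add, Nat.sub_add_cancel hN]
  obtain ⟨N, hw⟩ := hw
  choose w hw0 hw using hw
  have hfin : ∃ N' : ℕ, ∀ σ : Fin (p + 1) ↪o Fin m,
      f a ^ N' • (cechD f E p w σ - f a ^ N • z σ) = 0 := by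
    refine exists_forall_of_finite (fun σ => ?_) ?_
    · by_cases ha : a ∈ Set.range σ
      · obtain ⟨k, rfl⟩ := ha
        refine ⟨0, ?_⟩
        rw [pow_zero, one_smul, cechD_apply, Finset.sum_eq_single k, hw _ σ k rfl rfl,
          smul_comm ((-1 : R) ^ (k : ℕ)), smul_smul ((-1 : R) ^ (k : ℕ)), ← pow_add,
          Even.neg_one_pow ⟨_, rfl⟩, one_smul, sub_self]
        · intro l _ hl
          obtain ⟨j, hj⟩ := Fin.exists_succAbove_eq hl.symm
          rw [hw0 (cechFace σ l) ⟨j, by rw [← hj]; rfl⟩, map_zero, smul_zero]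
        · simp
      · obtain ⟨ρ, q, rfl, rfl⟩ := exists_cechFace_eq σ ha
        refine exists_pow_smul_eq_zero_of_liftOfLE_eq_zero f ?_
        have hρ := congrFun hz ρ
        rw [cechD_apply, Fin.sum_univ_succAbove _ q, Pi.zero_apply] at hρ
        have hρ' := eq_neg_of_add_eq_zero_right hρ
        rw [map_sub, sub_eq_zero, cechD_apply, map_sum]
        have hterm : ∀ j : Fin (p + 1), LocalizedModule.liftOfLE _ _
            (cechDenominators_face_le f ρ q) ((-1 : R) ^ (j : ℕ) • LocalizedModule.liftOfLE _ _
              (cechDenominators_face_le f (cechFace ρ q) j) (w (cechFace (cechFace ρ q) j))) =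
            (-(f (ρ q) ^ N * (-1) ^ (q : ℕ))) • ((-1 : R) ^ ((q.succAbove j : Fin (p + 2)) : ℕ) •
              LocalizedModule.liftOfLE _ _ (cechDenominators_face_le f ρ (q.succAbove j))
                (z (cechFace ρ (q.succAbove j)))) := by
          intro j
          have h1 := hw (cechFace (cechFace ρ q) j) (cechFace ρ (q.succAbove j)) (j.predAbove q)
            (cechFace_cechFace ρ q j) (by
              change ρ ((q.succAbove j).succAbove (j.predAbove q)) = ρ q
              rw [Fin.succAbove_succAbove_predAbove])
          have h2 := congrArg (LocalizedModule.liftOfLE _ _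
            (cechDenominators_face_le f ρ (q.succAbove j))) h1
          rw [liftOfLE_liftOfLE, map_smul, map_smul] at h2
          rw [map_smul, liftOfLE_liftOfLE, h2, smul_smul, smul_smul, smul_smul]
          congr 1
          have h3 := neg_one_pow_succAbove_predAbove (R := R) q j
          have h4 : ((-1 : R) ^ (j : ℕ)) * (-1) ^ (j : ℕ) = 1 := by
            rw [← pow_add, Even.neg_one_pow ⟨_, rfl⟩]
          have h5 : ((-1 : R) ^ ((q.succAbove j : Fin (p + 2)) : ℕ)) *
              (-1) ^ ((q.succAbove j : Fin (p + 2)) : ℕ) = 1 := by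
            rw [← pow_add, Even.neg_one_pow ⟨_, rfl⟩]
          linear_combination (f (ρ q) ^ N * (-1) ^ (j : ℕ) *
            (-1) ^ ((q.succAbove j : Fin (p + 2)) : ℕ)) * h3 -
            (f (ρ q) ^ N * (-1) ^ (j : ℕ) * (-1) ^ ((j.predAbove q : Fin (p + 1)) : ℕ)) * h5 -
            (f (ρ q) ^ N * (-1) ^ (q : ℕ) * (-1) ^ ((q.succAbove j : Fin (p + 2)) : ℕ)) * h4
        rw [Finset.sum_congr rfl fun j _ => hterm j, ← Finset.smul_sum, hρ', smul_neg, neg_smul,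
          neg_neg, smul_smul, mul_assoc, ← pow_add, Even.neg_one_pow ⟨_, rfl⟩, mul_one, map_smul]
    · intro σ N₁ N₂ hN h
      rw [← Nat.sub_add_cancel hN, pow_add, mul_smul, h, smul_zero]
  obtain ⟨N', hN'⟩ := hfin
  refine ⟨N' + N, (mem_cechBoundaries_succ f).2 ⟨f a ^ N' • w, funext fun σ => ?_⟩⟩
  have h1 := hN' σ
  rw [smul_sub, sub_eq_zero, smul_smul, ← pow_add] at h1
  rw [map_smul]
  exact h1

/-- Multiplication by an element of the ideal generated by the `f a` is locally nilpotent on the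
cohomology of the Čech complex. -/
theorem exists_pow_smul_mem_cechBoundaries_of_mem_span {p : ℕ} {z : CechModule f E p}
    (hz : cechD f E p z = 0) {s : R} (hs : s ∈ Ideal.span (Set.range f)) :
    ∃ N : ℕ, s ^ N • z ∈ cechBoundaries f E p := by
  let J : Ideal R := (cechBoundaries f E p).colon {z}
  have h : Ideal.span (Set.range f) ≤ J.radical := by
    rw [Ideal.span_le]
    rintro _ ⟨a, rfl⟩
    obtain ⟨N, hN⟩ := exists_pow_smul_mem_cechBoundaries f hz a
    exact ⟨N, Submodule.mem_colon_singleton.2 hN⟩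
  obtain ⟨N, hN⟩ := h hs
  exact ⟨N, Submodule.mem_colon_singleton.1 hN⟩

end CechComplex

/-! ### The grading of the Čech complex -/

section CechGrading

variable {R : Type*} [CommRing R] {E : Type*} [AddCommGroup E] [Module R E]

/-- The maps `π n : E → E` behave like the projections to the components of degree `n` of a graded
module over a graded ring with homogeneous elements `𝒜 d`, and the elements `f i` generate a
multiplicative set of homogeneous elements. -/
structure IsCechGrading {m : ℕ} (f : Fin m → R) (𝒜 : ℕ → Set R) (π : ℤ → E →+ E) : Prop where
  exists_mem : ∀ s ∈ Submonoid.closure (Set.range f), ∃ d, s ∈ 𝒜 d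
  mul_mem : ∀ {d d' : ℕ} {s t : R}, s ∈ 𝒜 d → t ∈ 𝒜 d' → s * t ∈ 𝒜 (d + d')
  map_smul : ∀ {d : ℕ} {s : R}, s ∈ 𝒜 d → ∀ (n : ℤ) (e : E), π (n + d) (s • e) = s • π n e

variable {m : ℕ} {f : Fin m → R} {𝒜 : ℕ → Set R} {π : ℤ → E →+ E}

lemma cechDenominators_le {p : ℕ} (σ : Fin p ↪o Fin m) :
    cechDenominators f σ ≤ Submonoid.closure (Set.range f) :=
  Submonoid.closure_mono (by rintro _ ⟨i, rfl⟩; exact ⟨σ i, rfl⟩)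

namespace IsCechGrading

variable (h : IsCechGrading f 𝒜 π)

lemma mk_eq_mk (h : IsCechGrading f 𝒜 π) {S : Submonoid R} (s : S)
    {d d' : ℕ} (hd : (s : R) ∈ 𝒜 d) (hd' : (s : R) ∈ 𝒜 d')
    (n : ℤ) (e : E) : LocalizedModule.mk (π (n + d) e) s = LocalizedModule.mk (π (n + d') e) s := by
  rw [LocalizedModule.mk_eq]
  refine ⟨1, ?_⟩
  rw [one_smul, one_smul, Submonoid.smul_def, Submonoid.smul_def, ← h.map_smul hd', ← h.map_smul hd,
    add_right_comm]

open Classical in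
/-- A degree of `s`, if `s` is homogeneous. -/
noncomputable def deg (_ : IsCechGrading f 𝒜 π) (s : R) : ℕ :=
  if hs : ∃ d, s ∈ 𝒜 d then hs.choose else 0

lemma mem_deg {s : R} (hs : s ∈ Submonoid.closure (Set.range f)) : s ∈ 𝒜 (h.deg s) := by
  have := h.exists_mem s hs
  rw [deg, dif_pos this]
  exact this.choose_spec

/-- The projection of a localization of `E` to its component of degree `n`, as a function. -/
noncomputable def locProjFun {S : Submonoid R} (hS : S ≤ Submonoid.closure (Set.range f)) (n : ℤ)
    (x : LocalizedModule S E) : LocalizedModule S E :=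
  x.liftOn (fun q => LocalizedModule.mk (π (n + h.deg q.2) q.1) q.2) (by
    rintro ⟨e, s⟩ ⟨e', s'⟩ ⟨u, hu⟩
    dsimp only at hu ⊢
    rw [LocalizedModule.mk_eq]
    refine ⟨u, ?_⟩
    simp only [Submonoid.smul_def] at hu ⊢
    rw [← h.map_smul (h.mem_deg (hS s'.2)), ← h.map_smul (h.mem_deg (hS s.2)),
      ← h.map_smul (h.mem_deg (hS u.2)), ← h.map_smul (h.mem_deg (hS u.2)), hu, add_right_comm n])

lemma locProjFun_mk {S : Submonoid R} (hS : S ≤ Submonoid.closure (Set.range f)) (n : ℤ) (e : E)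
    (s : S) {d : ℕ} (hd : (s : R) ∈ 𝒜 d) :
    h.locProjFun hS n (LocalizedModule.mk e s) = LocalizedModule.mk (π (n + d) e) s := by
  rw [locProjFun, LocalizedModule.liftOn_mk]
  exact h.mk_eq_mk s (h.mem_deg (hS s.2)) hd n e

/-- The projection of a localization of `E` to its component of degree `n`: the class of `e / s`
goes to the class of `e' / s`, where `e'` is the component of `e` of degree `n + deg s`. -/
noncomputable def locProj {S : Submonoid R} (hS : S ≤ Submonoid.closure (Set.range f)) (n : ℤ) :
    LocalizedModule S E →+ LocalizedModule S E :=
  AddMonoidHom.mk' (h.locProjFun hS n) fun x y => by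
    induction x using LocalizedModule.induction_on with
    | h e s =>
    induction y using LocalizedModule.induction_on with
    | h e' s' =>
    have hs := h.mem_deg (hS s.2)
    have hs' := h.mem_deg (hS s'.2)
    rw [LocalizedModule.mk_add_mk, h.locProjFun_mk hS n _ _ hs, h.locProjFun_mk hS n _ _ hs',
      h.locProjFun_mk hS n _ (s * s') (h.mul_mem hs hs'), LocalizedModule.mk_add_mk, map_add,
      Submonoid.smul_def, Submonoid.smul_def, Submonoid.smul_def, Submonoid.smul_def,
      ← h.map_smul hs, ← h.map_smul hs']
    push_cast
    rw [add_assoc, add_assoc, add_comm (h.deg (s' : R) : ℤ)]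

lemma locProj_mk {S : Submonoid R} (hS : S ≤ Submonoid.closure (Set.range f)) (n : ℤ) (e : E)
    (s : S) {d : ℕ} (hd : (s : R) ∈ 𝒜 d) :
    h.locProj hS n (LocalizedModule.mk e s) = LocalizedModule.mk (π (n + d) e) s :=
  h.locProjFun_mk hS n e s hd

lemma locProj_smul {S : Submonoid R} (hS : S ≤ Submonoid.closure (Set.range f)) (n : ℤ) {r : R}
    {d : ℕ} (hr : r ∈ 𝒜 d) (x : LocalizedModule S E) :
    h.locProj hS (n + d) (r • x) = r • h.locProj hS n x := by
  induction x using LocalizedModule.induction_on with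
  | h e s =>
    have hs := h.mem_deg (hS s.2)
    rw [LocalizedModule.smul'_mk, h.locProj_mk hS _ _ _ hs, h.locProj_mk hS _ _ _ hs,
      LocalizedModule.smul'_mk, ← h.map_smul hr, add_right_comm]

lemma locProj_liftOfLE {S T : Submonoid R} (hST : S ≤ T)
    (hT : T ≤ Submonoid.closure (Set.range f)) (n : ℤ) (x : LocalizedModule S E) :
    h.locProj hT n (LocalizedModule.liftOfLE S T hST x) =
      LocalizedModule.liftOfLE S T hST (h.locProj (hST.trans hT) n x) := by
  induction x using LocalizedModule.induction_on with
  | h e s =>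
    have hs := h.mem_deg (hT (hST s.2))
    rw [liftOfLE_mk, h.locProj_mk hT n e ⟨s, hST s.2⟩ hs, h.locProj_mk (hST.trans hT) n e s hs,
      liftOfLE_mk]

/-- The projection of the Čech cochains to the component of degree `n`. -/
noncomputable def cechProj (n : ℤ) (p : ℕ) : CechModule f E p →+ CechModule f E p where
  toFun z σ := h.locProj (cechDenominators_le σ) n (z σ)
  map_zero' := funext fun _ => map_zero _
  map_add' _ _ := funext fun _ => map_add _ _ _

lemma cechProj_apply (n : ℤ) {p : ℕ} (z : CechModule f E p) (σ : Fin p ↪o Fin m) :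
    h.cechProj n p z σ = h.locProj (cechDenominators_le σ) n (z σ) := rfl

lemma cechProj_smul (n : ℤ) {p : ℕ} {r : R} {d : ℕ} (hr : r ∈ 𝒜 d) (z : CechModule f E p) :
    h.cechProj (n + d) p (r • z) = r • h.cechProj n p z :=
  funext fun σ => h.locProj_smul (cechDenominators_le σ) n hr _

lemma cechProj_cechD (n : ℤ) {p : ℕ} (z : CechModule f E p) :
    h.cechProj n (p + 1) (cechD f E p z) = cechD f E p (h.cechProj n p z) := by
  funext σ
  rw [cechProj_apply, cechD_apply, cechD_apply, map_sum]
  refine Finset.sum_congr rfl fun k _ => ?_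
  rw [cechProj_apply, ← h.locProj_liftOfLE _ (cechDenominators_le σ)]
  rcases neg_one_pow_eq_or R (k : ℕ) with hk | hk <;> rw [hk] <;> simp

lemma cechProj_eq_self {ℰ : ℤ → Set E} (hℰ : ∀ n, ∀ e ∈ ℰ n, π n e = e) {n : ℤ} {p : ℕ}
    {z : CechModule f E p} (hz : IsCechHomogeneous f 𝒜 ℰ n z) : h.cechProj n p z = z := by
  funext σ
  obtain ⟨d, s, e, hs, he, hz⟩ := hz σ
  rw [cechProj_apply, hz, h.locProj_mk _ _ _ _ hs, hℰ _ _ he]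

lemma isCechHomogeneous_of_cechProj_eq_self {ℰ : ℤ → Set E} (hℰ : ∀ n e, π n e ∈ ℰ n) {n : ℤ}
    {p : ℕ} {z : CechModule f E p} (hz : h.cechProj n p z = z) :
    IsCechHomogeneous f 𝒜 ℰ n z := by
  intro σ
  have hσ := congrFun hz σ
  rw [cechProj_apply] at hσ
  generalize z σ = x at hσ
  induction x using LocalizedModule.induction_on with
  | h e s =>
    have hs := h.mem_deg (cechDenominators_le σ s.2)
    rw [h.locProj_mk _ _ _ _ hs] at hσ
    exact ⟨h.deg (s : R), s, π (n + h.deg (s : R)) e, hs, hℰ _ _, hσ.symm⟩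

lemma cechProj_cechProj (hℰ : ∀ n e, π n (π n e) = π n e) {n : ℤ} {p : ℕ}
    (z : CechModule f E p) : h.cechProj n p (h.cechProj n p z) = h.cechProj n p z := by
  funext σ
  rw [cechProj_apply, cechProj_apply]
  generalize z σ = x
  induction x using LocalizedModule.induction_on with
  | h e s =>
    have hs := h.mem_deg (cechDenominators_le σ s.2)
    rw [h.locProj_mk _ _ _ _ hs, h.locProj_mk _ _ _ _ hs, hℰ]

end IsCechGrading

lemma cechCohomologyComponent_eq_bot_iff {ℰ : ℤ → Set E} {p : ℕ} {n : ℤ} :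
    cechCohomologyComponent f 𝒜 ℰ p n = ⊥ ↔ ∀ z : CechModule f E p, cechD f E p z = 0 →
      IsCechHomogeneous f 𝒜 ℰ n z → z ∈ cechBoundaries f E p := by
  rw [cechCohomologyComponent, AddSubgroup.closure_eq_bot_iff]
  constructor
  · intro h z hz hn
    have := h ⟨⟨z, hz⟩, hn, rfl⟩
    rw [Set.mem_singleton_iff, Submodule.Quotient.mk_eq_zero] at this
    exact this
  · rintro h _ ⟨z, hn, rfl⟩
    rw [Set.mem_singleton_iff, Submodule.Quotient.mk_eq_zero]
    exact h z z.2 hn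

end CechGrading

/-! ### Functoriality of the Čech complex -/

section Functoriality

variable {R : Type*} [CommRing R] {E E' : Type*} [AddCommGroup E] [Module R E]
  [AddCommGroup E'] [Module R E'] {m : ℕ} (f : Fin m → R)

/-- The map of Čech complexes induced by a homomorphism of modules. -/
noncomputable def cechMap (φ : E →ₗ[R] E') (p : ℕ) : CechModule f E p →ₗ[R] CechModule f E' p :=
  LinearMap.pi fun σ => (IsLocalizedModule.map (cechDenominators f σ)
    (LocalizedModule.mkLinearMap _ E) (LocalizedModule.mkLinearMap _ E') φ).comp
    (LinearMap.proj σ)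

lemma cechMap_apply (φ : E →ₗ[R] E') {p : ℕ} (z : CechModule f E p) (σ : Fin p ↪o Fin m) :
    cechMap f φ p z σ = IsLocalizedModule.map (cechDenominators f σ)
      (LocalizedModule.mkLinearMap _ E) (LocalizedModule.mkLinearMap _ E') φ (z σ) := rfl

lemma cechMap_cechD (φ : E →ₗ[R] E') {p : ℕ} (z : CechModule f E p) :
    cechMap f φ (p + 1) (cechD f E p z) = cechD f E' p (cechMap f φ p z) := by
  funext σ
  rw [cechMap_apply, cechD_apply, cechD_apply, map_sum]
  refine Finset.sum_congr rfl fun k _ => ?_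
  rw [map_smul, cechMap_apply]
  congr 1
  generalize z (cechFace σ k) = x
  induction x using LocalizedModule.induction_on with
  | h e s =>
    rw [liftOfLE_mk, IsLocalizedModule.map_LocalizedModules, IsLocalizedModule.map_LocalizedModules,
      liftOfLE_mk]

lemma cechMap_surjective {φ : E →ₗ[R] E'} (hφ : Function.Surjective φ) (p : ℕ) :
    Function.Surjective (cechMap f φ p) := by
  intro y
  have := fun σ => IsLocalizedModule.map_surjective (cechDenominators f σ)
    (LocalizedModule.mkLinearMap (cechDenominators f σ) E)
    (LocalizedModule.mkLinearMap (cechDenominators f σ) E') φ hφ (y σ)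
  choose z hz using this
  exact ⟨z, funext hz⟩

/-- Exactness of `E → E → E'`, the first map being multiplication by `s`, passes to the Čech
complexes. -/
lemma exists_smul_eq_of_cechMap_eq_zero {φ : E →ₗ[R] E'} {s : R}
    (hφ : ∀ e, φ e = 0 → ∃ e', s • e' = e) {p : ℕ} {z : CechModule f E p}
    (hz : cechMap f φ p z = 0) : ∃ z', s • z' = z := by
  have key : ∀ σ, ∃ x, s • x = z σ := by
    intro σ
    have hσ := congrFun hz σ
    rw [cechMap_apply, Pi.zero_apply] at hσ
    generalize z σ = x at hσ
    induction x using LocalizedModule.induction_on with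
    | h e t =>
      rw [IsLocalizedModule.map_LocalizedModules, ← LocalizedModule.zero_mk 1,
        LocalizedModule.mk_eq] at hσ
      obtain ⟨u, hu⟩ := hσ
      rw [smul_zero, smul_zero, one_smul, Submonoid.smul_def, ← map_smul] at hu
      obtain ⟨e', he'⟩ := hφ _ hu
      refine ⟨LocalizedModule.mk e' (u * t), ?_⟩
      rw [LocalizedModule.smul'_mk, he', LocalizedModule.mk_eq]
      exact ⟨1, by simp only [Submonoid.smul_def, one_smul, smul_smul, Submonoid.coe_mul, mul_comm]⟩
  choose z' hz' using key
  exact ⟨z', funext hz'⟩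

lemma IsCechGrading.cechMap_cechProj {𝒜 : ℕ → Set R} {π : ℤ → E →+ E} {π' : ℤ → E' →+ E'}
    (h : IsCechGrading f 𝒜 π) (h' : IsCechGrading f 𝒜 π') {φ : E →ₗ[R] E'}
    (hφ : ∀ n e, φ (π n e) = π' n (φ e)) (n : ℤ) {p : ℕ} (z : CechModule f E p) :
    cechMap f φ p (h.cechProj n p z) = h'.cechProj n p (cechMap f φ p z) := by
  funext σ
  rw [cechMap_apply, h'.cechProj_apply, h.cechProj_apply, cechMap_apply]
  generalize z σ = x
  induction x using LocalizedModule.induction_on with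
  | h e s =>
    have hs := h.mem_deg (cechDenominators_le σ s.2)
    rw [h.locProj_mk _ _ _ _ hs, IsLocalizedModule.map_LocalizedModules,
      IsLocalizedModule.map_LocalizedModules, h'.locProj_mk _ _ _ _ hs, hφ]

end Functoriality

/-! ### The module `L^I(M)` -/

section LModuleBasics

variable {A : Type*} [CommRing A] (I : Ideal A)

/-- The element `a t ^ d` of the Rees ring. -/
noncomputable def reesMonomial {d : ℕ} {a : A} (ha : a ∈ I ^ d) : reesAlgebra I :=
  ⟨Polynomial.monomial d a, reesAlgebra.monomial_mem.2 ha⟩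

variable {I}

lemma coe_reesMonomial {d : ℕ} {a : A} (ha : a ∈ I ^ d) :
    (reesMonomial I ha : Polynomial A) = Polynomial.monomial d a := rfl

lemma reesMonomial_mul {d d' : ℕ} {a b : A} (ha : a ∈ I ^ d) (hb : b ∈ I ^ d')
    (hab : a * b ∈ I ^ (d + d')) :
    reesMonomial I ha * reesMonomial I hb = reesMonomial I hab :=
  Subtype.ext (Polynomial.monomial_mul_monomial _ _ _ _)

lemma one_mem_reesHomogeneous : (1 : reesAlgebra I) ∈ reesHomogeneous I 0 := ⟨1, rfl⟩

lemma reesMonomial_pow_mem_reesHomogeneous {u : A} (hu : u ∈ I ^ 1) (k : ℕ) :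
    reesMonomial I hu ^ k ∈ reesHomogeneous I k :=
  ⟨u ^ k, by rw [SubmonoidClass.coe_pow, coe_reesMonomial, Polynomial.monomial_pow, one_mul]⟩

lemma smul_coeff_of_mem_reesHomogeneous {M : Type*} [AddCommGroup M] [Module A M] {d : ℕ}
    {s : reesAlgebra I} {a : A} (hs : (s : Polynomial A) = Polynomial.monomial d a)
    (F : PolynomialModule A M) (n : ℕ) :
    (s • F).coeff n = if d ≤ n then a • F.coeff (n - d) else 0 := by
  rw [Subalgebra.smul_def, hs, PolynomialModule.monomial_smul_apply]

lemma smul_single_of_mem_reesHomogeneous {M : Type*} [AddCommGroup M] [Module A M] {d : ℕ}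
    {s : reesAlgebra I} {a : A} (hs : (s : Polynomial A) = Polynomial.monomial d a)
    (n : ℕ) (x : M) :
    s • PolynomialModule.single A n x = PolynomialModule.single A (d + n) (a • x) := by
  rw [Subalgebra.smul_def, hs, PolynomialModule.monomial_smul_single]

variable {M : Type*} [AddCommGroup M] [Module A M]

lemma mem_reesModule_iff {F : PolynomialModule A M} :
    F ∈ reesModule I M ↔ ∀ n, F.coeff n ∈ (I ^ n • ⊤ : Submodule A M) := Iff.rfl

lemma coeff_single_self (n : ℕ) (x : M) : (PolynomialModule.single A n x).coeff n = x := by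
  rw [PolynomialModule.coeff_single, Finsupp.single_eq_same]

lemma coeff_single_of_ne {n k : ℕ} (h : n ≠ k) (x : M) :
    (PolynomialModule.single A n x).coeff k = 0 := by
  rw [PolynomialModule.coeff_single, Finsupp.single_eq_of_ne h.symm]

lemma single_mem_reesModule_iff {n : ℕ} {x : M} :
    PolynomialModule.single A n x ∈ reesModule I M ↔ x ∈ (I ^ n • ⊤ : Submodule A M) := by
  refine ⟨fun h => ?_, fun h k => ?_⟩
  · have := mem_reesModule_iff.1 h n
    rwa [coeff_single_self] at this
  rcases eq_or_ne n k with rfl | hk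
  · rwa [coeff_single_self]
  · rw [coeff_single_of_ne hk]; exact zero_mem _

variable (I) in
/-- The class of `x t ^ n` in `L^I(M)`, an element of degree `n - 1`. -/
noncomputable def lSingle (n : ℕ) (x : M) : LModule I M :=
  (reesModule I M).mkQ (PolynomialModule.single A n x)

lemma lSingle_eq_zero_iff {n : ℕ} {x : M} :
    lSingle I n x = 0 ↔ x ∈ (I ^ n • ⊤ : Submodule A M) := by
  rw [lSingle, Submodule.mkQ_apply, Submodule.Quotient.mk_eq_zero, single_mem_reesModule_iff]

lemma lSingle_add (n : ℕ) (x y : M) : lSingle I n (x + y) = lSingle I n x + lSingle I n y := by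
  rw [lSingle, PolynomialModule.single_add, map_add]; rfl

lemma lSingle_sub (n : ℕ) (x y : M) : lSingle I n (x - y) = lSingle I n x - lSingle I n y := by
  rw [eq_sub_iff_add_eq, ← lSingle_add, sub_add_cancel]

lemma smul_lSingle {d : ℕ} {s : reesAlgebra I} {a : A}
    (hs : (s : Polynomial A) = Polynomial.monomial d a) (n : ℕ) (x : M) :
    s • lSingle I n x = lSingle I (d + n) (a • x) := by
  rw [lSingle, ← map_smul, smul_single_of_mem_reesHomogeneous hs]; rfl

lemma mkQ_eq_sum_lSingle (F : PolynomialModule A M) :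
    (reesModule I M).mkQ F = ∑ n ∈ F.coeff.support, lSingle I n (F.coeff n) := by
  have h : F = ∑ n ∈ F.coeff.support, PolynomialModule.single A n (F.coeff n) := by
    refine PolynomialModule.coeff_injective ?_
    rw [PolynomialModule.coeff_sum]
    exact (Finsupp.sum_single _).symm
  conv_lhs => rw [h]
  rw [map_sum]
  rfl

/-- The component of degree `n` of a polynomial with coefficients in `M`, in the grading in which
`x t ^ k` has degree `k - 1`. -/
noncomputable def polyProj (n : ℤ) : PolynomialModule A M →+ PolynomialModule A M :=
  AddMonoidHom.mk' (fun F => if 0 ≤ n + 1 then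
    PolynomialModule.single A (n + 1).toNat (F.coeff (n + 1).toNat) else 0) fun F G => by
    split_ifs
    · rw [PolynomialModule.coeff_add, Finsupp.add_apply, PolynomialModule.single_add]
    · rw [add_zero]

lemma polyProj_apply (n : ℤ) (F : PolynomialModule A M) :
    polyProj n F = if 0 ≤ n + 1 then
      PolynomialModule.single A (n + 1).toNat (F.coeff (n + 1).toNat) else 0 := rfl

variable (I M) in
/-- The projection of `L^I(M)` to its component of degree `n`. -/
noncomputable def lProj (n : ℤ) : LModule I M →+ LModule I M :=
  QuotientAddGroup.map (reesModule I M).toAddSubgroup (reesModule I M).toAddSubgroup (polyProj n)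
    (fun F hF => by
      rw [AddSubgroup.mem_comap, polyProj_apply]
      split_ifs
      · exact single_mem_reesModule_iff.2 (hF _)
      · exact zero_mem _)

lemma lProj_mkQ (n : ℤ) (F : PolynomialModule A M) :
    lProj I M n ((reesModule I M).mkQ F) = (reesModule I M).mkQ (polyProj n F) := rfl

lemma lProj_mkQ_of_le {n : ℤ} {k : ℕ} (h : n + 1 = k) (F : PolynomialModule A M) :
    lProj I M n ((reesModule I M).mkQ F) = lSingle I k (F.coeff k) := by
  rw [lProj_mkQ, polyProj_apply, h, if_pos (by positivity), Int.toNat_natCast]; rfl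

lemma lProj_of_lt {n : ℤ} (h : n + 1 < 0) (e : LModule I M) : lProj I M n e = 0 := by
  obtain ⟨F, rfl⟩ := Submodule.mkQ_surjective _ e
  rw [lProj_mkQ, polyProj_apply, if_neg (by omega), map_zero]

lemma lProj_lSingle_self {n : ℤ} {k : ℕ} (h : n + 1 = k) (x : M) :
    lProj I M n (lSingle I k x) = lSingle I k x := by
  rw [lSingle, lProj_mkQ_of_le h, coeff_single_self]; rfl

lemma lProj_lProj (n : ℤ) (e : LModule I M) : lProj I M n (lProj I M n e) = lProj I M n e := by
  obtain ⟨F, rfl⟩ := Submodule.mkQ_surjective _ e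
  by_cases h : 0 ≤ n + 1
  · obtain ⟨k, hk⟩ := Int.eq_ofNat_of_zero_le h
    rw [lProj_mkQ_of_le hk, lProj_lSingle_self hk]
  · rw [lProj_of_lt (by omega) ((reesModule I M).mkQ F), map_zero]

lemma lProj_eq_self_of_mem {n : ℤ} {e : LModule I M} (he : e ∈ LHomogeneous I M n) :
    lProj I M n e = e := by
  rcases he with rfl | ⟨k, x, hk, rfl⟩
  · exact map_zero _
  · exact lProj_lSingle_self hk.symm x

lemma lProj_mem (n : ℤ) (e : LModule I M) : lProj I M n e ∈ LHomogeneous I M n := by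
  obtain ⟨F, rfl⟩ := Submodule.mkQ_surjective _ e
  by_cases h : 0 ≤ n + 1
  · obtain ⟨k, hk⟩ := Int.eq_ofNat_of_zero_le h
    rw [lProj_mkQ_of_le hk]
    exact Or.inr ⟨k, F.coeff k, hk.symm, rfl⟩
  · exact Or.inl (lProj_of_lt (by omega) _)

section Map

variable {N : Type*} [AddCommGroup N] [Module A N]

variable (I) in
/-- The homomorphism `M[t] → N[t]` over the Rees ring induced by `M → N`. -/
noncomputable def polyMap (φ : M →ₗ[A] N) :
    PolynomialModule A M →ₗ[reesAlgebra I] PolynomialModule A N where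
  toFun := PolynomialModule.map A φ
  map_add' := map_add _
  map_smul' s F := by
    rw [Subalgebra.smul_def, PolynomialModule.map_smul]
    simp [Subalgebra.smul_def]

lemma coeff_polyMap (φ : M →ₗ[A] N) (F : PolynomialModule A M) (n : ℕ) :
    (polyMap I φ F).coeff n = φ (F.coeff n) := by
  change (PolynomialModule.map A φ F).coeff n = _
  induction F using PolynomialModule.induction_linear with
  | zero => simp
  | add F G hF hG => simp only [map_add, PolynomialModule.coeff_add, Finsupp.add_apply, hF, hG]
  | single k x =>
    rw [PolynomialModule.map_single]
    rcases eq_or_ne k n with rfl | h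
    · rw [coeff_single_self, coeff_single_self]
    · rw [coeff_single_of_ne h, coeff_single_of_ne h, map_zero]

lemma polyMap_mem_reesModule (φ : M →ₗ[A] N) {F : PolynomialModule A M} (hF : F ∈ reesModule I M) :
    polyMap I φ F ∈ reesModule I N := by
  intro n
  rw [coeff_polyMap]
  have := Submodule.mem_map_of_mem (f := φ) (hF n)
  rw [Ideal.stableFiltration_N, Submodule.map_smul''] at this
  exact Submodule.smul_mono le_rfl le_top this

variable (I) in
/-- The homomorphism `L^I(M) → L^I(N)` induced by `M → N`. -/
noncomputable def lMap (φ : M →ₗ[A] N) : LModule I M →ₗ[reesAlgebra I] LModule I N :=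
  Submodule.mapQ _ _ (polyMap I φ) fun _ hF => polyMap_mem_reesModule φ hF

lemma lMap_mkQ (φ : M →ₗ[A] N) (F : PolynomialModule A M) :
    lMap I φ ((reesModule I M).mkQ F) = (reesModule I N).mkQ (polyMap I φ F) := rfl

lemma lMap_lSingle (φ : M →ₗ[A] N) (n : ℕ) (x : M) :
    lMap I φ (lSingle I n x) = lSingle I n (φ x) := by
  rw [lSingle, lMap_mkQ]
  exact congrArg (reesModule I N).mkQ (PolynomialModule.map_single A φ n x)

lemma lMap_surjective {φ : M →ₗ[A] N} (hφ : Function.Surjective φ) :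
    Function.Surjective (lMap I φ) := by
  intro e
  obtain ⟨F, rfl⟩ := Submodule.mkQ_surjective _ e
  rw [mkQ_eq_sum_lSingle]
  choose g hg using hφ
  refine ⟨∑ n ∈ F.coeff.support, lSingle I n (g (F.coeff n)), ?_⟩
  rw [map_sum]
  exact Finset.sum_congr rfl fun n _ => by rw [lMap_lSingle, hg]

lemma lMap_lProj (φ : M →ₗ[A] N) (n : ℤ) (e : LModule I M) :
    lMap I φ (lProj I M n e) = lProj I N n (lMap I φ e) := by
  obtain ⟨F, rfl⟩ := Submodule.mkQ_surjective _ e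
  by_cases h : 0 ≤ n + 1
  · obtain ⟨k, hk⟩ := Int.eq_ofNat_of_zero_le h
    rw [lProj_mkQ_of_le hk, lMap_mkQ, lProj_mkQ_of_le hk, lMap_lSingle, coeff_polyMap]
  · rw [lProj_of_lt (by omega), lProj_of_lt (by omega), map_zero]

end Map

section Quot

variable {N : Type*} [AddCommGroup N] [Module A N] {u : A}

/-- If `N` is `M / u M`, the sequence `L^I(M)(-1) → L^I(M) → L^I(N)`, with first map multiplication
by `u t`, is exact. -/
lemma exists_smul_eq_of_lMap_eq_zero {φ : M →ₗ[A] N} (hφ : Function.Surjective φ)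
    (hker : ∀ x, φ x = 0 → ∃ y, u • y = x) {s : reesAlgebra I}
    (hs : (s : Polynomial A) = Polynomial.monomial 1 u) (e : LModule I M)
    (he : lMap I φ e = 0) : ∃ e', s • e' = e := by
  obtain ⟨F, rfl⟩ := Submodule.mkQ_surjective _ e
  rw [lMap_mkQ, Submodule.mkQ_apply, Submodule.Quotient.mk_eq_zero, mem_reesModule_iff] at he
  have key : ∀ n, ∃ e', s • e' = lSingle I n (F.coeff n) := by
    intro n
    rcases n with _ | n
    · refine ⟨0, ?_⟩
      rw [smul_zero, eq_comm, lSingle_eq_zero_iff]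
      simp
    · have h := he (n + 1)
      have hmap : (I ^ (n + 1) • ⊤ : Submodule A N) =
          (I ^ (n + 1) • ⊤ : Submodule A M).map φ := by
        rw [Submodule.map_smul'', Submodule.map_top, LinearMap.range_eq_top.2 hφ]
      rw [coeff_polyMap] at h
      obtain ⟨y, hy, hyF⟩ := hmap.le h
      obtain ⟨x, hx⟩ := hker (y - F.coeff (n + 1)) (by rw [map_sub, hyF, sub_self])
      refine ⟨lSingle I n (-x), ?_⟩
      rw [smul_lSingle hs, add_comm 1 n, ← sub_eq_zero, ← lSingle_sub, lSingle_eq_zero_iff,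
        smul_neg, hx]
      have : -(y - F.coeff (n + 1)) - F.coeff (n + 1) = -y := by abel
      rw [this]
      exact neg_mem hy
  choose e' he' using key
  refine ⟨∑ n ∈ F.coeff.support, e' n, ?_⟩
  rw [Finset.smul_sum, mkQ_eq_sum_lSingle]
  exact Finset.sum_congr rfl fun n _ => he' n

lemma smul_lModule_eq_zero (hN : ∀ y : N, u • y = 0) {s : reesAlgebra I}
    (hs : (s : Polynomial A) = Polynomial.monomial 1 u) (e : LModule I N) : s • e = 0 := by
  obtain ⟨F, rfl⟩ := Submodule.mkQ_surjective _ e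
  rw [mkQ_eq_sum_lSingle, Finset.smul_sum]
  refine Finset.sum_eq_zero fun n _ => ?_
  rw [smul_lSingle hs, hN, lSingle_eq_zero_iff]
  exact zero_mem _

end Quot

end LModuleBasics

/-! ### The graded components of the local cohomology of `L^I(M)` -/

section HL

variable {A : Type*} [CommRing A] [IsNoetherianRing A] {I : Ideal A}

lemma coe_reesGenerators (i : Fin (numGenerators I)) :
    (reesGenerators I i : Polynomial A) = Polynomial.monomial 1 (generators I i) := rfl

lemma coe_reesGenerators_pow (i : Fin (numGenerators I)) (k : ℕ) :
    ((reesGenerators I i ^ k : reesAlgebra I) : Polynomial A) =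
      Polynomial.monomial k (generators I i ^ k) := by
  rw [SubmonoidClass.coe_pow, coe_reesGenerators, Polynomial.monomial_pow, one_mul]

variable (I) in
/-- The grading of `L^I(M)`, with the generators `x_i t` of the irrelevant ideal. -/
lemma isCechGrading_lModule (M : Type*) [AddCommGroup M] [Module A M] :
    IsCechGrading (reesGenerators I) (reesHomogeneous I) (lProj I M) where
  exists_mem s hs := by
    induction hs using Submonoid.closure_induction with
    | mem s hs =>
      obtain ⟨i, rfl⟩ := hs
      exact ⟨1, _, rfl⟩
    | one => exact ⟨0, 1, rfl⟩
    | mul s t _ _ hs ht =>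
      obtain ⟨d, a, hs⟩ := hs
      obtain ⟨d', b, ht⟩ := ht
      exact ⟨d + d', a * b, by
        rw [Subalgebra.coe_mul, hs, ht, Polynomial.monomial_mul_monomial]⟩
  mul_mem := by
    rintro d d' s t ⟨a, hs⟩ ⟨b, ht⟩
    exact ⟨a * b, by rw [Subalgebra.coe_mul, hs, ht, Polynomial.monomial_mul_monomial]⟩
  map_smul := by
    rintro d s ⟨a, hs⟩ n e
    obtain ⟨F, rfl⟩ := Submodule.mkQ_surjective _ e
    rw [← map_smul]
    by_cases h : 0 ≤ n + 1
    · obtain ⟨k, hk⟩ := Int.eq_ofNat_of_zero_le h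
      rw [lProj_mkQ_of_le hk, lProj_mkQ_of_le (k := d + k) (by push_cast; omega),
        smul_lSingle hs, smul_coeff_of_mem_reesHomogeneous hs, if_pos (by omega),
        Nat.add_sub_cancel_left]
    · rw [lProj_of_lt (n := n) (by omega), smul_zero]
      by_cases h' : 0 ≤ n + d + 1
      · obtain ⟨k, hk⟩ := Int.eq_ofNat_of_zero_le h'
        rw [lProj_mkQ_of_le hk, smul_coeff_of_mem_reesHomogeneous hs, if_neg (by omega),
          lSingle_eq_zero_iff]
        exact zero_mem _
      · exact lProj_of_lt (by omega) _

variable {M : Type*} [AddCommGroup M] [Module A M]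

lemma HL_eq_bot_iff {i : ℕ} {n : ℤ} : HL I M i n = ⊥ ↔
    ∀ z : CechModule (reesGenerators I) (LModule I M) i,
      cechD (reesGenerators I) (LModule I M) i z = 0 →
      (isCechGrading_lModule I M).cechProj n i z = z →
      z ∈ cechBoundaries (reesGenerators I) (LModule I M) i := by
  rw [HL, cechCohomologyComponent_eq_bot_iff]
  constructor
  · intro h z hz hn
    exact h z hz ((isCechGrading_lModule I M).isCechHomogeneous_of_cechProj_eq_self lProj_mem hn)
  · intro h z hz hn
    exact h z hz ((isCechGrading_lModule I M).cechProj_eq_self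
      (fun _ _ => lProj_eq_self_of_mem) hn)

end HL

/-! ### The associated graded ring and module -/

section GModuleBasics

variable {A : Type*} [CommRing A] {I : Ideal A} {M : Type*} [AddCommGroup M] [Module A M]

/-- A polynomial lies in `I R(I, M)` if and only if its coefficient of degree `n` lies in
`I ^ (n + 1) M` for all `n`. -/
lemma mem_reesExtension_smul_top_iff {x : reesModule I M} :
    x ∈ (reesExtension I • ⊤ : Submodule (reesAlgebra I) (reesModule I M)) ↔
      ∀ n, (x : PolynomialModule A M).coeff n ∈ (I ^ (n + 1) • ⊤ : Submodule A M) := by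
  constructor
  · intro hx
    refine Submodule.smul_induction_on hx (fun r hr y _ => ?_) fun x y hx hy n => ?_
    · refine Submodule.span_induction (p := fun r _ => ∀ y : reesModule I M, ∀ n,
        ((r • y : reesModule I M) : PolynomialModule A M).coeff n ∈
          (I ^ (n + 1) • ⊤ : Submodule A M)) ?_ ?_ ?_ ?_ hr y
      · rintro _ ⟨a, ha, rfl⟩ y n
        have h : (algebraMap A (reesAlgebra I) a : Polynomial A) = Polynomial.monomial 0 a := rfl
        rw [Submodule.coe_smul, smul_coeff_of_mem_reesHomogeneous h, if_pos (Nat.zero_le _),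
          Nat.sub_zero, pow_succ', mul_smul]
        exact Submodule.smul_mem_smul ha (y.2 n)
      · intro y n
        rw [zero_smul]
        exact zero_mem _
      · intro r s _ _ hr hs y n
        rw [add_smul]
        exact add_mem (hr y n) (hs y n)
      · intro a r _ hr y n
        rw [smul_eq_mul, mul_comm, mul_smul]
        exact hr (a • y) n
    · exact add_mem (hx n) (hy n)
  · intro h
    have key : ∀ n, ∀ y ∈ (I ^ (n + 1) • ⊤ : Submodule A M),
        ∃ hy' : y ∈ (I ^ n • ⊤ : Submodule A M),
        (⟨PolynomialModule.single A n y, single_mem_reesModule_iff.2 hy'⟩ : reesModule I M) ∈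
          (reesExtension I • ⊤ : Submodule (reesAlgebra I) (reesModule I M)) := by
      intro n y hy
      rw [pow_succ', mul_smul] at hy
      refine Submodule.smul_induction_on hy (fun a ha z hz => ?_) fun x y hx hy => ?_
      · have h : (algebraMap A (reesAlgebra I) a : Polynomial A) = Polynomial.monomial 0 a := rfl
        refine ⟨Submodule.smul_mem _ _ hz, ?_⟩
        have : (⟨PolynomialModule.single A n (a • z),
            single_mem_reesModule_iff.2 (Submodule.smul_mem _ _ hz)⟩ :
            reesModule I M) = algebraMap A (reesAlgebra I) a •
              ⟨PolynomialModule.single A n z, single_mem_reesModule_iff.2 hz⟩ := by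
          refine Subtype.ext ?_
          rw [Submodule.coe_smul, smul_single_of_mem_reesHomogeneous h, zero_add]
        rw [this]
        exact Submodule.smul_mem_smul (Ideal.mem_map_of_mem _ ha) trivial
      · obtain ⟨hx', hx⟩ := hx
        obtain ⟨hy', hy⟩ := hy
        refine ⟨add_mem hx' hy', ?_⟩
        have := add_mem hx hy
        convert this using 1
        exact Subtype.ext (PolynomialModule.single_add _ _ _)
    have hx : x = ∑ n ∈ (x : PolynomialModule A M).coeff.support,
        (⟨PolynomialModule.single A n ((x : PolynomialModule A M).coeff n),
          single_mem_reesModule_iff.2 (x.2 n)⟩ : reesModule I M) := by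
      refine Subtype.ext (PolynomialModule.coeff_injective ?_)
      rw [AddSubmonoidClass.coe_finsetSum, PolynomialModule.coeff_sum]
      exact (Finsupp.sum_single _).symm
    rw [hx]
    exact sum_mem fun n _ => (key n _ (h n)).2

/-- The ring version of `mem_reesExtension_smul_top_iff`. -/
lemma mem_reesExtension_iff {r : reesAlgebra I} :
    r ∈ reesExtension I ↔ ∀ n, (r : Polynomial A).coeff n ∈ I ^ (n + 1) := by
  constructor
  · intro hr
    refine Submodule.span_induction (p := fun (r : reesAlgebra I) _ => ∀ n,
        (r : Polynomial A).coeff n ∈ I ^ (n + 1)) ?_ ?_ ?_ ?_ hr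
    · rintro _ ⟨a, ha, rfl⟩ n
      have h : (algebraMap A (reesAlgebra I) a : Polynomial A) = Polynomial.C a := rfl
      rw [h, Polynomial.coeff_C]
      split_ifs with hn
      · rw [hn, zero_add, pow_one]; exact ha
      · exact zero_mem _
    · intro n; exact zero_mem _
    · intro r s _ _ hr hs n
      rw [Subalgebra.coe_add, Polynomial.coeff_add]
      exact add_mem (hr n) (hs n)
    · intro s r _ hr n
      rw [smul_eq_mul, Subalgebra.coe_mul, Polynomial.coeff_mul]
      refine sum_mem fun p hp => ?_
      rw [← Finset.HasAntidiagonal.mem_antidiagonal.1 hp, add_assoc, pow_add]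
      exact Ideal.mul_mem_mul (s.2 p.1) (hr p.2)
  · intro h
    have key : ∀ n, ∀ y ∈ I ^ (n + 1), ∃ hy' : y ∈ I ^ n, reesMonomial I hy' ∈ reesExtension I := by
      intro n y hy
      rw [pow_succ'] at hy
      refine Submodule.mul_induction_on hy (fun a ha z hz => ?_) fun x y hx hy => ?_
      · refine ⟨Ideal.mul_mem_left _ _ hz, ?_⟩
        have : reesMonomial I (Ideal.mul_mem_left _ a hz) =
            reesMonomial I hz * algebraMap A (reesAlgebra I) a := by
          refine Subtype.ext ?_
          rw [Subalgebra.coe_mul]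
          change _ = Polynomial.monomial n z * Polynomial.monomial 0 a
          rw [Polynomial.monomial_mul_monomial, add_zero, mul_comm z a]
          rfl
        rw [this]
        exact Ideal.mul_mem_left _ _ (Ideal.mem_map_of_mem _ ha)
      · obtain ⟨hx', hx⟩ := hx
        obtain ⟨hy', hy⟩ := hy
        refine ⟨add_mem hx' hy', ?_⟩
        have := add_mem hx hy
        convert this using 1
        exact Subtype.ext (map_add _ _ _)
    have hr : r = ∑ n ∈ (r : Polynomial A).support, reesMonomial I (r.2 n) := by
      refine Subtype.ext ?_
      rw [AddSubmonoidClass.coe_finsetSum]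
      exact (r : Polynomial A).as_sum_support
    rw [hr]
    exact sum_mem fun n _ => (key n _ (h n)).2

/-- The class of `x t ^ n` in `G_I(M)`, for `x` in `I ^ n M`. -/
noncomputable def gSingle {n : ℕ} {x : M} (hx : x ∈ (I ^ n • ⊤ : Submodule A M)) : GModule I M :=
  Submodule.Quotient.mk ⟨PolynomialModule.single A n x, single_mem_reesModule_iff.2 hx⟩

lemma gSingle_eq_zero_iff {n : ℕ} {x : M} (hx : x ∈ (I ^ n • ⊤ : Submodule A M)) :
    gSingle hx = 0 ↔ x ∈ (I ^ (n + 1) • ⊤ : Submodule A M) := by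
  rw [gSingle, Submodule.Quotient.mk_eq_zero, mem_reesExtension_smul_top_iff]
  refine ⟨fun h => ?_, fun h k => ?_⟩
  · have := h n
    rwa [coeff_single_self] at this
  · rcases eq_or_ne n k with rfl | hk
    · rwa [coeff_single_self]
    · change (PolynomialModule.single A n x).coeff k ∈ _
      rw [coeff_single_of_ne hk]; exact zero_mem _

lemma gSingle_add {n : ℕ} {x y : M} (hx : x ∈ (I ^ n • ⊤ : Submodule A M))
    (hy : y ∈ (I ^ n • ⊤ : Submodule A M)) :
    gSingle (add_mem hx hy) = gSingle hx + gSingle hy := by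
  rw [gSingle, gSingle, gSingle, ← Submodule.Quotient.mk_add]
  exact congrArg _ (Subtype.ext (PolynomialModule.single_add _ _ _))

lemma smul_mem_pow_add {d n : ℕ} {a : A} {x : M} (ha : a ∈ I ^ d)
    (hx : x ∈ (I ^ n • ⊤ : Submodule A M)) : a • x ∈ (I ^ (d + n) • ⊤ : Submodule A M) := by
  rw [pow_add, mul_smul]
  exact Submodule.smul_mem_smul ha hx

lemma reesMonomial_smul_gSingle {d n : ℕ} {a : A} {x : M} (ha : a ∈ I ^ d)
    (hx : x ∈ (I ^ n • ⊤ : Submodule A M)) :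
    reesMonomial I ha • gSingle hx = gSingle (smul_mem_pow_add ha hx) := by
  rw [gSingle, gSingle, ← Submodule.Quotient.mk_smul]
  exact congrArg _ (Subtype.ext (smul_single_of_mem_reesHomogeneous (coe_reesMonomial ha) _ _))

instance finite_reesModule [IsNoetherianRing A] [Module.Finite A M] :
    Module.Finite (reesAlgebra I) (reesModule I M) :=
  Module.Finite.iff_fg.2 (((I.stableFiltration (⊤ : Submodule A M)).submodule_fg_iff_stable
    fun _ => IsNoetherian.noetherian _).2 (Ideal.stableFiltration_stable I ⊤))

end GModuleBasics

/-! ### Superficial elements -/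

section Superficial

variable {A : Type*} [CommRing A] [IsNoetherianRing A] {I : Ideal A}

lemma reesMonomial_one_mem_span {a : A} (ha : a ∈ I ^ 1) :
    reesMonomial I ha ∈ Ideal.span (Set.range (reesGenerators I)) := by
  have h : ∀ a ∈ I, ∃ ha : a ∈ I ^ 1,
      reesMonomial I ha ∈ Ideal.span (Set.range (reesGenerators I)) := by
    intro a ha
    rw [← span_generators I] at ha
    refine Submodule.span_induction ?_ ?_ ?_ ?_ ha
    · rintro _ ⟨i, rfl⟩
      exact ⟨by rw [pow_one]; exact generators_mem I i, Ideal.subset_span ⟨i, rfl⟩⟩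
    · refine ⟨zero_mem _, ?_⟩
      convert zero_mem (Ideal.span (Set.range (reesGenerators I))) using 1
      exact Subtype.ext (map_zero _)
    · rintro x y - - ⟨hx', hx⟩ ⟨hy', hy⟩
      refine ⟨add_mem hx' hy', ?_⟩
      convert add_mem hx hy using 1
      exact Subtype.ext (map_add _ _ _)
    · rintro b x - ⟨hx', hx⟩
      refine ⟨Ideal.mul_mem_left _ _ hx', ?_⟩
      convert Ideal.mul_mem_left _ (algebraMap A (reesAlgebra I) b) hx using 1
      refine Subtype.ext ?_
      rw [Subalgebra.coe_mul]
      change _ = Polynomial.monomial 0 b * Polynomial.monomial 1 x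
      rw [Polynomial.monomial_mul_monomial, zero_add]
      rfl
  exact (h a (by rwa [pow_one] at ha)).2

lemma reesMonomial_mem_span_pow {d : ℕ} {a : A} (ha : a ∈ I ^ d) :
    reesMonomial I ha ∈ Ideal.span (Set.range (reesGenerators I)) ^ d := by
  induction d generalizing a with
  | zero => rw [pow_zero, Ideal.one_eq_top]; trivial
  | succ d ih =>
    have h : ∃ ha : a ∈ I ^ (d + 1),
        reesMonomial I ha ∈ Ideal.span (Set.range (reesGenerators I)) ^ (d + 1) := by
      rw [pow_succ] at ha
      refine Submodule.mul_induction_on ha (fun b hb c hc => ?_) fun x y hx hy => ?_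
      · have hc' : c ∈ I ^ 1 := by rwa [pow_one]
        refine ⟨by rw [pow_succ]; exact Ideal.mul_mem_mul hb hc, ?_⟩
        rw [← reesMonomial_mul hb hc', pow_succ]
        exact Ideal.mul_mem_mul (ih hb) (reesMonomial_one_mem_span hc')
      · obtain ⟨hx', hx⟩ := hx
        obtain ⟨hy', hy⟩ := hy
        refine ⟨add_mem hx' hy', ?_⟩
        convert add_mem hx hy using 1
        exact Subtype.ext (map_add _ _ _)
    exact h.2

/-- Over a local ring with infinite residue field, finitely many proper submodules do not cover a
module. -/
lemma exists_forall_notMem_of_infinite_residueField {A : Type*} [CommRing A] [IsLocalRing A]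
    [Infinite (IsLocalRing.ResidueField A)] {V : Type*} [AddCommGroup V] [Module A V]
    (S : Set (Submodule A V)) (hS : S.Finite) (hne : ∀ W ∈ S, W ≠ ⊤) : ∃ v, ∀ W ∈ S, v ∉ W := by
  by_contra! hcon
  obtain ⟨W, hW, hfin⟩ := Submodule.exists_finiteIndex_of_cover (p := id) (s := hS.toFinset) (by
    rw [Set.eq_univ_iff_forall]
    intro v
    obtain ⟨W, hW, hv⟩ := hcon v
    exact Set.mem_biUnion (Finset.mem_coe.2 (hS.mem_toFinset.2 hW)) hv)
  rw [hS.mem_toFinset] at hW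
  obtain ⟨x, hx⟩ : ∃ x, x ∉ W := by
    by_contra! h
    exact hne W hW (Submodule.eq_top_iff'.2 h)
  have : W.toAddSubgroup.FiniteIndex := hfin
  have : Finite (V ⧸ W) := AddSubgroup.finite_quotient_of_finiteIndex (H := W.toAddSubgroup)
  let φ : A →ₗ[A] V ⧸ W := LinearMap.toSpanSingleton A _ (W.mkQ x)
  have hker : LinearMap.ker φ ≤ IsLocalRing.maximalIdeal A := by
    refine IsLocalRing.le_maximalIdeal fun h => hx ?_
    have : (1 : A) ∈ LinearMap.ker φ := h ▸ trivial
    rw [LinearMap.mem_ker, LinearMap.toSpanSingleton_apply, one_smul, Submodule.mkQ_apply,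
      Submodule.Quotient.mk_eq_zero] at this
    exact this
  have : Finite (A ⧸ LinearMap.ker φ) :=
    Finite.of_injective _ (LinearMap.ker_eq_bot.1 (Submodule.ker_liftQ_eq_bot _ φ le_rfl le_rfl))
  have : Finite (IsLocalRing.ResidueField A) :=
    Finite.of_surjective (Ideal.Quotient.factor hker) (Ideal.Quotient.factor_surjective hker)
  exact not_finite (IsLocalRing.ResidueField A)

/-- If every associated prime of a submodule `K` contains the ideal `T`, then a power of `T` kills
`K`, and `K` meets `T ^ n G` trivially for `n` large by the Artin-Rees lemma. -/
lemma exists_pow_smul_top_inf_eq_bot {R : Type*} [CommRing R] [IsNoetherianRing R] {G : Type*}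
    [AddCommGroup G] [Module R G] [Module.Finite R G] (T : Ideal R) (K : Submodule R G)
    (hK : ∀ P ∈ associatedPrimes R K, T ≤ P) : ∃ n₀, ∀ n ≥ n₀, T ^ n • ⊤ ⊓ K = ⊥ := by
  obtain ⟨c, hc⟩ := Ideal.exists_pow_le_of_le_radical_of_fg (I := T)
    (J := Module.annihilator R K) (by
      rw [← Ideal.sInf_minimalPrimes]
      exact le_sInf fun P hP => hK P
        (Module.associatedPrimes.minimalPrimes_annihilator_subset_associatedPrimes R K hP))
    (IsNoetherian.noetherian T)
  obtain ⟨k, hk⟩ := T.exists_pow_inf_eq_pow_smul K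
  refine ⟨k + c, fun n hn => ?_⟩
  rw [hk n (by omega), eq_bot_iff]
  refine Submodule.smul_le.2 fun r hr x hx => ?_
  have hr' := hc (Ideal.pow_le_pow_right (by omega : c ≤ n - k) hr)
  have := Module.mem_annihilator.1 hr' ⟨x, hx.2⟩
  exact congrArg Subtype.val this

/-- If `u t` lies in no associated prime of `G_I(M)` that does not contain the irrelevant ideal,
then multiplication by `u t` is injective on the components of large degree of `G_I(M)`. -/
lemma exists_forall_mem_of_smul_mem_pow_add_two {M : Type*} [AddCommGroup M] [Module A M]
    [Module.Finite A M] {u : A} (hu : u ∈ I ^ 1)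
    (hP : ∀ P ∈ associatedPrimes (reesAlgebra I) (GModule I M), reesMonomial I hu ∈ P →
      Ideal.span (Set.range (reesGenerators I)) ≤ P) :
    ∃ n₁, ∀ j ≥ n₁, ∀ m ∈ (I ^ j • ⊤ : Submodule A M),
      u • m ∈ (I ^ (j + 2) • ⊤ : Submodule A M) → m ∈ (I ^ (j + 1) • ⊤ : Submodule A M) := by
  let K : Submodule (reesAlgebra I) (GModule I M) :=
    LinearMap.ker (LinearMap.lsmul (reesAlgebra I) (GModule I M) (reesMonomial I hu))
  obtain ⟨n₁, hn₁⟩ := exists_pow_smul_top_inf_eq_bot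
    (Ideal.span (Set.range (reesGenerators I))) K (by
    intro P hPK
    refine hP P (associatedPrimes.subset_of_injective K.subtype_injective hPK) ?_
    obtain ⟨hPp, k, hk⟩ := isAssociatedPrime_iff.1 hPK
    rw [hk, Submodule.mem_colon_singleton, Submodule.mem_bot]
    exact Subtype.ext (LinearMap.mem_ker.1 k.2))
  refine ⟨n₁, fun j hj m hm hum => ?_⟩
  rw [← gSingle_eq_zero_iff hm]
  have h1 : gSingle hm ∈ K := by
    rw [LinearMap.mem_ker]
    change reesMonomial I hu • gSingle hm = 0
    rw [reesMonomial_smul_gSingle, gSingle_eq_zero_iff]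
    rwa [show 1 + j + 1 = j + 2 by ring]
  have h2 : ∃ hm : m ∈ (I ^ j • ⊤ : Submodule A M),
      gSingle hm ∈ (Ideal.span (Set.range (reesGenerators I)) ^ j • ⊤ :
        Submodule (reesAlgebra I) (GModule I M)) := by
    refine Submodule.smul_induction_on hm (fun a ha y _ => ?_) fun x y hx hy => ?_
    · have hy : y ∈ (I ^ 0 • ⊤ : Submodule A M) := by simp
      refine ⟨Submodule.smul_mem_smul ha trivial, ?_⟩
      have h := Submodule.smul_mem_smul (reesMonomial_mem_span_pow ha)
        (Submodule.mem_top (R := reesAlgebra I) (x := gSingle hy))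
      rwa [reesMonomial_smul_gSingle] at h
    · obtain ⟨hx', hx⟩ := hx
      obtain ⟨hy', hy⟩ := hy
      refine ⟨add_mem hx' hy', ?_⟩
      rw [gSingle_add hx' hy']
      exact add_mem hx hy
  exact (Submodule.mem_bot _).1 ((hn₁ j hj).le ⟨h2.2, h1⟩)

/-- Multiplying by a regular element lowers the `I`-adic order of an element by a bounded amount
only, by the Artin-Rees lemma. -/
lemma exists_forall_mem_pow_sub_of_smul_mem {M : Type*} [AddCommGroup M] [Module A M]
    [Module.Finite A M] {u : A} (hureg : IsSMulRegular M u) (I : Ideal A) :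
    ∃ k, ∀ n ≥ k, ∀ m : M, u • m ∈ (I ^ n • ⊤ : Submodule A M) →
      m ∈ (I ^ (n - k) • ⊤ : Submodule A M) := by
  obtain ⟨k, hk⟩ := I.exists_pow_inf_eq_pow_smul (LinearMap.range (LinearMap.lsmul A M u))
  refine ⟨k, fun n hn m hm => ?_⟩
  have h1 : u • m ∈ I ^ n • ⊤ ⊓ LinearMap.range (LinearMap.lsmul A M u) := ⟨hm, m, rfl⟩
  rw [hk n hn] at h1
  have h2 := Submodule.smul_mono (le_refl (I ^ (n - k)))
    (inf_le_right (b := LinearMap.range (LinearMap.lsmul A M u))) h1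
  rw [LinearMap.range_eq_map, ← Submodule.map_smul''] at h2
  obtain ⟨m', hm', h⟩ := h2
  rwa [← hureg h]

variable [IsLocalRing A] [Infinite (IsLocalRing.ResidueField A)]

/-- The existence of superficial elements: if `I` contains an `M`-regular element, then a general
element `u` of `I` is `M`-regular and satisfies `(I ^ (n + 1) M : u) = I ^ n M` for `n` large. -/
lemma exists_superficial {M : Type*} [AddCommGroup M] [Module A M] [Module.Finite A M]
    {x : A} (hxI : x ∈ I) (hx : IsSMulRegular M x) :
    ∃ u ∈ I, IsSMulRegular M u ∧ ∃ n₀, ∀ n ≥ n₀, ∀ m : M,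
      u • m ∈ (I ^ (n + 1) • ⊤ : Submodule A M) → m ∈ (I ^ n • ⊤ : Submodule A M) := by
  set R := reesAlgebra I
  set T : Ideal R := Ideal.span (Set.range (reesGenerators I))
  let δ : I →ₗ[A] R :=
    { toFun := fun a => reesMonomial I (d := 1) (by rw [pow_one]; exact a.2)
      map_add' := fun a b => Subtype.ext (map_add _ _ _)
      map_smul' := fun c a => Subtype.ext (by
        change Polynomial.monomial 1 (c * (a : A)) = _
        rw [← smul_eq_mul, ← Polynomial.smul_monomial]; rfl) }
  let S₁ : Set (Submodule A I) := (fun Q => Submodule.comap I.subtype Q) '' associatedPrimes A M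
  let S₂ : Set (Submodule A I) := (fun P : Ideal R => (P.restrictScalars A).comap δ) ''
    {P | P ∈ associatedPrimes R (GModule I M) ∧ ¬ T ≤ P}
  obtain ⟨⟨u, hu⟩, hu'⟩ := exists_forall_notMem_of_infinite_residueField (S₁ ∪ S₂)
    (((associatedPrimes.finite A M).image _).union
      (((associatedPrimes.finite R (GModule I M)).subset fun _ h => h.1).image _)) (by
    rintro _ (⟨Q, hQ, rfl⟩ | ⟨P, ⟨hP, hT⟩, rfl⟩) h
    · have hxQ : x ∈ Q := Submodule.eq_top_iff'.1 h ⟨x, hxI⟩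
      have := (biUnion_associatedPrimes_eq_compl_regular A M).le (Set.mem_biUnion hQ hxQ)
      exact this hx
    · refine hT (Ideal.span_le.2 ?_)
      rintro _ ⟨i, rfl⟩
      exact Submodule.eq_top_iff'.1 h ⟨_, generators_mem I i⟩)
  have hureg : IsSMulRegular M u := by
    by_contra hcon
    have := (biUnion_associatedPrimes_eq_compl_regular A M).ge hcon
    obtain ⟨Q, hQ, huQ⟩ := Set.mem_iUnion₂.1 this
    exact hu' _ (Or.inl ⟨Q, hQ, rfl⟩) huQ
  have hu1 : u ∈ I ^ 1 := by rwa [pow_one]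
  obtain ⟨n₁, hstep⟩ := exists_forall_mem_of_smul_mem_pow_add_two (M := M) hu1 (by
    intro P hP huP
    by_contra hT
    exact hu' _ (Or.inr ⟨P, ⟨hP, hT⟩, rfl⟩) huP)
  obtain ⟨k, hAR⟩ := exists_forall_mem_pow_sub_of_smul_mem hureg I
  refine ⟨u, hu, hureg, n₁ + k, fun n hn m hm => ?_⟩
  have hclimb : ∀ j, n₁ + j ≤ n → m ∈ (I ^ (n₁ + j) • ⊤ : Submodule A M) := by
    intro j
    induction j with
    | zero =>
      intro _
      exact Submodule.smul_mono_left (Ideal.pow_le_pow_right (by omega))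
        (hAR (n + 1) (by omega) m hm)
    | succ j ih =>
      intro hj
      exact hstep (n₁ + j) (by omega) m (ih (by omega))
        (Submodule.smul_mono_left (Ideal.pow_le_pow_right (by omega)) hm)
  have := hclimb (n - n₁) (by omega)
  rwa [show n₁ + (n - n₁) = n by omega] at this

end Superficial

/-! ### Čech cocycles of large degree -/

section CechTorsion

variable {R : Type*} [CommRing R] {E : Type*} [AddCommGroup E] [Module R E] {m : ℕ} {f : Fin m → R}

lemma smul_cechModule_eq_zero {s : R} (hs : ∀ e : E, s • e = 0) {p : ℕ} (z : CechModule f E p) :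
    s • z = 0 := by
  funext σ
  rw [Pi.smul_apply, Pi.zero_apply]
  generalize z σ = x
  induction x using LocalizedModule.induction_on with
  | h e t => rw [LocalizedModule.smul'_mk, hs, LocalizedModule.zero_mk]

/-- If the kernel of multiplication by `s` is torsion with respect to all the `f a`, then it
vanishes in the localizations. -/
lemma eq_zero_of_smul_cechModule_eq_zero {s : R}
    (hs : ∀ e : E, s • e = 0 → ∀ a, ∃ N : ℕ, f a ^ N • e = 0) {p : ℕ}
    {z : CechModule f E (p + 1)} (hz : s • z = 0) : z = 0 := by
  funext σ
  have hσ := congrFun hz σ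
  rw [Pi.smul_apply, Pi.zero_apply] at hσ
  rw [Pi.zero_apply]
  generalize z σ = x at hσ
  induction x using LocalizedModule.induction_on with
  | h e t =>
    rw [LocalizedModule.smul'_mk, ← LocalizedModule.zero_mk 1, LocalizedModule.mk_eq] at hσ
    obtain ⟨u, hu⟩ := hσ
    rw [smul_zero, smul_zero, one_smul, Submonoid.smul_def, smul_comm] at hu
    obtain ⟨N, hN⟩ := hs _ hu (σ 0)
    rw [← LocalizedModule.zero_mk 1, LocalizedModule.mk_eq]
    refine ⟨⟨f (σ 0), mem_cechDenominators f σ 0⟩ ^ N * u, ?_⟩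
    rw [smul_zero, smul_zero, one_smul, Submonoid.smul_def, Submonoid.coe_mul, mul_smul]
    exact hN

variable {𝒜 : ℕ → Set R} {π : ℤ → E →+ E}

/-- If multiplication by `s`, of degree one in the ideal generated by the `f a`, is injective in
large degrees, then there are no cocycles of large degree in cohomological degree zero. -/
lemma mem_cechBoundaries_zero_of_injective (G : IsCechGrading f 𝒜 π) {s : R}
    (hs : ∀ k, s ^ k ∈ 𝒜 k) (hsf : s ∈ Ideal.span (Set.range f)) (hπ : ∀ n e, π n (π n e) = π n e)
    {n₀ : ℤ} (hinj : ∀ n, n₀ ≤ n → ∀ e, π n e = e → s • e = 0 → e = 0)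
    {n : ℤ} (hn : n₀ ≤ n) {z : CechModule f E 0} (hz : cechD f E 0 z = 0)
    (hzn : G.cechProj n 0 z = z) : z ∈ cechBoundaries f E 0 := by
  obtain ⟨N, hN⟩ := exists_pow_smul_mem_cechBoundaries_of_mem_span _ hz hsf
  rw [mem_cechBoundaries_zero] at hN ⊢
  have h1 : ∀ σ, ∀ c ∈ cechDenominators f (p := 0) σ, c = 1 := by
    intro σ c hc
    rw [cechDenominators, Set.range_eq_empty, Submonoid.closure_empty] at hc
    exact Submonoid.mem_bot.1 hc
  have hone : (1 : R) ∈ 𝒜 0 := by simpa using hs 0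
  have hpow : ∀ N : ℕ, ∀ e : E, s ^ N • π n e = 0 → π n e = 0 := by
    intro N e
    induction N with
    | zero => intro h; simpa using h
    | succ N ih =>
      intro h
      exact ih (hinj (n + N) (by omega) _ (by rw [G.map_smul (hs N), hπ])
        (by rw [smul_smul, ← pow_succ']; exact h))
  funext σ
  have hNσ := congrFun hN σ
  have hzσ := congrFun hzn σ
  rw [G.cechProj_apply] at hzσ
  rw [Pi.smul_apply, Pi.zero_apply] at hNσ
  rw [Pi.zero_apply]
  generalize z σ = x at hNσ hzσ
  induction x using LocalizedModule.induction_on with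
  | h e t =>
    obtain rfl : t = 1 := Subtype.ext (h1 σ t t.2)
    rw [G.locProj_mk _ _ _ _ hone, Nat.cast_zero, add_zero] at hzσ
    rw [← hzσ, LocalizedModule.smul'_mk, ← LocalizedModule.zero_mk 1, LocalizedModule.mk_eq] at hNσ
    obtain ⟨c, hc'⟩ := hNσ
    obtain rfl : c = 1 := Subtype.ext (h1 σ c c.2)
    rw [smul_zero, smul_zero, one_smul, one_smul] at hc'
    rw [← hzσ, hpow N e hc', LocalizedModule.zero_mk]

variable {E' : Type*} [AddCommGroup E'] [Module R E'] {π' : ℤ → E' →+ E'}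

/-- Let `E → E → E' → 0` be exact, the first map being multiplication by an element `s` of degree
one whose kernel is torsion, and let `s` kill `E'`. If the cocycles of large degree of `E'` in
cohomological degree `i` are coboundaries, so are those of `E` in cohomological degree `i + 1`. -/
lemma mem_cechBoundaries_succ_of_exact (G : IsCechGrading f 𝒜 π) (G' : IsCechGrading f 𝒜 π')
    {s : R} (hs : ∀ k, s ^ k ∈ 𝒜 k) (hsf : s ∈ Ideal.span (Set.range f))
    (hπ : ∀ n e, π n (π n e) = π n e) {φ : E →ₗ[R] E'} (hφπ : ∀ n e, φ (π n e) = π' n (φ e))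
    (hφ : Function.Surjective φ) (hker : ∀ e, φ e = 0 → ∃ e', s • e' = e)
    (hsE' : ∀ e : E', s • e = 0) (htors : ∀ e : E, s • e = 0 → ∀ a, ∃ N : ℕ, f a ^ N • e = 0)
    {i : ℕ} {n₀ : ℤ} (hE' : ∀ n, n₀ ≤ n → ∀ z : CechModule f E' i, cechD f E' i z = 0 →
      G'.cechProj n i z = z → z ∈ cechBoundaries f E' i)
    {n : ℤ} (hn : n₀ ≤ n) {z : CechModule f E (i + 1)} (hz : cechD f E (i + 1) z = 0)
    (hzn : G.cechProj n (i + 1) z = z) : z ∈ cechBoundaries f E (i + 1) := by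
  have hs1 : s ∈ 𝒜 1 := by simpa using hs 1
  have descend : ∀ n, n₀ ≤ n → ∀ y : CechModule f E (i + 1), G.cechProj n (i + 1) y = y →
      s • y ∈ cechBoundaries f E (i + 1) → y ∈ cechBoundaries f E (i + 1) := by
    intro n hn y hyn hy
    obtain ⟨w, hw⟩ := (mem_cechBoundaries_succ f).1 hy
    have hdw₁ : cechD f E i (G.cechProj (n + 1) i w) = s • y := by
      rw [← G.cechProj_cechD, hw]
      exact (G.cechProj_smul n hs1 y).trans (by rw [hyn])
    have hw₁n := G.cechProj_cechProj hπ (n := n + 1) w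
    generalize G.cechProj (n + 1) i w = w₁ at hdw₁ hw₁n
    have hbar : cechMap f φ i w₁ ∈ cechBoundaries f E' i := by
      refine hE' (n + 1) (by omega) _ ?_ ?_
      · rw [← cechMap_cechD, hdw₁, map_smul]
        exact smul_cechModule_eq_zero hsE' _
      · rw [← G.cechMap_cechProj f G' hφπ, hw₁n]
    obtain ⟨b, hdb, hb⟩ : ∃ b : CechModule f E i,
        cechD f E i b = 0 ∧ cechMap f φ i b = cechMap f φ i w₁ := by
      rcases i with _ | i
      · exact ⟨0, map_zero _, by rw [map_zero]; exact ((mem_cechBoundaries_zero f).1 hbar).symm⟩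
      · obtain ⟨v', hv'⟩ := (mem_cechBoundaries_succ f).1 hbar
        obtain ⟨v, rfl⟩ := cechMap_surjective f hφ i v'
        exact ⟨cechD f _ i v, cechD_cechD f i v, by rw [cechMap_cechD, hv']⟩
    obtain ⟨w', hw'⟩ := exists_smul_eq_of_cechMap_eq_zero f hker (z := w₁ - b)
      (by rw [map_sub, hb, sub_self])
    refine (mem_cechBoundaries_succ f).2 ⟨w', ?_⟩
    refine (sub_eq_zero.1 (eq_zero_of_smul_cechModule_eq_zero htors
      (z := y - cechD f E i w') ?_)).symm
    rw [smul_sub, ← map_smul, hw', map_sub, hdb, sub_zero, hdw₁, sub_self]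
  obtain ⟨N, hN⟩ := exists_pow_smul_mem_cechBoundaries_of_mem_span _ hz hsf
  clear hz
  induction N with
  | zero => rwa [pow_zero, one_smul] at hN
  | succ N ihN =>
    refine ihN (descend (n + N) (by omega) _ ?_ ?_)
    · exact (G.cechProj_smul n (hs N) z).trans (by rw [hzn])
    · rwa [smul_smul, ← pow_succ']

end CechTorsion

/-! ### Vanishing of the local cohomology of `L^I(M)` in large degrees -/

section Vanishing

variable {A : Type*} [CommRing A] [IsNoetherianRing A] {I : Ideal A}

/-- If `u` is superficial, the kernel of multiplication by `u t` on `L^I(M)` is torsion. -/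
lemma exists_pow_smul_eq_zero_of_superficial {M : Type*} [AddCommGroup M] [Module A M]
    {u : A} {n₀ : ℕ} (hu : ∀ n ≥ n₀, ∀ m : M,
      u • m ∈ (I ^ (n + 1) • ⊤ : Submodule A M) → m ∈ (I ^ n • ⊤ : Submodule A M))
    {s : reesAlgebra I} (hs : (s : Polynomial A) = Polynomial.monomial 1 u) {e : LModule I M}
    (he : s • e = 0) (a : Fin (numGenerators I)) : ∃ N : ℕ, reesGenerators I a ^ N • e = 0 := by
  obtain ⟨F, rfl⟩ := Submodule.mkQ_surjective _ e
  refine ⟨n₀, ?_⟩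
  rw [← map_smul, Submodule.mkQ_apply, Submodule.Quotient.mk_eq_zero, mem_reesModule_iff] at he
  rw [← map_smul, Submodule.mkQ_apply, Submodule.Quotient.mk_eq_zero, mem_reesModule_iff]
  intro n
  rw [smul_coeff_of_mem_reesHomogeneous (coe_reesGenerators_pow a n₀)]
  split_ifs with hn
  · have h := he (n - n₀ + 1)
    rw [smul_coeff_of_mem_reesHomogeneous hs, if_pos (by omega), Nat.add_sub_cancel] at h
    refine hu n hn _ ?_
    rw [smul_comm, show n + 1 = n₀ + (n - n₀ + 1) by omega]
    exact smul_mem_pow_add (Ideal.pow_mem_pow (generators_mem I a) _) h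
  · exact zero_mem _

/-- The case of `mem_cechBoundaries_succ_of_exact` where `N` is `M / u M` for a superficial
element `u`. -/
lemma mem_cechBoundaries_succ_of_superficial {M N : Type*} [AddCommGroup M] [Module A M]
    [AddCommGroup N] [Module A N] {u : A} (hu1 : u ∈ I ^ 1) {n₁ : ℕ} (hu : ∀ n ≥ n₁, ∀ m : M,
      u • m ∈ (I ^ (n + 1) • ⊤ : Submodule A M) → m ∈ (I ^ n • ⊤ : Submodule A M))
    {φ : M →ₗ[A] N} (hφ : Function.Surjective φ) (hker : ∀ x, φ x = 0 → ∃ y, u • y = x)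
    (hN : ∀ y : N, u • y = 0) {i : ℕ} {n₀ : ℤ} (hn₀ : ∀ n, n₀ ≤ n → HL I N i n = ⊥)
    {n : ℤ} (hn : n₀ ≤ n) {z : CechModule (reesGenerators I) (LModule I M) (i + 1)}
    (hz : cechD (reesGenerators I) (LModule I M) (i + 1) z = 0)
    (hzn : (isCechGrading_lModule I M).cechProj n (i + 1) z = z) :
    z ∈ cechBoundaries (reesGenerators I) (LModule I M) (i + 1) :=
  mem_cechBoundaries_succ_of_exact (isCechGrading_lModule I M) (isCechGrading_lModule I N)
    (reesMonomial_pow_mem_reesHomogeneous hu1) (reesMonomial_one_mem_span hu1) lProj_lProj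
    (lMap_lProj φ) (lMap_surjective hφ)
    (exists_smul_eq_of_lMap_eq_zero hφ hker (coe_reesMonomial hu1))
    (smul_lModule_eq_zero hN (coe_reesMonomial hu1))
    (fun _ he a => exists_pow_smul_eq_zero_of_superficial hu (coe_reesMonomial hu1) he a)
    (fun n hn => HL_eq_bot_iff.1 (hn₀ n hn)) hn hz hzn

variable [IsLocalRing A] [Infinite (IsLocalRing.ResidueField A)]

/-- If `grade(I, M) > i`, then `H^i(L^I(M))` vanishes in large degrees: for a superficial element
`u` the module `L^I(M / u M)` is the cokernel of multiplication by `u t` on `L^I(M)`, up to the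
shift in degree, and multiplication by `u t` is nilpotent on the classes of cocycles. -/
theorem exists_forall_HL_eq_bot (hI : I ≤ IsLocalRing.maximalIdeal A) (i : ℕ) {M : Type*}
    [AddCommGroup M] [Module A M] [Module.Finite A M] (hM : HasWeaklyRegularSeq I (i + 1) M) :
    ∃ n₀ : ℕ, ∀ n : ℤ, n₀ ≤ n → HL I M i n = ⊥ := by
  induction i generalizing M with
  | zero =>
    obtain ⟨x, hxI, hx, -⟩ := hasWeaklyRegularSeq_succ_iff.1 hM
    obtain ⟨u, huI, hureg, n₀, hu⟩ := exists_superficial hxI hx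
    have hu1 : u ∈ I ^ 1 := by rwa [pow_one]
    refine ⟨n₀, fun n hn => HL_eq_bot_iff.2 fun z hz hzn => ?_⟩
    refine mem_cechBoundaries_zero_of_injective (isCechGrading_lModule I M)
      (reesMonomial_pow_mem_reesHomogeneous hu1) (reesMonomial_one_mem_span hu1) lProj_lProj
      (n₀ := n₀) ?_ hn hz hzn
    intro n hn e he hse
    rcases he ▸ lProj_mem n e with rfl | ⟨k, m, hk, rfl⟩
    · rfl
    · change _ • lSingle I k m = 0 at hse
      change lSingle I k m = 0
      rw [smul_lSingle (coe_reesMonomial _), lSingle_eq_zero_iff, add_comm 1 k] at hse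
      exact lSingle_eq_zero_iff.2 (hu k (by omega) _ hse)
  | succ i ih =>
    obtain ⟨x, hxI, hx, -⟩ := hasWeaklyRegularSeq_succ_iff.1 hM
    obtain ⟨u, huI, hureg, n₁, hu⟩ := exists_superficial hxI hx
    have hu1 : u ∈ I ^ 1 := by rwa [pow_one]
    obtain ⟨n₀, hn₀⟩ := ih (hM.quotSMulTop hI huI hureg)
    refine ⟨n₀, fun n hn => HL_eq_bot_iff.2 fun z hz hzn => ?_⟩
    exact mem_cechBoundaries_succ_of_superficial hu1 hu
      (φ := (Submodule.mkQ _ : M →ₗ[A] QuotSMulTop u M)) (Submodule.mkQ_surjective _)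
      (fun x hx => quotSMulTop_mk_eq_zero.1 hx)
      (fun y => by
        obtain ⟨x, rfl⟩ := Submodule.Quotient.mk_surjective _ y
        exact quotSMulTop_mk_eq_zero.2 ⟨x, rfl⟩) (fun n hn => hn₀ n hn) hn hz hzn

end Vanishing

/-! ### Finiteness of the amplitude -/

section AmpFinite

variable {A : Type*} [CommRing A] [IsNoetherianRing A] {I : Ideal A}
  {M : Type*} [AddCommGroup M] [Module A M]

lemma HL_eq_bot_of_numGenerators_lt {i : ℕ} (hi : numGenerators I < i) (n : ℤ) :
    HL I M i n = ⊥ := by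
  refine HL_eq_bot_iff.2 fun z _ _ => ?_
  have : IsEmpty (Fin i ↪o Fin (numGenerators I)) := ⟨fun σ => by
    have := Fintype.card_le_of_embedding σ.toEmbedding
    simp only [Fintype.card_fin] at this
    omega⟩
  rw [Subsingleton.elim z 0]
  exact zero_mem _

lemma xi_le_grade : xi I M ≤ grade I M := sInf_le (Or.inl rfl)

lemma HL_eq_bot_of_lt_xi {i : ℕ} (hi : (i : ℕ∞) < xi I M) :
    HL I M i (-1) = ⊥ ∧ {j : ℤ | j < 0 ∧ HL I M i j ≠ ⊥}.Finite := by
  by_contra hcon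
  refine absurd hi (not_lt.2 (sInf_le (Or.inr ⟨i, rfl, hi.trans_le xi_le_grade, ?_⟩)))
  by_cases h : HL I M i (-1) = ⊥
  · exact Or.inr fun hfin => hcon ⟨h, hfin⟩
  · exact Or.inl h

variable [IsLocalRing A] [Infinite (IsLocalRing.ResidueField A)]

/-- Only finitely many pairs of degrees contribute to the amplitude: large degrees are excluded by
`exists_forall_HL_eq_bot`, negative ones by the definition of `ξ_I(M)`, and the cohomological degree
is bounded by the length of the Čech complex. -/
theorem amp_lt_top (hI : I ≤ IsLocalRing.maximalIdeal A) [Module.Finite A M] : amp I M < ⊤ := by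
  have hfin : ∀ i : ℕ, {n : ℤ | (i : ℕ∞) < xi I M ∧ HL I M i (n - 1) ≠ ⊥}.Finite := by
    intro i
    by_cases hi : (i : ℕ∞) < xi I M
    · have hgr : HasWeaklyRegularSeq I (i + 1) M := by
        rw [← le_grade_iff]
        push_cast
        exact Order.add_one_le_of_lt (hi.trans_le xi_le_grade)
      obtain ⟨n₀, hn₀⟩ := exists_forall_HL_eq_bot hI i hgr
      have h := ((HL_eq_bot_of_lt_xi hi).2.image (· + 1)).union (Set.finite_Icc (1 : ℤ) (n₀ + 1))
      refine h.subset fun n hn => ?_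
      by_cases h0 : n - 1 < 0
      · exact Or.inl ⟨n - 1, ⟨h0, hn.2⟩, by dsimp only; ring⟩
      · refine Or.inr ⟨by omega, ?_⟩
        by_contra hlt
        exact hn.2 (hn₀ _ (by omega))
    · exact Set.finite_empty.subset fun n hn => hi hn.1
  have hfin' : (⋃ i ∈ Set.Iic (numGenerators I),
      {n : ℤ | (i : ℕ∞) < xi I M ∧ HL I M i (n - 1) ≠ ⊥}).Finite :=
    (Set.finite_Iic _).biUnion fun i _ => hfin i
  obtain ⟨B, hB⟩ := (hfin'.image Int.natAbs).bddAbove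
  refine lt_of_le_of_lt (sSup_le ?_) (ENat.natCast_lt_top B)
  rintro _ ⟨n, i, rfl, hi, hn⟩
  have hi' : i ≤ numGenerators I := by
    by_contra hlt
    exact hn (HL_eq_bot_of_numGenerators_lt (not_le.1 hlt) _)
  exact_mod_cast hB ⟨n, Set.mem_biUnion hi' ⟨hi, hn⟩, rfl⟩

end AmpFinite

/-! ### Koszul cohomology and regular sequences of length two -/

section Koszul

variable {R : Type*} [CommRing R] {N : Type*} [AddCommGroup N] [Module R N]

lemma isSMulRegular_quotSMulTop_iff {y v : R} : IsSMulRegular (QuotSMulTop y N) v ↔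
    ∀ n n' : N, v • n = y • n' → ∃ n'', n = y • n'' := by
  constructor
  · intro h n n' hn
    have : v • (Submodule.Quotient.mk n : QuotSMulTop y N) = 0 := by
      rw [← Submodule.Quotient.mk_smul]
      exact quotSMulTop_mk_eq_zero.2 ⟨n', hn.symm⟩
    obtain ⟨n'', h''⟩ := quotSMulTop_mk_eq_zero.1
      (h (this.trans (smul_zero v).symm) : (Submodule.Quotient.mk n : QuotSMulTop y N) = 0)
    exact ⟨n'', h''.symm⟩
  · intro h
    refine isSMulRegular_iff_right_eq_zero_of_smul.2 fun q hq => ?_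
    obtain ⟨n, rfl⟩ := Submodule.Quotient.mk_surjective _ q
    rw [← Submodule.Quotient.mk_smul] at hq
    obtain ⟨n', hn'⟩ := quotSMulTop_mk_eq_zero.1 hq
    obtain ⟨n'', h''⟩ := h n n' hn'.symm
    exact quotSMulTop_mk_eq_zero.2 ⟨n'', h''.symm⟩

lemma hasWeaklyRegularSeq_two_iff {J : Ideal R} : HasWeaklyRegularSeq J 2 N ↔
    ∃ y ∈ J, IsSMulRegular N y ∧ ∃ v ∈ J, ∀ n n' : N, v • n = y • n' → ∃ n'', n = y • n'' := by
  simp only [hasWeaklyRegularSeq_succ_iff (k := 1), hasWeaklyRegularSeq_succ_iff (k := 0),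
    hasWeaklyRegularSeq_zero, and_true, isSMulRegular_quotSMulTop_iff]

/-- If `y, v` is a regular sequence, so is `y ^ k, v ^ l`. -/
lemma exists_eq_pow_smul {y v : R} (hy : IsSMulRegular N y)
    (hv : ∀ n n' : N, v • n = y • n' → ∃ n'', n = y • n'') (k l : ℕ) {n n' : N}
    (h : v ^ l • n = y ^ k • n') : ∃ n'', n = y ^ k • n'' := by
  have h1 : ∀ k, ∀ n n' : N, v • n = y ^ k • n' → ∃ n'', n = y ^ k • n'' := by
    intro k
    induction k with
    | zero => intro n n' _; exact ⟨n, by simp⟩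
    | succ k ih =>
      intro n n' h
      rw [pow_succ', mul_smul] at h
      obtain ⟨n₁, rfl⟩ := hv _ _ h
      rw [smul_comm] at h
      obtain ⟨n₂, rfl⟩ := ih _ _ (hy h)
      exact ⟨n₂, by rw [pow_succ', mul_smul]⟩
  induction l generalizing n n' with
  | zero => exact ⟨n', by simpa using h⟩
  | succ l ih =>
    rw [pow_succ', mul_smul] at h
    obtain ⟨n₁, hn₁⟩ := h1 k _ _ h
    exact ih hn₁

/-- Exactness of the Koszul complex in degree one: if the ideal generated by the `w i` has grade at
least two up to radical, then families `n i` with `w i • n j = w j • n i` are of the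
form `w i • e`. -/
lemma exists_eq_smul_of_hasWeaklyRegularSeq {J : Ideal R} (hJ : HasWeaklyRegularSeq J 2 N)
    {ι : Type*} [Finite ι] {w : ι → R} (hw : J ≤ (Ideal.span (Set.range w)).radical) {n : ι → N}
    (hn : ∀ i j, w i • n j = w j • n i) : ∃ e, ∀ i, n i = w i • e := by
  obtain ⟨y, hyJ, hy, v, hvJ, hv⟩ := hasWeaklyRegularSeq_two_iff.1 hJ
  have := Fintype.ofFinite ι
  have key : ∀ u ∈ J, ∃ k : ℕ, ∃ h : N, (∀ i, u ^ k • n i = w i • h) ∧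
      ∀ m : N, (∀ i, w i • m = 0) → u ^ k • m = 0 := by
    intro u hu
    obtain ⟨k, hk⟩ := hw hu
    obtain ⟨g, hg⟩ := (Ideal.mem_span_range_iff_exists_fun).1 hk
    refine ⟨k, ∑ i, g i • n i, fun j => ?_, fun m hm => ?_⟩
    · rw [← hg, Finset.sum_smul, Finset.smul_sum]
      refine Finset.sum_congr rfl fun i _ => ?_
      rw [mul_smul, hn, smul_comm]
    · rw [← hg, Finset.sum_smul]
      exact Finset.sum_eq_zero fun i _ => by rw [mul_smul, hm, smul_zero]
  obtain ⟨k, h, hh, hk⟩ := key y hyJ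
  obtain ⟨l, h', hh', -⟩ := key v hvJ
  have h1 : v ^ l • h = y ^ k • h' := by
    refine sub_eq_zero.1 ((hy.pow k).right_eq_zero_of_smul (hk _ fun i => ?_))
    rw [smul_sub, smul_comm, ← hh, smul_comm (w i), ← hh', smul_comm, sub_self]
  obtain ⟨e, rfl⟩ := exists_eq_pow_smul hy hv k l h1
  refine ⟨e, fun i => hy.pow k ?_⟩
  change y ^ k • n i = y ^ k • w i • e
  rw [hh, smul_comm]

/-- If the ideal generated by the `w i` contains a regular element up to radical, then no nonzero
element is killed by all the `w i`. -/
lemma eq_zero_of_hasWeaklyRegularSeq {J : Ideal R} {k : ℕ} (hJ : HasWeaklyRegularSeq J (k + 1) N)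
    {ι : Type*} {w : ι → R} (hw : J ≤ (Ideal.span (Set.range w)).radical) {n : N}
    (hn : ∀ i, w i • n = 0) : n = 0 := by
  obtain ⟨y, hyJ, hy, -⟩ := hasWeaklyRegularSeq_succ_iff.1 hJ
  obtain ⟨l, hl⟩ := hw hyJ
  refine (hy.pow l).right_eq_zero_of_smul ?_
  have : Ideal.span (Set.range w) ≤ LinearMap.ker (LinearMap.toSpanSingleton R N n) := by
    rw [Ideal.span_le]
    rintro _ ⟨i, rfl⟩
    exact hn i
  exact this hl

/-- A converse of `exists_eq_smul_of_hasWeaklyRegularSeq`: vanishing of the Koszul cohomology in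
degrees zero and one gives a regular sequence of length two. -/
lemma hasWeaklyRegularSeq_two_of_forall_exists [IsNoetherianRing R] [Module.Finite R N]
    {J : Ideal R} {ι : Type*} {w : ι → R} (hwJ : ∀ i, w i ∈ J)
    (h0 : ∀ n : N, (∀ i, w i • n = 0) → n = 0)
    (h1 : ∀ n : ι → N, (∀ i j, w i • n j = w j • n i) → ∃ e, ∀ i, n i = w i • e) :
    HasWeaklyRegularSeq J 2 N := by
  obtain ⟨y, hyJ, hy⟩ := exists_isSMulRegular_of_forall_eq_zero (J := J) (N := N)
    fun n hn => h0 n fun i => hn _ (hwJ i)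
  refine hasWeaklyRegularSeq_succ_iff.2 ⟨y, hyJ, hy, ?_⟩
  obtain ⟨v, hvJ, hv⟩ := exists_isSMulRegular_of_forall_eq_zero (J := J) (N := QuotSMulTop y N) (by
    intro q hq
    obtain ⟨n, rfl⟩ := Submodule.Quotient.mk_surjective _ q
    have : ∀ i, ∃ n', y • n' = w i • n := fun i => quotSMulTop_mk_eq_zero.1 (hq _ (hwJ i))
    choose n' hn' using this
    obtain ⟨e, he⟩ := h1 n' fun i j => hy (by
      change y • w i • n' j = y • w j • n' i
      rw [smul_comm, hn', smul_comm y, hn', smul_comm])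
    refine quotSMulTop_mk_eq_zero.2 ⟨e, ?_⟩
    refine (sub_eq_zero.1 (h0 _ fun i => ?_)).symm
    rw [smul_sub, ← hn', he, smul_comm y, sub_self])
  exact hasWeaklyRegularSeq_succ_iff.2 ⟨v, hvJ, hv, hasWeaklyRegularSeq_zero⟩

end Koszul

/-! ### The first terms of the Čech complex -/

section Unwinding

variable {A : Type*} [CommRing A] [IsNoetherianRing A] {I : Ideal A}
  {M : Type*} [AddCommGroup M] [Module A M]

/-- The index of the `0`-th localization in the Čech complex. -/
def emptyIndex (m : ℕ) : Fin 0 ↪o Fin m := RelEmbedding.ofIsEmpty (· ≤ ·) (· ≤ ·)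

lemma eq_emptyIndex {m : ℕ} (σ : Fin 0 ↪o Fin m) : σ = emptyIndex m := by
  ext i; exact i.elim0

/-- The index of the localization at a single element. -/
def singleIndex {m : ℕ} (a : Fin m) : Fin 1 ↪o Fin m :=
  OrderEmbedding.ofStrictMono (fun _ => a) fun i j h => by
    rw [Subsingleton.elim i j] at h; exact absurd h (lt_irrefl _)

lemma singleIndex_apply {m : ℕ} (a : Fin m) (i : Fin 1) : singleIndex a i = a := rfl

lemma eq_singleIndex {m : ℕ} (σ : Fin 1 ↪o Fin m) : σ = singleIndex (σ 0) := by
  ext i; rw [Subsingleton.elim i 0]; rfl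

/-- The index of the localization at two elements. -/
def pairIndex {m : ℕ} {a b : Fin m} (h : a < b) : Fin 2 ↪o Fin m :=
  OrderEmbedding.ofStrictMono ![a, b] fun i j hij => by
    fin_cases i <;> fin_cases j <;> simp_all

variable {R : Type*} [CommRing R] {E : Type*} [AddCommGroup E] [Module R E] {m : ℕ} {f : Fin m → R}

lemma eq_one_of_mem_cechDenominators {σ : Fin 0 ↪o Fin m} {c : R}
    (hc : c ∈ cechDenominators f σ) : c = 1 := by
  rw [cechDenominators, Set.range_eq_empty, Submonoid.closure_empty] at hc
  exact Submonoid.mem_bot.1 hc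

lemma pow_mem_cechDenominators {p : ℕ} (σ : Fin p ↪o Fin m) (i : Fin p) (k : ℕ) :
    f (σ i) ^ k ∈ cechDenominators f σ := pow_mem (mem_cechDenominators f σ i) k

lemma exists_eq_pow_of_mem_cechDenominators {σ : Fin 1 ↪o Fin m} {c : R}
    (hc : c ∈ cechDenominators f σ) : ∃ k, c = f (σ 0) ^ k := by
  have h : Set.range (f ∘ σ) = {f (σ 0)} := by
    rw [Set.range_unique]; rfl
  rw [cechDenominators, h, Submonoid.mem_closure_singleton] at hc
  obtain ⟨k, hk⟩ := hc
  exact ⟨k, hk.symm⟩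

lemma exists_eq_mul_pow_of_mem_cechDenominators {σ : Fin 2 ↪o Fin m} {c : R}
    (hc : c ∈ cechDenominators f σ) : ∃ k l, c = f (σ 0) ^ k * f (σ 1) ^ l := by
  induction hc using Submonoid.closure_induction with
  | mem s hs =>
    obtain ⟨i, rfl⟩ := hs
    fin_cases i
    · exact ⟨1, 0, by simp⟩
    · exact ⟨0, 1, by simp⟩
  | one => exact ⟨0, 0, by simp⟩
  | mul s t _ _ hs ht =>
    obtain ⟨k, l, rfl⟩ := hs
    obtain ⟨k', l', rfl⟩ := ht
    exact ⟨k + k', l + l', by ring⟩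

end Unwinding

/-! ### Čech cocycles of degrees zero and one -/

section UnwindingGraded

variable {R : Type*} [CommRing R] {E : Type*} [AddCommGroup E] [Module R E] {m : ℕ} {f : Fin m → R}
  {𝒜 : ℕ → Set R} {π : ℤ → E →+ E}

/-- Elements that vanish in all the localizations at the `f a` are the cocycles of degree zero. -/
lemma eq_zero_of_forall_cocycle_zero (G : IsCechGrading f 𝒜 π) (hone : (1 : R) ∈ 𝒜 0) {n : ℤ}
    (H : ∀ z : CechModule f E 0, cechD f E 0 z = 0 → G.cechProj n 0 z = z →
      z ∈ cechBoundaries f E 0) {e : E} (he : π n e = e) (hfe : ∀ a, ∃ k : ℕ, f a ^ k • e = 0) :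
    e = 0 := by
  have h := H (fun _ => LocalizedModule.mk e 1) (by
    funext σ
    rw [cechD_apply, Fin.sum_univ_one, liftOfLE_mk, Pi.zero_apply]
    obtain ⟨k, hk⟩ := hfe (σ 0)
    have : LocalizedModule.mk e ⟨((1 : cechDenominators f (cechFace σ 0)) : R),
        cechDenominators_face_le f σ 0 (one_mem _)⟩ = (0 : LocalizedModule _ E) := by
      rw [← LocalizedModule.zero_mk 1, LocalizedModule.mk_eq]
      refine ⟨⟨_, pow_mem_cechDenominators σ 0 k⟩, ?_⟩
      rw [smul_zero, smul_zero, one_smul]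
      exact hk
    exact (congrArg _ this).trans (smul_zero _)) (by
    funext σ
    rw [G.cechProj_apply, G.locProj_mk _ _ _ _ hone, Nat.cast_zero, add_zero, he])
  rw [mem_cechBoundaries_zero] at h
  have h' := congrFun h (emptyIndex m)
  rw [Pi.zero_apply, ← LocalizedModule.zero_mk 1, LocalizedModule.mk_eq] at h'
  obtain ⟨c, hc⟩ := h'
  rw [smul_zero, smul_zero, one_smul, Submonoid.smul_def, eq_one_of_mem_cechDenominators c.2,
    one_smul] at hc
  exact hc

/-- If the homogeneous cocycles of degree one are coboundaries, then families `e a` with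
`f a ^ k • e b = f b ^ k • e a` are of the form `f a ^ k • e`, up to torsion. -/
lemma exists_of_forall_cocycle_one (G : IsCechGrading f 𝒜 π) (hf : ∀ a k, f a ^ k ∈ 𝒜 k)
    (hone : (1 : R) ∈ 𝒜 0) (hπ : ∀ n e, π n (π n e) = π n e) {n : ℤ}
    (H : ∀ z : CechModule f E 1, cechD f E 1 z = 0 → G.cechProj n 1 z = z →
      z ∈ cechBoundaries f E 1) {k : ℕ} {e : Fin m → E} (he : ∀ a, π (n + k) (e a) = e a)
    (hfe : ∀ a b, f a ^ k • e b = f b ^ k • e a) :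
    ∃ e₀, π n e₀ = e₀ ∧ ∀ a, ∃ N : ℕ, f a ^ N • (e a - f a ^ k • e₀) = 0 := by
  have h := H (fun σ => LocalizedModule.mk (e (σ 0)) ⟨_, pow_mem_cechDenominators σ 0 k⟩) (by
    funext σ
    rw [cechD_apply, Fin.sum_univ_two, liftOfLE_mk, liftOfLE_mk, Pi.zero_apply]
    have : LocalizedModule.mk (e (cechFace σ 0 0)) ⟨f (cechFace σ 0 0) ^ k,
          cechDenominators_face_le f σ 0 (pow_mem_cechDenominators _ 0 k)⟩ =
        LocalizedModule.mk (e (cechFace σ 1 0)) ⟨f (cechFace σ 1 0) ^ k,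
          cechDenominators_face_le f σ 1 (pow_mem_cechDenominators _ 0 k)⟩ := by
      rw [LocalizedModule.mk_eq]
      refine ⟨1, ?_⟩
      rw [one_smul, one_smul]
      exact hfe _ _
    rw [Fin.val_zero, Fin.val_one, pow_zero, pow_one, one_smul, neg_one_smul]
    exact (congrArg (· + _) this).trans (add_neg_cancel _)) (by
    funext σ
    rw [G.cechProj_apply, G.locProj_mk _ _ _ _ (hf _ k), he])
  obtain ⟨w, hw⟩ := (mem_cechBoundaries_succ f).1 h
  have hw' : cechD f E 0 (G.cechProj n 0 w) =
      fun σ => LocalizedModule.mk (e (σ 0)) ⟨_, pow_mem_cechDenominators σ 0 k⟩ := by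
    rw [← G.cechProj_cechD, hw]
    funext σ
    rw [G.cechProj_apply, G.locProj_mk _ _ _ _ (hf _ k), he]
  obtain ⟨e₀, he₀, hwe⟩ : ∃ e₀, π n e₀ = e₀ ∧
      G.cechProj n 0 w (emptyIndex m) = LocalizedModule.mk e₀ 1 := by
    rw [G.cechProj_apply]
    generalize w (emptyIndex m) = x
    induction x using LocalizedModule.induction_on with
    | h e t =>
      obtain rfl : t = 1 := Subtype.ext (eq_one_of_mem_cechDenominators t.2)
      exact ⟨π n e, hπ n e, by rw [G.locProj_mk _ _ _ _ hone, Nat.cast_zero, add_zero]⟩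
  refine ⟨e₀, he₀, fun a => ?_⟩
  have ha := congrFun hw' (singleIndex a)
  rw [cechD_apply, Fin.sum_univ_one, Fin.val_zero, pow_zero, one_smul] at ha
  have h0 : G.cechProj n 0 w (cechFace (singleIndex a) 0) = LocalizedModule.mk e₀ 1 := by
    have := eq_emptyIndex (cechFace (singleIndex a) 0)
    generalize cechFace (singleIndex a) 0 = τ at this
    subst this
    exact hwe
  rw [h0, liftOfLE_mk, LocalizedModule.mk_eq] at ha
  obtain ⟨⟨c, hc⟩, hca⟩ := ha
  obtain ⟨N, rfl⟩ := exists_eq_pow_of_mem_cechDenominators hc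
  refine ⟨N, ?_⟩
  have hca' : f a ^ N • f a ^ k • e₀ = f a ^ N • (1 : R) • e a := hca
  rw [smul_sub, hca', one_smul, sub_self]

/-- If the families `e a` with `f a ^ k • e b = f b ^ k • e a` consist of torsion elements for `k`
large and divisible by `c`, then there are no nonzero homogeneous cocycles of degree one. -/
lemma eq_zero_of_forall_exists_pow_smul_eq_zero (G : IsCechGrading f 𝒜 π)
    (hf : ∀ a k, f a ^ k ∈ 𝒜 k) (hπ : ∀ n e, π n (π n e) = π n e) {n : ℤ} {c k₀ : ℕ} (hc : 0 < c)
    (H : ∀ k, k₀ ≤ k → c ∣ k → ∀ e : Fin m → E, (∀ a, π (n + k) (e a) = e a) →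
      (∀ a b, f a ^ k • e b = f b ^ k • e a) → ∀ a, ∃ N : ℕ, f a ^ N • e a = 0)
    {z : CechModule f E 1} (hz : cechD f E 1 z = 0) (hzn : G.cechProj n 1 z = z) : z = 0 := by
  have h1 : ∀ a, ∃ r : ℕ, ∃ e, π (n + r) e = e ∧ z (singleIndex a) =
      LocalizedModule.mk e ⟨_, pow_mem_cechDenominators (singleIndex a) 0 r⟩ := by
    intro a
    have ha := congrFun hzn (singleIndex a)
    rw [G.cechProj_apply] at ha
    generalize z (singleIndex a) = x at ha
    induction x using LocalizedModule.induction_on with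
    | h e t =>
      obtain ⟨t, ht⟩ := t
      obtain ⟨r, rfl⟩ := exists_eq_pow_of_mem_cechDenominators ht
      refine ⟨r, π (n + r) e, hπ _ _, ?_⟩
      rw [← ha, G.locProj_mk _ _ _ _ (hf _ r)]
  -- a common denominator exponent `D`
  obtain ⟨D, hD⟩ : ∃ D : ℕ, ∀ a, ∃ e, π (n + D) e = e ∧ z (singleIndex a) =
      LocalizedModule.mk e ⟨_, pow_mem_cechDenominators (singleIndex a) 0 D⟩ := by
    refine exists_forall_of_finite h1 ?_
    rintro a r r' hr ⟨e, he, hze⟩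
    obtain ⟨j, rfl⟩ := Nat.exists_eq_add_of_le hr
    refine ⟨f a ^ j • e, ?_, ?_⟩
    · have := G.map_smul (hf a j) (n + r) e
      rw [he] at this
      push_cast
      rw [← add_assoc]
      exact this
    · rw [hze, LocalizedModule.mk_eq]
      refine ⟨1, ?_⟩
      simp only [Submonoid.smul_def, one_smul, singleIndex_apply, smul_smul, pow_add]
  choose e he hze using hD
  have h2 : ∀ p : Fin m × Fin m, ∃ N : ℕ,
      (f p.1 * f p.2) ^ N • (f p.1 ^ D • e p.2) = (f p.1 * f p.2) ^ N • (f p.2 ^ D • e p.1) := by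
    have hlt : ∀ a b, a < b → ∃ N : ℕ,
        (f a * f b) ^ N • (f a ^ D • e b) = (f a * f b) ^ N • (f b ^ D • e a) := by
      intro a b hab
      have hτ := congrFun hz (pairIndex hab)
      have h0 : cechFace (pairIndex hab) 0 = singleIndex b := by
        ext i; rw [Subsingleton.elim i 0]; rfl
      have h1 : cechFace (pairIndex hab) 1 = singleIndex a := by
        ext i; rw [Subsingleton.elim i 0]; rfl
      have hb : z (cechFace (pairIndex hab) 0) = LocalizedModule.mk (e b)
          ⟨f b ^ D, by rw [h0]; exact pow_mem_cechDenominators (singleIndex b) 0 D⟩ := by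
        generalize_proofs hp
        generalize cechFace (pairIndex hab) 0 = τ at *
        subst h0
        exact hze b
      have ha : z (cechFace (pairIndex hab) 1) = LocalizedModule.mk (e a)
          ⟨f a ^ D, by rw [h1]; exact pow_mem_cechDenominators (singleIndex a) 0 D⟩ := by
        generalize_proofs hp
        generalize cechFace (pairIndex hab) 1 = τ at *
        subst h1
        exact hze a
      rw [cechD_apply, Fin.sum_univ_two, ha, hb, liftOfLE_mk, liftOfLE_mk, Pi.zero_apply,
        Fin.val_zero, Fin.val_one, pow_zero, pow_one, one_smul, neg_one_smul, ← sub_eq_add_neg,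
        sub_eq_zero, LocalizedModule.mk_eq] at hτ
      obtain ⟨⟨u, hu⟩, hτ⟩ := hτ
      obtain ⟨k, l, rfl⟩ := exists_eq_mul_pow_of_mem_cechDenominators hu
      change (f a ^ k * f b ^ l) • f a ^ D • e b = (f a ^ k * f b ^ l) • f b ^ D • e a at hτ
      refine ⟨k + l, ?_⟩
      have : (f a * f b) ^ (k + l) = (f a ^ l * f b ^ k) * (f a ^ k * f b ^ l) := by ring
      rw [this, mul_smul, hτ, ← mul_smul]
    rintro ⟨a, b⟩
    rcases lt_trichotomy a b with h | rfl | h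
    · exact hlt a b h
    · exact ⟨0, rfl⟩
    · obtain ⟨N, hN⟩ := hlt b a h
      exact ⟨N, by dsimp only; rw [mul_comm (f a)]; exact hN.symm⟩
  obtain ⟨N, hN⟩ := exists_forall_of_finite h2 (by
    rintro ⟨a, b⟩ r r' hr h
    obtain ⟨j, rfl⟩ := Nat.exists_eq_add_of_le' hr
    dsimp only at h ⊢
    rw [pow_add, mul_smul, h, ← mul_smul])
  -- enlarge the exponent so that it is divisible by `c`
  obtain ⟨N', hNN', k, hk⟩ : ∃ N', N + k₀ ≤ N' ∧ c ∣ D + N' := by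
    refine ⟨c * (D + N + k₀) - D, ?_, ?_⟩
    · have := Nat.le_mul_of_pos_left (D + N + k₀) hc
      omega
    · have := Nat.le_mul_of_pos_left (D + N + k₀) hc
      rw [Nat.add_sub_cancel' (by omega)]
      exact dvd_mul_right _ _
  have h3 := H (D + N') (by omega) ⟨k, hk⟩ (fun a => f a ^ N' • e a) (fun a => by
    have := G.map_smul (hf a N') (n + D) (e a)
    rw [he] at this
    push_cast
    rw [← add_assoc]
    exact this) (fun a b => by
    obtain ⟨j, rfl⟩ := Nat.exists_eq_add_of_le' (show N ≤ N' by omega)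
    have := congrArg ((f a * f b) ^ j • ·) (hN (a, b))
    simp only [smul_smul] at this ⊢
    convert this using 2 <;> ring)
  funext σ
  rw [eq_singleIndex σ, hze, Pi.zero_apply, ← LocalizedModule.zero_mk 1, LocalizedModule.mk_eq]
  obtain ⟨L, hL⟩ := h3 (σ 0)
  refine ⟨⟨_, pow_mem_cechDenominators (singleIndex (σ 0)) 0 (L + N')⟩, ?_⟩
  rw [smul_zero, smul_zero, one_smul]
  change f (σ 0) ^ (L + N') • e (σ 0) = 0
  rw [pow_add, mul_smul]
  exact hL

end UnwindingGraded

/-! ### The cohomology of `L^I(M)` in degrees zero and one -/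

section UnwindingLModule

variable {A : Type*} [CommRing A] [IsNoetherianRing A] {I : Ideal A}
  {M : Type*} [AddCommGroup M] [Module A M]

lemma reesGenerators_pow_mem_reesHomogeneous (a : Fin (numGenerators I)) (k : ℕ) :
    reesGenerators I a ^ k ∈ reesHomogeneous I k := ⟨_, coe_reesGenerators_pow a k⟩

lemma pow_smul_lSingle (a : Fin (numGenerators I)) (k n : ℕ) (x : M) :
    reesGenerators I a ^ k • lSingle I n x = lSingle I (k + n) (generators I a ^ k • x) :=
  smul_lSingle (coe_reesGenerators_pow a k) n x

/-- The vanishing of `H^0(L^I(M))` in degree `n - 1`, in terms of elements of `M`. -/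
lemma mem_pow_smul_top_of_HL_zero {n : ℕ} {j : ℤ} (hj : j + 1 = n) (h : HL I M 0 j = ⊥) {x : M}
    (hx : ∀ a, ∃ k : ℕ, generators I a ^ k • x ∈ (I ^ (n + k) • ⊤ : Submodule A M)) :
    x ∈ (I ^ n • ⊤ : Submodule A M) := by
  rw [← lSingle_eq_zero_iff]
  refine eq_zero_of_forall_cocycle_zero (isCechGrading_lModule I M) one_mem_reesHomogeneous
    (HL_eq_bot_iff.1 h) (lProj_lSingle_self hj x) fun a => ?_
  obtain ⟨k, hk⟩ := hx a
  exact ⟨k, by rw [pow_smul_lSingle, lSingle_eq_zero_iff, add_comm]; exact hk⟩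

/-- The vanishing of `H^1(L^I(M))` in degree `n - 1`, in terms of elements of `M`. -/
lemma exists_of_HL_one {n k : ℕ} {j : ℤ} (hj : j + 1 = n) (h : HL I M 1 j = ⊥)
    {x : Fin (numGenerators I) → M}
    (hx : ∀ a b, generators I a ^ k • x b - generators I b ^ k • x a ∈
      (I ^ (n + 2 * k) • ⊤ : Submodule A M)) :
    ∃ y : M, ∃ N₀ : ℕ, ∀ N ≥ N₀, ∀ a, generators I a ^ N • (x a - generators I a ^ k • y) ∈
      (I ^ (n + k + N) • ⊤ : Submodule A M) := by
  obtain ⟨e₀, he₀, H⟩ := exists_of_forall_cocycle_one (isCechGrading_lModule I M)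
    reesGenerators_pow_mem_reesHomogeneous one_mem_reesHomogeneous lProj_lProj
    (HL_eq_bot_iff.1 h) (k := k) (e := fun a => lSingle I (n + k) (x a))
    (fun a => lProj_lSingle_self (by push_cast; omega) (x a)) (fun a b => by
      rw [pow_smul_lSingle, pow_smul_lSingle, ← sub_eq_zero, ← lSingle_sub, lSingle_eq_zero_iff,
        show k + (n + k) = n + 2 * k by ring]
      exact hx a b)
  obtain ⟨y, hy⟩ : ∃ y, e₀ = lSingle I n y := by
    rcases he₀ ▸ lProj_mem j e₀ with rfl | ⟨k', y, hk', rfl⟩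
    · exact ⟨0, (lSingle_eq_zero_iff.2 (zero_mem _)).symm⟩
    · obtain rfl : k' = n := by omega
      exact ⟨y, rfl⟩
  subst hy
  obtain ⟨N₀, hN₀⟩ := exists_forall_of_finite (P := fun a N =>
    generators I a ^ N • (x a - generators I a ^ k • y) ∈ (I ^ (n + k + N) • ⊤ : Submodule A M))
    (fun a => by
      obtain ⟨N, hN⟩ := H a
      refine ⟨N, ?_⟩
      rwa [pow_smul_lSingle, add_comm k n, ← lSingle_sub, pow_smul_lSingle, lSingle_eq_zero_iff,
        add_comm] at hN) (by
      intro a N N' hN h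
      obtain ⟨i, rfl⟩ := Nat.exists_eq_add_of_le' hN
      rw [show n + k + (i + N) = i + (n + k + N) by ring, pow_add (generators I a), mul_smul]
      exact smul_mem_pow_add (Ideal.pow_mem_pow (generators_mem I a) i) h)
  refine ⟨y, N₀, fun N hN a => ?_⟩
  obtain ⟨i, rfl⟩ := Nat.exists_eq_add_of_le' hN
  rw [show n + k + (i + N₀) = i + (n + k + N₀) by ring, pow_add (generators I a), mul_smul]
  exact smul_mem_pow_add (Ideal.pow_mem_pow (generators_mem I a) i) (hN₀ a)

lemma HL_zero_eq_bot_of_neg {j : ℤ} (hj : j < 0) : HL I M 0 j = ⊥ := by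
  refine HL_eq_bot_iff.2 fun z _ hzn => ?_
  have hzero : ∀ e : LModule I M, lProj I M j e = 0 := by
    intro e
    rcases lProj_mem j e with h | ⟨k, y, hk, h⟩
    · exact h
    · rw [h]
      obtain rfl : k = 0 := by omega
      refine lSingle_eq_zero_iff.2 ?_
      simp
  rw [mem_cechBoundaries_zero, ← hzn]
  funext σ
  rw [IsCechGrading.cechProj_apply]
  generalize z σ = x
  induction x using LocalizedModule.induction_on with
  | h e t =>
    obtain rfl : t = 1 := Subtype.ext (eq_one_of_mem_cechDenominators t.2)
    rw [(isCechGrading_lModule I M).locProj_mk _ _ _ _ one_mem_reesHomogeneous, Nat.cast_zero,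
      add_zero, hzero, LocalizedModule.zero_mk]
    rfl

/-- A criterion for the vanishing of `H^1(L^I(M))` in degree `n - 1`. -/
lemma HL_one_eq_bot_of_forall {n : ℤ} {c k₀ : ℕ} (hc : 0 < c)
    (H : ∀ k l : ℕ, k₀ ≤ k → c ∣ k → (l : ℤ) = n + k → ∀ x : Fin (numGenerators I) → M,
      (∀ a b, generators I a ^ k • x b - generators I b ^ k • x a ∈
        (I ^ (l + k) • ⊤ : Submodule A M)) →
      ∀ a, ∃ N : ℕ, generators I a ^ N • x a ∈ (I ^ (l + N) • ⊤ : Submodule A M)) :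
    HL I M 1 (n - 1) = ⊥ := by
  refine HL_eq_bot_iff.2 fun z hz hzn => ?_
  have h : z = 0 := by
    refine eq_zero_of_forall_exists_pow_smul_eq_zero (isCechGrading_lModule I M)
      reesGenerators_pow_mem_reesHomogeneous lProj_lProj hc (k₀ := max k₀ n.natAbs)
      (fun k hk hck e he hfe a => ?_) hz hzn
    obtain ⟨l, hl⟩ := Int.eq_ofNat_of_zero_le (show 0 ≤ n + k by
      have := (le_max_right k₀ n.natAbs).trans hk; omega)
    have hx : ∀ a, ∃ x, e a = lSingle I l x := by
      intro a
      rcases he a ▸ lProj_mem _ (e a) with h | ⟨k', y, hk', h⟩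
      · exact ⟨0, by rw [h, lSingle_eq_zero_iff.2 (zero_mem _)]⟩
      · obtain rfl : k' = l := by omega
        exact ⟨y, h⟩
    choose x hx using hx
    obtain ⟨N, hN⟩ := H k l ((le_max_left _ _).trans hk) hck hl.symm x (fun a b => by
      have := hfe a b
      rwa [hx, hx, pow_smul_lSingle, pow_smul_lSingle, ← sub_eq_zero, ← lSingle_sub,
        lSingle_eq_zero_iff, add_comm k l] at this) a
    exact ⟨N, by rw [hx, pow_smul_lSingle, lSingle_eq_zero_iff, add_comm]; exact hN⟩
  rw [h]
  exact zero_mem _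

end UnwindingLModule

/-! ### Irrelevant ideals -/

section Basics

variable {A : Type*} [CommRing A]

lemma coeff_monomial_mul_eq (d n : ℕ) (a : A) (p : Polynomial A) :
    (Polynomial.monomial d a * p).coeff n = if d ≤ n then a * p.coeff (n - d) else 0 := by
  rw [← Polynomial.C_mul_X_pow_eq_monomial, mul_assoc, Polynomial.coeff_C_mul,
    Polynomial.coeff_X_pow_mul', mul_ite, mul_zero]

/-- A family of elements of `A` lies in `K A ^ r` if and only if its entries lie in `K`. -/
lemma mem_smul_top_pi_iff {K : Ideal A} {r : ℕ} {g : Fin r → A} :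
    g ∈ (K • ⊤ : Submodule A (Fin r → A)) ↔ ∀ i, g i ∈ K := by
  constructor
  · intro h i
    have := Submodule.mem_map_of_mem (f := LinearMap.proj (R := A) (φ := fun _ : Fin r => A) i) h
    rw [Submodule.map_smul''] at this
    exact Submodule.smul_le.2 (fun a ha b _ => Ideal.mul_mem_right _ _ ha) this
  · intro h
    rw [pi_eq_sum_univ g]
    exact sum_mem fun i _ => Submodule.smul_mem_smul (h i) trivial

lemma reesMonomial_mem_reesIrrelevant {J : Ideal A} {a : A} (ha : a ∈ J ^ 1) :
    reesMonomial J ha ∈ reesIrrelevant J := by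
  change (Polynomial.monomial 1 a).coeff 0 = 0
  rw [Polynomial.coeff_monomial, if_neg one_ne_zero]

lemma GIrrelevant_le_radical {J : Ideal A} {ι : Type*} {w : ι → reesAlgebra J}
    (hw : reesIrrelevant J ≤ (Ideal.span (Set.range w)).radical) :
    GIrrelevant J ≤
      (Ideal.span (Set.range fun i => Ideal.Quotient.mk (reesExtension J) (w i))).radical := by
  rw [GIrrelevant, Ideal.map_le_iff_le_comap]
  intro F hF
  obtain ⟨k, hk⟩ := hw hF
  refine ⟨k, ?_⟩
  rw [← map_pow]
  have := Ideal.mem_map_of_mem (Ideal.Quotient.mk (reesExtension J)) hk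
  rwa [Ideal.map_span, ← Set.range_comp] at this

/-- A regular sequence of length two on `A` whose first element is regular on `L` is regular on the
kernel of a homomorphism from a free module to `L`. -/
lemma hasWeaklyRegularSeq_two_of_ker {I : Ideal A} {M L : Type*} [AddCommGroup M]
    [Module A M] [AddCommGroup L] [Module A L] {r : ℕ}
    {f : (Fin r → A) →ₗ[A] L} {ι : M →ₗ[A] (Fin r → A)} (hinj : Function.Injective ι)
    (hι : LinearMap.range ι = LinearMap.ker f) (hA : HasWeaklyRegularSeq I 2 A)
    (hL : ∀ x ∈ I, IsSMulRegular A x → IsSMulRegular L x) : HasWeaklyRegularSeq I 2 M := by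
  obtain ⟨y, hyI, hy, v, hvI, hv⟩ := hasWeaklyRegularSeq_two_iff.1 hA
  have hyM : ∀ g : Fin r → A, ∀ g', y • g = y • g' → g = g' := fun g g' h =>
    funext fun i => hy (congrFun h i)
  refine hasWeaklyRegularSeq_two_iff.2 ⟨y, hyI, fun m m' h => hinj (hyM _ _ ?_), v, hvI,
    fun m m' h => ?_⟩
  · rw [← map_smul, ← map_smul]
    exact congrArg ι h
  · have h' : v • ι m = y • ι m' := by rw [← map_smul, h, map_smul]
    have : ∀ i, ∃ t, ι m i = y • t := fun i => hv _ _ (congrFun h' i)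
    choose g hg using this
    have hg' : ι m = y • g := funext hg
    have hgk : g ∈ LinearMap.range ι := by
      rw [hι, LinearMap.mem_ker]
      refine (hL y hyI hy).right_eq_zero_of_smul ?_
      rw [← map_smul, ← hg', ← LinearMap.mem_ker, ← hι]
      exact ⟨m, rfl⟩
    obtain ⟨m'', rfl⟩ := hgk
    exact ⟨m'', hinj (by rw [hg', map_smul])⟩

end Basics

/-! ### Consequences of `grade(G_J(A)_+, G_J(A)) ≥ 2` for the ring -/

section RingSide

variable {A : Type*} [CommRing A] [IsNoetherianRing A]

lemma reesIrrelevant_le_span (J : Ideal A) :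
    reesIrrelevant J ≤ Ideal.span (Set.range (reesGenerators J)) := by
  intro F hF
  have h0 : (F : Polynomial A).coeff 0 = 0 := hF
  have hF : F = ∑ n ∈ (F : Polynomial A).support, reesMonomial J (F.2 n) := by
    refine Subtype.ext ?_
    rw [AddSubmonoidClass.coe_finsetSum]
    exact (F : Polynomial A).as_sum_support
  rw [hF]
  refine sum_mem fun n hn => ?_
  have hn0 : n ≠ 0 := by
    rintro rfl
    exact Polynomial.mem_support_iff.1 hn h0
  exact Ideal.pow_le_self hn0 (reesMonomial_mem_span_pow (F.2 n))

lemma generators_pow_mem (I : Ideal A) (c l : ℕ) (a : Fin (numGenerators I)) :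
    generators I a ^ (c * l) ∈ (I ^ c) ^ l := by
  rw [← pow_mul]
  exact Ideal.pow_mem_pow (generators_mem I a) _

/-- The elements `x_i ^ (c l) t ^ l` of the Rees ring of `I ^ c`, where `I = (x_1, …, x_m)`. -/
noncomputable def reesPowers (I : Ideal A) (c l : ℕ) (a : Fin (numGenerators I)) :
    reesAlgebra (I ^ c) := reesMonomial (I ^ c) (generators_pow_mem I c l a)

lemma reesIrrelevant_le_radical (I : Ideal A) {c : ℕ} (hc : 0 < c) (l : ℕ) :
    reesIrrelevant (I ^ c) ≤ (Ideal.span (Set.range (reesPowers I c l))).radical := by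
  obtain ⟨c, rfl⟩ := Nat.exists_eq_add_of_le' hc
  have key : ∀ x ∈ I, ∀ z ∈ I ^ c, ∃ h : x * z ∈ (I ^ (c + 1)) ^ 1, reesMonomial (I ^ (c + 1)) h ∈
      (Ideal.span (Set.range (reesPowers I (c + 1) l))).radical := by
    intro x hx
    rw [← span_generators I] at hx
    refine Submodule.span_induction ?_ ?_ ?_ ?_ hx
    · rintro _ ⟨a, rfl⟩ z hz
      have hxz : generators I a * z ∈ (I ^ (c + 1)) ^ 1 := by
        rw [pow_one, pow_succ']
        exact Ideal.mul_mem_mul (generators_mem I a) hz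
      refine ⟨hxz, (c + 1) * l, ?_⟩
      have hz' : z ^ ((c + 1) * l) ∈ (I ^ (c + 1)) ^ (c * l) := by
        have := Ideal.pow_mem_pow hz ((c + 1) * l)
        rw [← pow_mul] at this ⊢
        rwa [show (c + 1) * (c * l) = c * ((c + 1) * l) by ring]
      have h : reesMonomial (I ^ (c + 1)) hxz ^ ((c + 1) * l) =
          reesMonomial (I ^ (c + 1)) hz' * reesPowers I (c + 1) l a := by
        refine Subtype.ext ?_
        rw [SubmonoidClass.coe_pow, Subalgebra.coe_mul, reesPowers, coe_reesMonomial,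
          coe_reesMonomial, coe_reesMonomial, Polynomial.monomial_pow,
          Polynomial.monomial_mul_monomial, mul_pow, mul_comm (z ^ _)]
        congr 2
        ring
      rw [h]
      exact Ideal.mul_mem_left _ _ (Ideal.subset_span ⟨a, rfl⟩)
    · intro z hz
      refine ⟨by rw [zero_mul]; exact zero_mem _, ?_⟩
      convert zero_mem (Ideal.span (Set.range (reesPowers I (c + 1) l))).radical using 1
      refine Subtype.ext ?_
      rw [coe_reesMonomial, zero_mul, map_zero]
      rfl
    · rintro x y - - hx hy z hz
      obtain ⟨hx', hx⟩ := hx z hz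
      obtain ⟨hy', hy⟩ := hy z hz
      refine ⟨by rw [add_mul]; exact add_mem hx' hy', ?_⟩
      convert add_mem hx hy using 1
      refine Subtype.ext ?_
      rw [coe_reesMonomial, add_mul, map_add]
      rfl
    · rintro r x - hx z hz
      obtain ⟨hx', hx⟩ := hx (r * z) (Ideal.mul_mem_left _ _ hz)
      have h : r • x * z = x * (r * z) := by rw [smul_eq_mul]; ring
      refine ⟨by rw [h]; exact hx', ?_⟩
      convert hx using 1
      refine Subtype.ext ?_
      rw [coe_reesMonomial, h]
      rfl
  refine (reesIrrelevant_le_span _).trans (Ideal.span_le.2 ?_)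
  rintro _ ⟨b, rfl⟩
  have hy : ∀ y ∈ I ^ (c + 1), ∃ h : y ∈ (I ^ (c + 1)) ^ 1, reesMonomial (I ^ (c + 1)) h ∈
      (Ideal.span (Set.range (reesPowers I (c + 1) l))).radical := by
    intro y hy
    rw [pow_succ'] at hy
    refine Submodule.mul_induction_on hy key fun x y hx hy => ?_
    obtain ⟨hx', hx⟩ := hx
    obtain ⟨hy', hy⟩ := hy
    refine ⟨add_mem hx' hy', ?_⟩
    convert add_mem hx hy using 1
    exact Subtype.ext (map_add _ _ _)
  exact (hy _ (generators_mem _ b)).2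

/-- Let `G_{I ^ c}(A)_+` have grade at least two. Then the relations `x_i ^ k a_j = x_j ^ k a_i`
modulo a power of `I ^ c`, with `k = c l`, have only trivial solutions in low degrees. -/
lemma mem_pow_of_forall_sub_mem_pow {I : Ideal A} {c : ℕ} (hc : 0 < c)
    (hG : HasWeaklyRegularSeq (GIrrelevant (I ^ c)) 2 (GRing (I ^ c))) {l r : ℕ} (hr : r ≤ l)
    {a : Fin (numGenerators I) → A} (ha : ∀ i j, generators I i ^ (c * l) * a j -
      generators I j ^ (c * l) * a i ∈ (I ^ c) ^ (r + l)) (i : Fin (numGenerators I)) :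
    a i ∈ (I ^ c) ^ r := by
  induction r generalizing i with
  | zero => rw [pow_zero, Ideal.one_eq_top]; trivial
  | succ r ih =>
    have har := ih (by omega) fun i j => Ideal.pow_le_pow_right (by omega) (ha i j)
    obtain ⟨e, he⟩ := exists_eq_smul_of_hasWeaklyRegularSeq hG
      (GIrrelevant_le_radical (reesIrrelevant_le_radical I hc l))
      (n := fun i => Ideal.Quotient.mk (reesExtension (I ^ c)) (reesMonomial _ (har i)))
      (fun i j => by
        rw [smul_eq_mul, smul_eq_mul, ← map_mul, ← map_mul, Ideal.Quotient.eq,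
          mem_reesExtension_iff]
        intro n
        rw [AddSubgroupClass.coe_sub, Subalgebra.coe_mul, Subalgebra.coe_mul, reesPowers,
          reesPowers,
          coe_reesMonomial, coe_reesMonomial, coe_reesMonomial, coe_reesMonomial,
          Polynomial.monomial_mul_monomial, Polynomial.monomial_mul_monomial, ← map_sub,
          Polynomial.coeff_monomial]
        split_ifs with h
        · rw [← h, show l + r + 1 = r + 1 + l by ring]
          exact ha i j
        · exact zero_mem _)
    obtain ⟨F, rfl⟩ := Ideal.Quotient.mk_surjective e
    have h := he i
    rw [smul_eq_mul, ← map_mul, Ideal.Quotient.eq, mem_reesExtension_iff] at h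
    have h' := h r
    rw [AddSubgroupClass.coe_sub, Subalgebra.coe_mul, reesPowers, coe_reesMonomial,
      coe_reesMonomial, Polynomial.coeff_sub, Polynomial.coeff_monomial_same,
      coeff_monomial_mul_eq, if_neg (by omega), sub_zero] at h'
    exact h'

/-- The grade of `J` on `A` is at least two if the grade of `G_J(A)_+` is. -/
theorem hasWeaklyRegularSeq_two_of_GRing [IsLocalRing A] {J : Ideal A}
    (hJ : J ≤ IsLocalRing.maximalIdeal A)
    (hG : HasWeaklyRegularSeq (GIrrelevant J) 2 (GRing J)) : HasWeaklyRegularSeq J 2 A := by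
  have hJ' : J ≠ ⊤ := fun h => (IsLocalRing.maximalIdeal.isMaximal A).ne_top (top_le_iff.1 (h ▸ hJ))
  have hrad := GIrrelevant_le_radical ((reesIrrelevant_le_span J).trans Ideal.le_radical)
  refine hasWeaklyRegularSeq_two_of_forall_exists (w := generators J) (generators_mem J) ?_ ?_
  · intro a ha
    have key : ∀ n, a ∈ J ^ n := by
      intro n
      induction n with
      | zero => rw [pow_zero, Ideal.one_eq_top]; trivial
      | succ n ih =>
        have h := eq_zero_of_hasWeaklyRegularSeq hG hrad
          (n := Ideal.Quotient.mk (reesExtension J) (reesMonomial J ih)) (fun i => by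
            rw [smul_eq_mul, ← map_mul]
            convert map_zero (Ideal.Quotient.mk (reesExtension J))
            refine Subtype.ext ?_
            rw [Subalgebra.coe_mul, coe_reesGenerators, coe_reesMonomial,
              Polynomial.monomial_mul_monomial]
            have := ha i
            rw [smul_eq_mul] at this
            rw [this, map_zero]
            rfl)
        rw [Ideal.Quotient.eq_zero_iff_mem, mem_reesExtension_iff] at h
        have h' := h n
        rwa [coe_reesMonomial, Polynomial.coeff_monomial_same] at h'
    have h := (Ideal.iInf_pow_eq_bot_of_isLocalRing J hJ').le
      ((Submodule.mem_iInf _).2 key)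
    exact h
  · intro a ha
    have key : ∀ n, ∃ e, ∀ b, a b - generators J b * e ∈ J ^ n := by
      intro n
      induction n with
      | zero => exact ⟨0, fun b => by rw [pow_zero, Ideal.one_eq_top]; trivial⟩
      | succ n ih =>
        obtain ⟨e, he⟩ := ih
        obtain ⟨F, hF⟩ := exists_eq_smul_of_hasWeaklyRegularSeq hG hrad
          (n := fun b => Ideal.Quotient.mk (reesExtension J) (reesMonomial J (he b)))
          (fun i j => by
            rw [smul_eq_mul, smul_eq_mul, ← map_mul, ← map_mul]
            congr 1
            refine Subtype.ext ?_
            rw [Subalgebra.coe_mul, Subalgebra.coe_mul, coe_reesGenerators, coe_reesGenerators,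
              coe_reesMonomial, coe_reesMonomial, Polynomial.monomial_mul_monomial,
              Polynomial.monomial_mul_monomial, mul_sub, mul_sub]
            have := ha i j
            rw [smul_eq_mul, smul_eq_mul] at this
            rw [this, mul_left_comm])
        obtain ⟨F, rfl⟩ := Ideal.Quotient.mk_surjective F
        refine ⟨e + if 1 ≤ n then (F : Polynomial A).coeff (n - 1) else 0, fun b => ?_⟩
        have h := hF b
        rw [smul_eq_mul, ← map_mul, Ideal.Quotient.eq, mem_reesExtension_iff] at h
        have h' := h n
        rw [AddSubgroupClass.coe_sub, Subalgebra.coe_mul, coe_reesGenerators,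
          coe_reesMonomial, Polynomial.coeff_sub, Polynomial.coeff_monomial_same,
          coeff_monomial_mul_eq] at h'
        rw [mul_add, ← sub_sub]
        split_ifs at h' ⊢ with hn
        · exact h'
        · rwa [mul_zero]
    -- by Krull's intersection theorem the submodule of the multiples of the generators is closed
    have hcl := Ideal.iInf_pow_smul_eq_bot_of_isLocalRing
      (M := (Fin (numGenerators J) → A) ⧸ Submodule.span A {generators J}) J hJ'
    have hmem : (Submodule.span A {generators J}).mkQ a ∈
        ⨅ n : ℕ, (J ^ n • ⊤ : Submodule A
          ((Fin (numGenerators J) → A) ⧸ Submodule.span A {generators J})) := by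
      rw [Submodule.mem_iInf]
      intro n
      obtain ⟨e, he⟩ := key n
      have h1 : a - e • generators J ∈ (J ^ n • ⊤ : Submodule A (Fin (numGenerators J) → A)) := by
        rw [mem_smul_top_pi_iff]
        intro b
        rw [Pi.sub_apply, Pi.smul_apply, smul_eq_mul, mul_comm]
        exact he b
      have h2 := Submodule.mem_map_of_mem (f := (Submodule.span A {generators J}).mkQ) h1
      have h3 : (Submodule.span A {generators J}).mkQ (e • generators J) = 0 := by
        rw [Submodule.mkQ_apply, Submodule.Quotient.mk_eq_zero]
        exact Submodule.smul_mem _ _ (Submodule.mem_span_singleton_self _)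
      rw [Submodule.map_smul'', map_sub, h3, sub_zero] at h2
      exact Submodule.smul_mono le_rfl le_top h2
    rw [hcl, Submodule.mem_bot, Submodule.mkQ_apply, Submodule.Quotient.mk_eq_zero,
      Submodule.mem_span_singleton] at hmem
    obtain ⟨e, he⟩ := hmem
    refine ⟨e, fun b => ?_⟩
    rw [← he, Pi.smul_apply, smul_eq_mul, smul_eq_mul, mul_comm]

end RingSide

/-! ### Consequences of `grade(G_J(A)_+, G_J(A)) ≥ 2` for a syzygy -/

section SyzygySide

variable {A : Type*} [CommRing A] [IsNoetherianRing A] {I : Ideal A}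
  {M : Type*} [AddCommGroup M] [Module A M]

/-- Let `G_{I ^ c}(A)_+` have grade at least two, and let `M` be a submodule of a free module `F`
such that `I ^ n M` is the intersection of `M` and `I ^ n F` for `n` large. Then `H^1(L^I(M))`
vanishes in the degrees `-1` and `-c - 1`. -/
lemma HL_one_eq_bot_of_GRing {c : ℕ} (hc : 0 < c)
    (hG : HasWeaklyRegularSeq (GIrrelevant (I ^ c)) 2 (GRing (I ^ c))) {r : ℕ}
    {ι : M →ₗ[A] (Fin r → A)} (hι : ∀ᶠ n in atTop, ∀ m,
      ι m ∈ (I ^ n • ⊤ : Submodule A (Fin r → A)) → m ∈ (I ^ n • ⊤ : Submodule A M))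
    {ε : ℕ} (hε : ε ≤ 1) : HL I M 1 (-(c * ε : ℕ) - 1) = ⊥ := by
  refine HL_one_eq_bot_of_forall hc (k₀ := c) ?_
  rintro _ l hk ⟨l₀, rfl⟩ hl x hx a
  have hl₀ : 1 ≤ l₀ := by
    by_contra h
    obtain rfl : l₀ = 0 := by omega
    omega
  have hlc : l = c * (l₀ - ε) := by
    zify [hε.trans hl₀]
    rw [hl]
    push_cast
    ring
  have hxF : ι (x a) ∈ (I ^ l • ⊤ : Submodule A (Fin r → A)) := by
    rw [mem_smul_top_pi_iff]
    intro s
    rw [hlc, pow_mul]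
    refine mem_pow_of_forall_sub_mem_pow hc hG (l := l₀) (r := l₀ - ε) (by omega)
      (a := fun b => ι (x b) s) (fun i j => ?_) a
    have h1 := Submodule.mem_map_of_mem (f := ι) (hx i j)
    rw [Submodule.map_smul''] at h1
    have h2 := mem_smul_top_pi_iff.1 (Submodule.smul_mono le_rfl le_top h1) s
    rw [map_sub, map_smul, map_smul] at h2
    rw [← pow_mul, mul_add, ← hlc]
    exact h2
  obtain ⟨n₀, hn₀⟩ := eventually_atTop.1 hι
  refine ⟨n₀, hn₀ (l + n₀) (by omega) _ ?_⟩
  rw [map_smul, add_comm]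
  exact smul_mem_pow_add (Ideal.pow_mem_pow (generators_mem I a) _) hxF

end SyzygySide

/-! ### The grade on `G_J(M)` -/

lemma finite_quotient_smul_top {R : Type*} [CommRing R] (K : Ideal R) (N : Type*) [AddCommGroup N]
    [Module R N] [Module.Finite R N] : Module.Finite (R ⧸ K) (N ⧸ (K • ⊤ : Submodule R N)) :=
  Module.Finite.of_restrictScalars_finite R _ _

lemma mk_smul_mk_quotient_smul_top {R : Type*} [CommRing R] (K : Ideal R) {N : Type*}
    [AddCommGroup N] [Module R N] (r : R) (x : N) :
    Ideal.Quotient.mk K r • (Submodule.Quotient.mk x : N ⧸ (K • ⊤ : Submodule R N)) =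
      Submodule.Quotient.mk (r • x) := rfl

lemma coeff_sub_apply {R N : Type*} [CommRing R] [AddCommGroup N] [Module R N]
    (F F' : PolynomialModule R N) (n : ℕ) : (F - F').coeff n = F.coeff n - F'.coeff n := rfl

lemma coeff_reesMonomial_smul {A : Type*} [CommRing A] {M : Type*} [AddCommGroup M] [Module A M]
    {J : Ideal A} {y : A} (hy : y ∈ J ^ 1) (F : reesModule J M) (p : ℕ) :
    ((reesMonomial J hy • F : reesModule J M) : PolynomialModule A M).coeff p =
      if 1 ≤ p then y • (F : PolynomialModule A M).coeff (p - 1) else 0 := by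
  rw [Submodule.coe_smul, smul_coeff_of_mem_reesHomogeneous (coe_reesMonomial _)]

section GModuleGrade

variable {A : Type*} [CommRing A] [IsNoetherianRing A] {I : Ideal A}
  {M : Type*} [AddCommGroup M] [Module A M]

lemma mem_pow_pow_smul_top_of_HL_zero {c : ℕ} (h0 : ∀ p : ℕ, HL I M 0 ((c * p : ℕ) - 1) = ⊥) (p : ℕ)
    {x : M} (hx : ∀ a, ∃ k : ℕ, generators I a ^ k • x ∈ (I ^ (c * p + k) • ⊤ : Submodule A M)) :
    x ∈ ((I ^ c) ^ p • ⊤ : Submodule A M) := by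
  rw [← pow_mul]
  exact mem_pow_smul_top_of_HL_zero (by ring) (h0 p) hx

lemma generators_pow_smul_mem {n : ℕ} {x : M} (a : Fin (numGenerators I)) (k : ℕ)
    (hx : x ∈ (I ^ n • ⊤ : Submodule A M)) :
    generators I a ^ k • x ∈ (I ^ (k + n) • ⊤ : Submodule A M) :=
  smul_mem_pow_add (Ideal.pow_mem_pow (generators_mem I a) k) hx

/-- A family `z y`, for `y` in `I ^ c`, that satisfies the cocycle relations in the component of
degree `p + 1` of `G_{I ^ c}(M)`, and agrees with the family `y • e` at the elements `x_i ^ c` up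
to torsion, agrees with it everywhere. -/
lemma sub_smul_mem_of_HL_zero {c : ℕ} (h0 : ∀ p : ℕ, HL I M 0 ((c * p : ℕ) - 1) = ⊥) {p : ℕ}
    {z : A → M} (hz : ∀ y ∈ I ^ c, z y ∈ ((I ^ c) ^ p • ⊤ : Submodule A M))
    (hcoc : ∀ y ∈ I ^ c, ∀ y' ∈ I ^ c,
      y • z y' - y' • z y ∈ ((I ^ c) ^ (p + 2) • ⊤ : Submodule A M)) {e : M} {N : ℕ}
    (he : ∀ a, generators I a ^ N • (z (generators I a ^ c) - generators I a ^ c • e) ∈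
      (I ^ (c * p + c + N) • ⊤ : Submodule A M)) :
    (∀ q, p = q + 1 → e ∈ ((I ^ c) ^ q • ⊤ : Submodule A M)) ∧
      ∀ y ∈ I ^ c, z y - y • e ∈ ((I ^ c) ^ (p + 1) • ⊤ : Submodule A M) := by
  have hxc : ∀ a, generators I a ^ c ∈ I ^ c := fun a => Ideal.pow_mem_pow (generators_mem I a) c
  constructor
  · rintro q rfl
    refine mem_pow_pow_smul_top_of_HL_zero h0 q fun a => ⟨N + c, ?_⟩
    have h1 := hz _ (hxc a)
    rw [← pow_mul] at h1
    have h2 := generators_pow_smul_mem a N h1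
    have h3 : generators I a ^ (N + c) • e = generators I a ^ N • z (generators I a ^ c) -
        generators I a ^ N • (z (generators I a ^ c) - generators I a ^ c • e) := by
      rw [smul_sub, sub_sub_cancel, smul_smul, pow_add]
    rw [h3, show c * q + (N + c) = N + c * (q + 1) by ring]
    refine sub_mem h2 (Submodule.smul_mono_left (Ideal.pow_le_pow_right ?_) (he a))
    omega
  · intro y hy
    refine mem_pow_pow_smul_top_of_HL_zero h0 (p + 1) fun a => ⟨N + c, ?_⟩
    have h1 := hcoc _ (hxc a) y hy
    rw [← pow_mul] at h1
    have h2 := generators_pow_smul_mem a N h1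
    have h3 := smul_mem_pow_add hy (he a)
    rw [show c * (p + 1) + (N + c) = N + c * (p + 2) by ring]
    rw [show c + (c * p + c + N) = N + c * (p + 2) by ring] at h3
    convert add_mem h2 h3 using 1
    simp only [smul_sub, smul_smul, pow_add]
    rw [mul_comm y (generators I a ^ N), mul_comm y (_ * _), sub_add_sub_cancel]

/-- The grade of `G_J(A)_+` on `G_J(M)` is at least two if the Koszul cohomology of `G_J(M)` with
respect to the elements `y t`, for `y` in `J`, vanishes in degrees zero and one. -/
lemma hasWeaklyRegularSeq_two_GModule_of_forall [Module.Finite A M] {J : Ideal A}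
    (h0 : ∀ (p : ℕ) (x : M), (∀ y ∈ J, y • x ∈ (J ^ (p + 2) • ⊤ : Submodule A M)) →
      x ∈ (J ^ (p + 1) • ⊤ : Submodule A M))
    (h1 : ∀ F : J → reesModule J M, (∀ y y' : J, ∀ p : ℕ,
        (y : A) • (F y' : PolynomialModule A M).coeff p -
          (y' : A) • (F y : PolynomialModule A M).coeff p ∈ (J ^ (p + 2) • ⊤ : Submodule A M)) →
      ∃ E : reesModule J M, ∀ (y : J) (p : ℕ), (F y : PolynomialModule A M).coeff p -
        (if 1 ≤ p then (y : A) • (E : PolynomialModule A M).coeff (p - 1) else 0) ∈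
          (J ^ (p + 1) • ⊤ : Submodule A M)) :
    HasWeaklyRegularSeq (GIrrelevant J) 2 (GModule J M) := by
  have : Module.Finite (GRing J) (GModule J M) := finite_quotient_smul_top _ _
  have hm : ∀ y : J, (y : A) ∈ J ^ 1 := fun y => by rw [pow_one]; exact y.2
  refine hasWeaklyRegularSeq_two_of_forall_exists
    (w := fun y : J => Ideal.Quotient.mk (reesExtension J) (reesMonomial J (hm y)))
    (fun y => Ideal.mem_map_of_mem _ (reesMonomial_mem_reesIrrelevant _)) ?_ ?_
  · intro n hn
    obtain ⟨F, rfl⟩ := Submodule.Quotient.mk_surjective _ n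
    rw [Submodule.Quotient.mk_eq_zero, mem_reesExtension_smul_top_iff]
    intro p
    refine h0 p _ fun y hy => ?_
    have h := hn ⟨y, hy⟩
    rw [mk_smul_mk_quotient_smul_top, Submodule.Quotient.mk_eq_zero,
      mem_reesExtension_smul_top_iff] at h
    have h' := h (p + 1)
    rwa [coeff_reesMonomial_smul, if_pos (by omega), Nat.add_sub_cancel] at h'
  · intro n hn
    have hF : ∀ y, ∃ F : reesModule J M, Submodule.Quotient.mk F = n y :=
      fun y => Submodule.Quotient.mk_surjective _ (n y)
    choose F hF using hF
    obtain ⟨E, hE⟩ := h1 F fun y y' p => by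
      have h := hn y y'
      rw [← hF, ← hF, mk_smul_mk_quotient_smul_top, mk_smul_mk_quotient_smul_top,
        Submodule.Quotient.eq, mem_reesExtension_smul_top_iff] at h
      have h' := h (p + 1)
      rwa [AddSubgroupClass.coe_sub, coeff_sub_apply,
        coeff_reesMonomial_smul, coeff_reesMonomial_smul, if_pos (by omega), if_pos (by omega),
        Nat.add_sub_cancel] at h'
    refine ⟨Submodule.Quotient.mk E, fun y => ?_⟩
    rw [← hF, mk_smul_mk_quotient_smul_top, Submodule.Quotient.eq, mem_reesExtension_smul_top_iff]
    intro p
    rw [AddSubgroupClass.coe_sub, coeff_sub_apply,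
      coeff_reesMonomial_smul]
    exact hE y p

/-- The vanishing of `H^0(L^I(M))` and `H^1(L^I(M))` in the degrees `c p - 1`, `p ≥ 0`, implies that
the grade of `G_{I ^ c}(A)_+` on `G_{I ^ c}(M)` is at least two. -/
theorem hasWeaklyRegularSeq_two_GModule [Module.Finite A M] {c : ℕ}
    (h0 : ∀ p : ℕ, HL I M 0 ((c * p : ℕ) - 1) = ⊥)
    (h1 : ∀ p : ℕ, HL I M 1 ((c * p : ℕ) - 1) = ⊥) :
    HasWeaklyRegularSeq (GIrrelevant (I ^ c)) 2 (GModule (I ^ c) M) := by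
  have hxc : ∀ a, generators I a ^ c ∈ I ^ c := fun a => Ideal.pow_mem_pow (generators_mem I a) c
  refine hasWeaklyRegularSeq_two_GModule_of_forall ?_ ?_
  · intro p x hx
    refine mem_pow_pow_smul_top_of_HL_zero h0 (p + 1) fun a => ⟨c, ?_⟩
    have h := hx _ (hxc a)
    rwa [← pow_mul] at h
  · intro F hcoc
    obtain ⟨P, hP⟩ := exists_forall_of_finite
      (P := fun (a : Fin (numGenerators I)) P =>
        ∀ p ≥ P, (F ⟨_, hxc a⟩ : PolynomialModule A M).coeff p = 0)
      (fun a => by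
        obtain ⟨B, hB⟩ := (F ⟨_, hxc a⟩ : PolynomialModule A M).coeff.support.bddAbove
        refine ⟨B + 1, fun p hp => ?_⟩
        by_contra h
        have := hB (Finsupp.mem_support_iff.2 h)
        omega) (fun a N N' hN h p hp => h p (hN.trans hp))
    have key : ∀ p : ℕ, ∃ e : M, (∀ q, p = q + 1 → e ∈ ((I ^ c) ^ q • ⊤ : Submodule A M)) ∧
        (∀ y, (F y : PolynomialModule A M).coeff p - (y : A) • e ∈
          ((I ^ c) ^ (p + 1) • ⊤ : Submodule A M)) ∧ (P ≤ p → e = 0) := by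
      intro p
      classical
      let z : A → M := fun y =>
        if hy : y ∈ I ^ c then (F ⟨y, hy⟩ : PolynomialModule A M).coeff p else 0
      have hz : ∀ y (hy : y ∈ I ^ c), z y = (F ⟨y, hy⟩ : PolynomialModule A M).coeff p :=
        fun y hy => dif_pos hy
      have hz1 : ∀ y ∈ I ^ c, z y ∈ ((I ^ c) ^ p • ⊤ : Submodule A M) := fun y hy => by
        rw [hz y hy]; exact (F ⟨y, hy⟩).2 p
      have hz2 : ∀ y ∈ I ^ c, ∀ y' ∈ I ^ c,
          y • z y' - y' • z y ∈ ((I ^ c) ^ (p + 2) • ⊤ : Submodule A M) := fun y hy y' hy' => by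
        rw [hz y hy, hz y' hy']; exact hcoc ⟨y, hy⟩ ⟨y', hy'⟩ p
      by_cases hpP : P ≤ p
      · obtain ⟨-, h⟩ := sub_smul_mem_of_HL_zero h0 hz1 hz2 (e := 0) (N := 0) (fun a => by
          rw [hz _ (hxc a), hP a p hpP, smul_zero, sub_zero, smul_zero]
          exact zero_mem _)
        refine ⟨0, fun _ _ => zero_mem _, fun y => ?_, fun _ => rfl⟩
        rw [← hz y y.2]
        exact h y y.2
      · obtain ⟨e, N, he⟩ := exists_of_HL_one (by ring) (h1 p) (k := c)
          (x := fun a => z (generators I a ^ c)) (fun a b => by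
            have := hz2 _ (hxc a) _ (hxc b)
            rwa [← pow_mul, show c * (p + 2) = c * p + 2 * c by ring] at this)
        obtain ⟨h, h'⟩ := sub_smul_mem_of_HL_zero h0 hz1 hz2 (he N le_rfl)
        exact ⟨e, h, fun y => by rw [← hz y y.2]; exact h' y y.2, fun h => absurd h hpP⟩
    choose e he1 he2 he3 using key
    let E : reesModule (I ^ c) M := ∑ q ∈ Finset.range P,
      ⟨PolynomialModule.single A q (e (q + 1)), single_mem_reesModule_iff.2 (he1 _ q rfl)⟩
    have hE : ∀ q, (E : PolynomialModule A M).coeff q = e (q + 1) := by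
      intro q
      rw [AddSubmonoidClass.coe_finsetSum, PolynomialModule.coeff_sum, Finsupp.finsetSum_apply]
      by_cases hq : q < P
      · rw [Finset.sum_eq_single q (fun b _ hb => coeff_single_of_ne hb _)
          (fun h => absurd (Finset.mem_range.2 hq) h), coeff_single_self]
      · rw [he3 _ (by omega)]
        refine Finset.sum_eq_zero fun b hb => coeff_single_of_ne ?_ _
        have := Finset.mem_range.1 hb
        omega
    refine ⟨E, fun y p => ?_⟩
    rcases p with _ | p
    · rw [if_neg (by omega), sub_zero]
      have h := he2 0 y
      have h' : (y : A) • e 0 ∈ ((I ^ c) ^ (0 + 1) • ⊤ : Submodule A M) :=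
        Submodule.smul_mem_smul (by rw [zero_add, pow_one]; exact y.2) trivial
      have := add_mem h h'
      rwa [sub_add_cancel] at this
    · rw [if_pos (by omega), Nat.add_sub_cancel, hE]
      exact he2 (p + 1) y

end GModuleGrade

/-! ### The unit ideal -/

section UnitIdeal

variable {A : Type*} [CommRing A] {M : Type*} [AddCommGroup M] [Module A M]

lemma hasWeaklyRegularSeq_of_subsingleton {R : Type*} [CommRing R] (J : Ideal R) (k : ℕ)
    (N : Type*) [AddCommGroup N] [Module R N] [Subsingleton N] : HasWeaklyRegularSeq J k N := by
  induction k generalizing N with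
  | zero => exact hasWeaklyRegularSeq_zero
  | succ k ih =>
    have : Subsingleton (QuotSMulTop (0 : R) N) :=
      (Submodule.Quotient.mk_surjective _).subsingleton
    exact hasWeaklyRegularSeq_succ_iff.2
      ⟨0, zero_mem _, Function.injective_of_subsingleton _, ih _⟩

variable (M)

lemma subsingleton_gModule_top (n : ℕ) : Subsingleton (GModule ((⊤ : Ideal A) ^ n) M) := by
  refine Submodule.Quotient.subsingleton_iff.2 (Submodule.eq_top_iff'.2 fun F => ?_)
  rw [mem_reesExtension_smul_top_iff]
  intro k
  have h : ((⊤ : Ideal A) ^ n) ^ (k + 1) = ⊤ := by rw [Ideal.top_pow, Ideal.top_pow]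
  rw [h, Submodule.top_smul]
  trivial

lemma amp_top [IsNoetherianRing A] : amp (⊤ : Ideal A) M = 0 := by
  have : Subsingleton (LModule (⊤ : Ideal A) M) := by
    refine Submodule.Quotient.subsingleton_iff.2 (Submodule.eq_top_iff'.2 fun F => ?_)
    rw [mem_reesModule_iff]
    intro k
    rw [Ideal.top_pow, Submodule.top_smul]
    trivial
  have hz : ∀ i (z : CechModule (reesGenerators (⊤ : Ideal A)) (LModule (⊤ : Ideal A) M) i),
      z = 0 := by
    intro i z
    funext σ
    generalize z σ = x
    induction x using LocalizedModule.induction_on with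
    | h e t => rw [Subsingleton.elim e 0, LocalizedModule.zero_mk]; rfl
  refine le_antisymm (sSup_le ?_) bot_le
  rintro _ ⟨n, i, -, -, h⟩
  exact absurd (HL_eq_bot_iff.2 fun z _ _ => by rw [hz i z]; exact zero_mem _) h

end UnitIdeal

/-! ### The bound for `ξ_I(M)` -/

section Xi

variable {A : Type*} [CommRing A] [IsNoetherianRing A] {I : Ideal A}
  {M : Type*} [AddCommGroup M] [Module A M]

/-- The cohomology of degree zero vanishes in all negative degrees, so that only the degree one is
to be controlled. -/
lemma two_le_xi [Module.Finite A M] (hgr : HasWeaklyRegularSeq I 2 M) (h0 : HL I M 1 (-1) = ⊥)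
    {c₀ : ℕ} (h1 : ∀ c : ℕ, c₀ ≤ c → HL I M 1 (-c - 1) = ⊥) : 2 ≤ xi I M := by
  refine le_sInf ?_
  rintro _ (rfl | ⟨i, rfl, hi, h⟩)
  · exact (le_grade_iff (k := 2)).2 hgr
  · by_contra hlt
    have hi2 : i < 2 := by
      rw [not_le] at hlt
      exact_mod_cast hlt
    interval_cases i
    · rcases h with h | h
      · exact h (HL_zero_eq_bot_of_neg (by omega))
      · refine h (Set.finite_empty.subset fun j hj => ?_)
        exact hj.2 (HL_zero_eq_bot_of_neg hj.1)
    · rcases h with h | h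
      · exact h h0
      · refine h ((Set.finite_Icc (-(c₀ : ℤ)) 0).subset fun j hj => ⟨?_, hj.1.le⟩)
        by_contra hlt
        refine hj.2 ?_
        have := h1 (-j - 1).toNat (by omega)
        rwa [show -((-j - 1).toNat : ℤ) - 1 = j by omega] at this

lemma HL_eq_bot_of_amp_lt {i n : ℕ} (hi : (i : ℕ∞) < xi I M) (hn : amp I M < n) {p : ℕ} :
    HL I M i ((n * p : ℕ) - 1) = ⊥ := by
  rcases p with _ | p
  · simpa using (HL_eq_bot_of_lt_xi hi).1
  · by_contra h
    have h1 : (((n * (p + 1) : ℕ) : ℤ).natAbs : ℕ∞) ≤ amp I M := le_sSup ⟨_, i, rfl, hi, h⟩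
    have h2 : n * (p + 1) < n := by
      rw [Int.natAbs_natCast] at h1
      exact_mod_cast h1.trans_lt hn
    exact absurd h2 (not_lt.2 (Nat.le_mul_of_pos_right n (Nat.succ_pos p)))

end Xi

end AsymptoticGrade

open AsymptoticGrade in
theorem theorem4p1 {A : Type*} [CommRing A] [IsLocalRing A] [IsNoetherianRing A]
    [Infinite (IsLocalRing.ResidueField A)]
    (hCM : AsymptoticGrade.IsCohenMacaulayLocalRing A) (hreg : ¬ IsRegularLocalRing A)
    {L : Type*} [AddCommGroup L] [Module A L] (hL : AsymptoticGrade.IsMaximalCohenMacaulay A L)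
    {M : Type*} [AddCommGroup M] [Module A M] [Nontrivial M]
    (hM : AsymptoticGrade.IsFirstSyzygy A L M)
    (hfree : AsymptoticGrade.IsFreeOnPuncturedSpectrum A M)
    (I : Ideal A)
    (hI : ∀ᶠ n : ℕ in Filter.atTop,
      2 ≤ AsymptoticGrade.grade (AsymptoticGrade.GIrrelevant (I ^ n))
        (AsymptoticGrade.GRing (I ^ n)))
    (hass : IsLocalRing.maximalIdeal A ∉ AsymptoticGrade.assInfty I M) :
    AsymptoticGrade.amp I M < ⊤ ∧
      ∀ n : ℕ, AsymptoticGrade.amp I M < n →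
        2 ≤ AsymptoticGrade.grade (AsymptoticGrade.GIrrelevant (I ^ n))
          (AsymptoticGrade.GModule (I ^ n) M) := by
  rcases eq_or_ne I ⊤ with rfl | hItop
  · refine ⟨by rw [amp_top]; exact ENat.natCast_lt_top 0, fun n _ => ?_⟩
    have := subsingleton_gModule_top (A := A) M n
    exact (le_grade_iff (k := 2)).2 (hasWeaklyRegularSeq_of_subsingleton _ 2 _)
  have hIm : I ≤ IsLocalRing.maximalIdeal A := IsLocalRing.le_maximalIdeal hItop
  obtain ⟨r, f, hf, -, ⟨φ⟩⟩ := hM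
  have hfin : Module.Finite A M := Module.Finite.equiv φ.symm
  let ι : M →ₗ[A] (Fin r → A) := (LinearMap.ker f).subtype.comp φ.toLinearMap
  have hinj : Function.Injective ι := Subtype.val_injective.comp φ.injective
  have hι : LinearMap.range ι = LinearMap.ker f := by
    rw [LinearMap.range_comp, LinearEquiv.range, Submodule.map_top, Submodule.range_subtype]
  have hT := eventually_mem_smul_top_of_syzygy hCM hL hf hinj hι hfree hass
  obtain ⟨c₀, hc₀⟩ := eventually_atTop.1 hI
  have hG : ∀ c, c₀ ≤ c → HasWeaklyRegularSeq (GIrrelevant (I ^ c)) 2 (GRing (I ^ c)) :=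
    fun c hc => (le_grade_iff (k := 2)).1 (hc₀ c hc)
  have hA : HasWeaklyRegularSeq I 2 A :=
    (hasWeaklyRegularSeq_two_of_GRing ((Ideal.pow_le_self (Nat.succ_ne_zero c₀)).trans hIm)
      (hG (c₀ + 1) (Nat.le_succ _))).mono (Ideal.pow_le_self (Nat.succ_ne_zero c₀))
  obtain ⟨d, hd, -, hLd⟩ := exists_hasWeaklyRegularSeq_maximalIdeal hCM hL
  have : Module.Finite A L := hL.1
  have hgr : HasWeaklyRegularSeq I 2 M := hasWeaklyRegularSeq_two_of_ker hinj hι hA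
    fun x _ hx => isSMulRegular_of_ringKrullDim_le hd hLd hx
  have hxi : 2 ≤ xi I M := by
    refine two_le_xi hgr ?_ (c₀ := c₀ + 1) fun c hc => ?_
    · have := HL_one_eq_bot_of_GRing (Nat.succ_pos c₀) (hG _ (Nat.le_succ c₀)) hT zero_le_one
      rwa [mul_zero, Nat.cast_zero, neg_zero, zero_sub] at this
    · have := HL_one_eq_bot_of_GRing (by omega) (hG c (by omega)) hT le_rfl
      rwa [mul_one] at this
  refine ⟨amp_lt_top hIm, fun n hn => (le_grade_iff (k := 2)).2 ?_⟩
  exact hasWeaklyRegularSeq_two_GModule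
    (fun p => HL_eq_bot_of_amp_lt (lt_of_lt_of_le (by norm_num) hxi) hn)
    (fun p => HL_eq_bot_of_amp_lt (lt_of_lt_of_le (by norm_num) hxi) hn)
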